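/- **Setting.** A para-Kähler manifold is a pseudo-Riemannian manifold $(\widetilde M,\widetilde g)$ with a smooth $(1,1)$-tensor field $\mathcal P\neq\pm I$ such that $\mathcal P^2=I$, $\widetilde g(\mathcal PX,\mathcal PY)=-\widetilde g(X,Y)$ and $\widetilde\nabla\mathcal P=0$, where $\widetilde\nabla$ is the Levi-Civita connection. An immersed pseudo-Riemannian submanifold $M$ of $\widetilde M$ (with nondegenerate induced metric $g$) is a $\mathcal PR$-submanifold if $TM=\mathcal D\oplus\mathcal D^\perp$ with $\mathcal P\mathcal D=\mathcal D$ and $\mathcal P\mathcal D^\perp\subseteq T^\perp M$; it is proper if $\mathcal D$ and $\mathcal D^\perp$ are both nonzero. For $X$ tangent to $M$, $PX$ and $FX$ denote the tangential and the normal part of $\mathcal PX$. For a normal vector field $\xi$, the shape operator $A_\xi$ is defined by letting $-A_\xi X$ be the tangential part of $\widetilde\nabla_X\xi$. An open subset $U$ of $M$ is a *$\mathcal PR$-warped product with warping function $\lambda:U\to\mathbb R_{+}$* if there are pseudo-Riemannian manifolds $N_\top,N_\perp$, a smooth function $f:N_\top\to\mathbb R_+$ and an isometry $\Psi$ from the warped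 product $(N_\top\times N_\perp,\ g_\top+f^2g_\perp)$ onto $(U,g)$ such that each $N_\top\times\{c\}$ is an invariant submanifold of $\widetilde M$ ($\mathcal P$ preserves its tangent spaces), each $\{b\}\times N_\perp$ is an anti-invariant submanifold of $\widetilde M$ ($\mathcal P$ maps its tangent spaces into its normal spaces), and $\lambda(\Psi(b,c))=f(b)$. We say that $M$ is *locally a $\mathcal PR$-warped product with warping function* $\lambda:M\to\mathbb R_+$ if every point of $M$ has an open neighbourhood $U$ which is a $\mathcal PR$-warped product with warping function $\lambda|_U$. **Proposition.** Let $M$ be a proper $\mathcal PR$-submanifold of a para-Kähler manifold $\widetilde M$. For a smooth function $\mu:M\to\mathbb R$ consider the condition $$(\ast)\qquad A_{FZ}X=(PX(\mu))\,Z\quad\text{for all }X\in\mathcal D,\ Z\in\mathcal D^\perp,\qquad\text{and}\qquad W(\mu)=0\quad\text{for all }W\in\mathcal D^\perp .$$ 1. If $M$ is a $\mathcal PR$-warped product with a non-constant warping function, then there is a non-constant smooth $\mu$ on $M$ satisfying $(\ast)$. 2. $M$ is locally a $\mathcal PR$-warped product with some non-constant warping function $\lambda$ on $M$ if and only if there is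 a non-constant smooth $\mu$ on $M$ satisfying $(\ast)$. 3. $M$ is locally a $\mathcal PR$-warped product with some (possibly constant) warping function $\lambda$ on $M$ if and only if there is a smooth $\mu$ on $M$ satisfying $(\ast)$. -/

import Mathlib

open Set Filter Topology Manifold Bundle
open scoped ContDiff

noncomputable section

namespace PRSub

universe uE uM

/-! ### Pseudo-Riemannian metrics and the Levi-Civita connection -/

/-- A smooth pseudo-Riemannian metric on a boundaryless smooth manifold `M` modelled on `E`: a smooth
field of symmetric nondegenerate bilinear forms on the tangent spaces. -/
structure PseudoRiemannianMetric (E : Type uE) [NormedAddCommGroup E] [NormedSpace ℝ E]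
    (M : Type uM) [TopologicalSpace M] [ChartedSpace E M] [IsManifold 𝓘(ℝ, E) ∞ M] where
  val : ∀ x : M, TangentSpace 𝓘(ℝ, E) x →L[ℝ] TangentSpace 𝓘(ℝ, E) x →L[ℝ] ℝ
  symm : ∀ (x : M) (v w : TangentSpace 𝓘(ℝ, E) x), val x v w = val x w v
  nondegenerate : ∀ (x : M) (v : TangentSpace 𝓘(ℝ, E) x), (∀ w, val x v w = 0) → v = 0
  contMDiff : ContMDiff 𝓘(ℝ, E) (𝓘(ℝ, E).prod 𝓘(ℝ, E →L[ℝ] E →L[ℝ] ℝ)) ∞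
    (fun x : M ↦ TotalSpace.mk' (E →L[ℝ] E →L[ℝ] ℝ)
      (E := fun x : M ↦ TangentSpace 𝓘(ℝ, E) x →L[ℝ] TangentSpace 𝓘(ℝ, E) x →L[ℝ] ℝ) x (val x))

/-- The index-raising map of a nondegenerate bilinear form `b` on a finite-dimensional space: `sharp b α`
is the vector with `b (sharp b α) w = α w` for all `w`. (The value is `0` for degenerate `b`.) -/
def sharp {E : Type*} [NormedAddCommGroup E] [NormedSpace ℝ E]
    (b : E →L[ℝ] E →L[ℝ] ℝ) (α : E →L[ℝ] ℝ) : E :=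
  ContinuousLinearMap.inverse b α

theorem apply_sharp {E : Type*} [NormedAddCommGroup E] [NormedSpace ℝ E] [FiniteDimensional ℝ E]
    (b : E →L[ℝ] E →L[ℝ] ℝ) (hb : ∀ v, (∀ w, b v w = 0) → v = 0) (α : E →L[ℝ] ℝ) :
    b (sharp b α) = α := by
  have hinj : Function.Injective (b : E →ₗ[ℝ] (E →L[ℝ] ℝ)) := by
    rw [← LinearMap.ker_eq_bot, LinearMap.ker_eq_bot']
    intro v hv
    exact hb v fun w => by
      have := congrArg (fun f : E →L[ℝ] ℝ => f w) hv
      simpa using this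
  have hdim : Module.finrank ℝ E = Module.finrank ℝ (E →L[ℝ] ℝ) := by
    rw [← (LinearMap.toContinuousLinearMap (𝕜 := ℝ) (E := E) (F' := ℝ)).finrank_eq]
    exact (Subspace.dual_finrank_eq (K := ℝ) (V := E)).symm
  have hinv : b.IsInvertible :=
    ⟨(LinearEquiv.ofInjectiveOfFinrankEq (b : E →ₗ[ℝ] (E →L[ℝ] ℝ)) hinj hdim).toContinuousLinearEquiv,
      by ext v w; rfl⟩
  exact hinv.self_apply_inverse α

variable {E : Type*} [NormedAddCommGroup E] [NormedSpace ℝ E] [FiniteDimensional ℝ E]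
  {M : Type*} [TopologicalSpace M] [ChartedSpace E M] [IsManifold 𝓘(ℝ, E) ∞ M]
  {E' : Type*} [NormedAddCommGroup E'] [NormedSpace ℝ E'] [FiniteDimensional ℝ E']
  {N : Type*} [TopologicalSpace N] [ChartedSpace E' N] [IsManifold 𝓘(ℝ, E') ∞ N]

/-- The metric in the preferred chart at `p`: the bilinear form `∑ g_ij(z) dzⁱ dzʲ` on the model space,
as a function of the coordinate vector `z`. -/
def chartMetric (g : PseudoRiemannianMetric E' N) (p : N) (z : E') : E' →L[ℝ] E' →L[ℝ] ℝ :=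
  let ψ : E' → N := (extChartAt 𝓘(ℝ, E') p).symm
  let dψ : E' →L[ℝ] E' := mfderiv 𝓘(ℝ, E') 𝓘(ℝ, E') ψ z
  let b : E' →L[ℝ] E' →L[ℝ] ℝ := g.val (ψ z)
  b.bilinearComp dψ dψ

/-- The Christoffel symbols at `p` of the Levi-Civita connection in the preferred chart at `p`:
`2 g(Γ(u, v), w) = ∂_u g(v, w) + ∂_v g(u, w) - ∂_w g(u, v)`. Mathlib identifies `T_p N` with `E'`
through the preferred chart at `p`. -/
def christoffel (g : PseudoRiemannianMetric E' N) (p : N)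
    (u v : TangentSpace 𝓘(ℝ, E') p) : TangentSpace 𝓘(ℝ, E') p :=
  let u' : E' := u
  let v' : E' := v
  let z₀ : E' := extChartAt 𝓘(ℝ, E') p p
  let α : E' →L[ℝ] ℝ := (1 / 2 : ℝ) •
    (fderiv ℝ (fun z ↦ chartMetric g p z v') z₀ u' + fderiv ℝ (fun z ↦ chartMetric g p z u') z₀ v'
      - fderiv ℝ (fun z ↦ chartMetric g p z u' v') z₀)
  sharp (E := E') (g.val p) α

/-- The Levi-Civita covariant derivative `∇_v ξ` at `x` of a vector field `ξ` along a map `φ : M → N`,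
i.e. `ξ y ∈ T_{φ y} N`: in the preferred chart at `φ x` it is
`(∇_v ξ)ᵏ = v(ξᵏ) + Γᵏ_ij (dφ v)ⁱ ξʲ`, where the components of `ξ` near `x` are obtained by applying the
differential of the chart. -/
def covAlong (g : PseudoRiemannianMetric E' N) (φ : M → N)
    (ξ : ∀ y : M, TangentSpace 𝓘(ℝ, E') (φ y)) (x : M) (v : TangentSpace 𝓘(ℝ, E) x) :
    TangentSpace 𝓘(ℝ, E') (φ x) :=
  let components : M → E' := fun y ↦
    mfderiv 𝓘(ℝ, E') 𝓘(ℝ, E') (extChartAt 𝓘(ℝ, E') (φ x)) (φ y) (ξ y)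
  let dξ : E' := mfderiv 𝓘(ℝ, E) 𝓘(ℝ, E') components x v
  let Γ : E' := christoffel g (φ x) (mfderiv 𝓘(ℝ, E) 𝓘(ℝ, E') φ x v) (ξ x)
  dξ + Γ

/-- The Levi-Civita covariant derivative `∇_v Y` of a vector field `Y` on `N`. -/
def covDeriv (g : PseudoRiemannianMetric E' N) (Y : ∀ y : N, TangentSpace 𝓘(ℝ, E') y) (x : N)
    (v : TangentSpace 𝓘(ℝ, E') x) : TangentSpace 𝓘(ℝ, E') x :=
  covAlong (E := E') g (fun y : N ↦ y) Y x v

/-! ### Para-Kähler manifolds -/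

/-- `(N, g, J)` is para-Kähler: `J` is a smooth `(1,1)`-tensor field, `J² = I`, `J ≠ ± I`,
`g(J X, J Y) = - g(X, Y)` and `∇ J = 0` for the Levi-Civita connection `∇` of `g`. -/
structure IsParaKahler (g : PseudoRiemannianMetric E' N)
    (J : ∀ x : N, TangentSpace 𝓘(ℝ, E') x →L[ℝ] TangentSpace 𝓘(ℝ, E') x) : Prop where
  contMDiff : ContMDiff 𝓘(ℝ, E') (𝓘(ℝ, E').prod 𝓘(ℝ, E' →L[ℝ] E')) ∞
    (fun x : N ↦ TotalSpace.mk' (E' →L[ℝ] E')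
      (E := fun x : N ↦ TangentSpace 𝓘(ℝ, E') x →L[ℝ] TangentSpace 𝓘(ℝ, E') x) x (J x))
  sq : ∀ (x : N) (v : TangentSpace 𝓘(ℝ, E') x), J x (J x v) = v
  ne_id : ∃ (x : N) (v : TangentSpace 𝓘(ℝ, E') x), J x v ≠ v
  ne_neg_id : ∃ (x : N) (v : TangentSpace 𝓘(ℝ, E') x), J x v ≠ -v
  anti : ∀ (x : N) (v w : TangentSpace 𝓘(ℝ, E') x), g.val x (J x v) (J x w) = - g.val x v w
  parallel : ∀ (x : N) (v : TangentSpace 𝓘(ℝ, E') x) (Y : ∀ y : N, TangentSpace 𝓘(ℝ, E') y),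
    MDifferentiableAt 𝓘(ℝ, E') 𝓘(ℝ, E').tangent
      (fun y ↦ (⟨y, Y y⟩ : TangentBundle 𝓘(ℝ, E') N)) x →
    covDeriv g (fun y ↦ J y (Y y)) x v = J x (covDeriv g Y x v)

/-! ### Submanifolds -/

/-- The metric on `M` induced by `φ : M → N`. -/
def inducedMetric (g : PseudoRiemannianMetric E' N) (φ : M → N) (x : M) :
    TangentSpace 𝓘(ℝ, E) x →L[ℝ] TangentSpace 𝓘(ℝ, E) x →L[ℝ] ℝ :=
  let dφ : E →L[ℝ] E' := mfderiv 𝓘(ℝ, E) 𝓘(ℝ, E') φ x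
  let b : E' →L[ℝ] E' →L[ℝ] ℝ := g.val (φ x)
  (b.bilinearComp dφ dφ : E →L[ℝ] E →L[ℝ] ℝ)

/-- `φ : M → N` is an immersed pseudo-Riemannian submanifold: a smooth immersion whose induced metric
is nondegenerate. -/
structure IsPseudoRiemannianSubmanifold (g : PseudoRiemannianMetric E' N) (φ : M → N) : Prop where
  contMDiff : ContMDiff 𝓘(ℝ, E) 𝓘(ℝ, E') ∞ φ
  injective_mfderiv : ∀ x : M, Function.Injective (mfderiv 𝓘(ℝ, E) 𝓘(ℝ, E') φ x)
  nondegenerate : ∀ (x : M) (v : TangentSpace 𝓘(ℝ, E) x),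
    (∀ w : TangentSpace 𝓘(ℝ, E) x, inducedMetric (E := E) g φ x v w = 0) → v = 0

/-- The tangential part of `ζ ∈ T_{φ x} N = dφ(T_x M) ⊕ T_x^⊥ M`, as a vector of `T_x M`: it is determined
by `g(tan ζ, w) = g(ζ, dφ w)` for all `w ∈ T_x M`. -/
def tanPart (g : PseudoRiemannianMetric E' N) (φ : M → N) (x : M)
    (ζ : TangentSpace 𝓘(ℝ, E') (φ x)) : TangentSpace 𝓘(ℝ, E) x :=
  let dφ : E →L[ℝ] E' := mfderiv 𝓘(ℝ, E) 𝓘(ℝ, E') φ x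
  let α : E' →L[ℝ] ℝ := g.val (φ x) ζ
  sharp (E := E) (inducedMetric (E := E) g φ x) (α.comp dφ)

/-- The normal part of `ζ ∈ T_{φ x} N = dφ(T_x M) ⊕ T_x^⊥ M`. -/
def norPart (g : PseudoRiemannianMetric E' N) (φ : M → N) (x : M)
    (ζ : TangentSpace 𝓘(ℝ, E') (φ x)) : TangentSpace 𝓘(ℝ, E') (φ x) :=
  ζ - mfderiv 𝓘(ℝ, E) 𝓘(ℝ, E') φ x (tanPart (E := E) g φ x ζ)

/-- The tangential part `P X` of `J X`, for `X` tangent to the submanifold. -/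
def tangOp (g : PseudoRiemannianMetric E' N)
    (J : ∀ x : N, TangentSpace 𝓘(ℝ, E') x →L[ℝ] TangentSpace 𝓘(ℝ, E') x) (φ : M → N) (x : M)
    (X : TangentSpace 𝓘(ℝ, E) x) : TangentSpace 𝓘(ℝ, E) x :=
  tanPart g φ x (J (φ x) (mfderiv 𝓘(ℝ, E) 𝓘(ℝ, E') φ x X))

/-- The normal part `F X` of `J X`, for `X` tangent to the submanifold. -/
def normOp (g : PseudoRiemannianMetric E' N)
    (J : ∀ x : N, TangentSpace 𝓘(ℝ, E') x →L[ℝ] TangentSpace 𝓘(ℝ, E') x) (φ : M → N) (x : M)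
    (X : TangentSpace 𝓘(ℝ, E) x) : TangentSpace 𝓘(ℝ, E') (φ x) :=
  norPart (E := E) g φ x (J (φ x) (mfderiv 𝓘(ℝ, E) 𝓘(ℝ, E') φ x X))

/-- The shape operator of a normal vector field `ξ`, by the Weingarten formula
`∇_X ξ = - A_ξ X + ∇^⊥_X ξ`: `A_ξ X` is minus the tangential part of `∇_X ξ`. -/
def shapeOperator (g : PseudoRiemannianMetric E' N) (φ : M → N)
    (ξ : ∀ y : M, TangentSpace 𝓘(ℝ, E') (φ y)) (x : M) (X : TangentSpace 𝓘(ℝ, E) x) :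
    TangentSpace 𝓘(ℝ, E) x :=
  -tanPart g φ x (covAlong g φ ξ x X)

/-- The immersed submanifold `ι : M → N` is invariant: `J` maps its tangent spaces to themselves. -/
def IsInvariant (J : ∀ x : N, TangentSpace 𝓘(ℝ, E') x →L[ℝ] TangentSpace 𝓘(ℝ, E') x)
    (ι : M → N) : Prop :=
  ∀ (x : M) (v : TangentSpace 𝓘(ℝ, E) x), ∃ w : TangentSpace 𝓘(ℝ, E) x,
    J (ι x) (mfderiv 𝓘(ℝ, E) 𝓘(ℝ, E') ι x v) = mfderiv 𝓘(ℝ, E) 𝓘(ℝ, E') ι x w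

/-- The immersed submanifold `ι : M → N` is anti-invariant: `J` maps its tangent spaces to its
normal spaces. -/
def IsAntiInvariant (g : PseudoRiemannianMetric E' N)
    (J : ∀ x : N, TangentSpace 𝓘(ℝ, E') x →L[ℝ] TangentSpace 𝓘(ℝ, E') x) (ι : M → N) : Prop :=
  ∀ (x : M) (v w : TangentSpace 𝓘(ℝ, E) x),
    g.val (ι x) (J (ι x) (mfderiv 𝓘(ℝ, E) 𝓘(ℝ, E') ι x v)) (mfderiv 𝓘(ℝ, E) 𝓘(ℝ, E') ι x w) = 0

/-- The pseudo-Riemannian submanifold `φ : M → N` is a `PR`-submanifold with invariant distribution `D`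
and anti-invariant distribution `D'`: `TM = D ⊕ D'`, `J D = D`, `J D' ⊆ T^⊥ M`. (Smoothness of the
distributions is automatic: `P` is smooth and `P²` is the projection onto `D` along `D'`.) -/
structure IsPRSubmanifold (g : PseudoRiemannianMetric E' N)
    (J : ∀ x : N, TangentSpace 𝓘(ℝ, E') x →L[ℝ] TangentSpace 𝓘(ℝ, E') x) (φ : M → N)
    (D D' : ∀ x : M, Submodule ℝ (TangentSpace 𝓘(ℝ, E) x)) : Prop
    extends IsPseudoRiemannianSubmanifold (E := E) g φ where
  isCompl : ∀ x : M, IsCompl (D x) (D' x)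
  invariant : ∀ x : M,
    (fun X ↦ J (φ x) (mfderiv 𝓘(ℝ, E) 𝓘(ℝ, E') φ x X)) '' (D x : Set (TangentSpace 𝓘(ℝ, E) x)) =
      mfderiv 𝓘(ℝ, E) 𝓘(ℝ, E') φ x '' (D x : Set (TangentSpace 𝓘(ℝ, E) x))
  antiInvariant : ∀ (x : M), ∀ Z ∈ D' x, ∀ w : TangentSpace 𝓘(ℝ, E) x,
    g.val (φ x) (J (φ x) (mfderiv 𝓘(ℝ, E) 𝓘(ℝ, E') φ x Z)) (mfderiv 𝓘(ℝ, E) 𝓘(ℝ, E') φ x w) = 0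

/-- Both distributions are nonzero (at every point). -/
def IsProper (D D' : ∀ x : M, Submodule ℝ (TangentSpace 𝓘(ℝ, E) x)) : Prop :=
  ∀ x : M, D x ≠ ⊥ ∧ D' x ≠ ⊥

/-! ### Warped products -/

/-- The warped product metric `g_B + f² g_F` on `B × F`. -/
def warpedMetric {E₁ : Type*} [NormedAddCommGroup E₁] [NormedSpace ℝ E₁]
    {B : Type*} [TopologicalSpace B] [ChartedSpace E₁ B] [IsManifold 𝓘(ℝ, E₁) ∞ B]
    {E₂ : Type*} [NormedAddCommGroup E₂] [NormedSpace ℝ E₂]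
    {F : Type*} [TopologicalSpace F] [ChartedSpace E₂ F] [IsManifold 𝓘(ℝ, E₂) ∞ F]
    (gB : PseudoRiemannianMetric E₁ B) (gF : PseudoRiemannianMetric E₂ F) (f : B → ℝ) (q : B × F)
    (v w : TangentSpace (𝓘(ℝ, E₁).prod 𝓘(ℝ, E₂)) q) : ℝ :=
  let dπ₁ := mfderiv (𝓘(ℝ, E₁).prod 𝓘(ℝ, E₂)) 𝓘(ℝ, E₁) (Prod.fst : B × F → B) q
  let dπ₂ := mfderiv (𝓘(ℝ, E₁).prod 𝓘(ℝ, E₂)) 𝓘(ℝ, E₂) (Prod.snd : B × F → F) q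
  gB.val q.1 (dπ₁ v) (dπ₁ w) + f q.1 ^ 2 * gF.val q.2 (dπ₂ v) (dπ₂ w)

/-- The open subset `U` of the submanifold `φ : M → N` (with the induced metric) is a warped product
`B ×_f F` of an invariant submanifold `B` and an anti-invariant submanifold `F` of `N`, with smooth
positive warping function `f : B → ℝ`, and `lam` is equal on `U` to `f` viewed as a function on the
product. Here `Ψ` is the isometry from the warped product onto `U`; every `B × {c}` must be invariant
and every `{b} × F` anti-invariant. (These slices carry the nondegenerate metrics `g_B` and
`f(b)² g_F`.) -/
def IsPRWarpedProductOn {M : Type uM} [TopologicalSpace M] [ChartedSpace E M]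
    [IsManifold 𝓘(ℝ, E) ∞ M] (g : PseudoRiemannianMetric E' N)
    (J : ∀ x : N, TangentSpace 𝓘(ℝ, E') x →L[ℝ] TangentSpace 𝓘(ℝ, E') x) (φ : M → N)
    (U : Set M) (lam : M → ℝ) : Prop :=
  ∃ (a b : ℕ)
    (B : Type uM) (_ : TopologicalSpace B) (_ : ChartedSpace (EuclideanSpace ℝ (Fin a)) B)
    (_ : IsManifold 𝓘(ℝ, EuclideanSpace ℝ (Fin a)) ∞ B)
    (F : Type uM) (_ : TopologicalSpace F) (_ : ChartedSpace (EuclideanSpace ℝ (Fin b)) F)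
    (_ : IsManifold 𝓘(ℝ, EuclideanSpace ℝ (Fin b)) ∞ F)
    (gB : PseudoRiemannianMetric (EuclideanSpace ℝ (Fin a)) B)
    (gF : PseudoRiemannianMetric (EuclideanSpace ℝ (Fin b)) F)
    (f : B → ℝ) (Ψ : B × F → M),
    ContMDiff 𝓘(ℝ, EuclideanSpace ℝ (Fin a)) 𝓘(ℝ, ℝ) ∞ f ∧
    (∀ x, 0 < f x) ∧
    IsLocalDiffeomorph
      (𝓘(ℝ, EuclideanSpace ℝ (Fin a)).prod 𝓘(ℝ, EuclideanSpace ℝ (Fin b))) 𝓘(ℝ, E) ∞ Ψ ∧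
    Function.Injective Ψ ∧
    Set.range Ψ = U ∧
    (∀ (q : B × F)
      (v w : TangentSpace
        (𝓘(ℝ, EuclideanSpace ℝ (Fin a)).prod 𝓘(ℝ, EuclideanSpace ℝ (Fin b))) q),
      inducedMetric (E := E) g φ (Ψ q)
          (mfderiv (𝓘(ℝ, EuclideanSpace ℝ (Fin a)).prod 𝓘(ℝ, EuclideanSpace ℝ (Fin b)))
            𝓘(ℝ, E) Ψ q v)
          (mfderiv (𝓘(ℝ, EuclideanSpace ℝ (Fin a)).prod 𝓘(ℝ, EuclideanSpace ℝ (Fin b)))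
            𝓘(ℝ, E) Ψ q w) =
        warpedMetric gB gF f q v w) ∧
    (∀ c : F, IsInvariant (E := EuclideanSpace ℝ (Fin a)) J (fun x : B ↦ φ (Ψ (x, c)))) ∧
    (∀ x : B, IsAntiInvariant (E := EuclideanSpace ℝ (Fin b)) g J (fun c : F ↦ φ (Ψ (x, c)))) ∧
    (∀ q : B × F, lam (Ψ q) = f q.1)

/-- The whole submanifold is a `PR`-warped product with warping function `lam`
(viewed as a function on `M`). -/
def IsPRWarpedProduct {M : Type uM} [TopologicalSpace M] [ChartedSpace E M]
    [IsManifold 𝓘(ℝ, E) ∞ M] (g : PseudoRiemannianMetric E' N)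
    (J : ∀ x : N, TangentSpace 𝓘(ℝ, E') x →L[ℝ] TangentSpace 𝓘(ℝ, E') x) (φ : M → N)
    (lam : M → ℝ) : Prop :=
  IsPRWarpedProductOn (E := E) g J φ Set.univ lam

/-- The submanifold is locally a `PR`-warped product with warping function `lam : M → ℝ`: every point has
an open neighbourhood which is a `PR`-warped product whose warping function is the restriction
of `lam`. -/
def IsLocallyPRWarpedProduct {M : Type uM} [TopologicalSpace M] [ChartedSpace E M]
    [IsManifold 𝓘(ℝ, E) ∞ M] (g : PseudoRiemannianMetric E' N)
    (J : ∀ x : N, TangentSpace 𝓘(ℝ, E') x →L[ℝ] TangentSpace 𝓘(ℝ, E') x) (φ : M → N)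
    (lam : M → ℝ) : Prop :=
  ∀ x : M, ∃ U : Set M, IsOpen U ∧ x ∈ U ∧ IsPRWarpedProductOn (E := E) g J φ U lam

/-- `μ` is a smooth function on `M` with `A_{FZ} X = (P X (μ)) Z` for `X ∈ D` and `Z ∈ D'`, and
`W(μ) = 0` for `W ∈ D'`. The first identity is required at every point `x`, for every vector
`X ∈ D x` and every local section `Z` of `D'` around `x`. -/
structure ShapeCondition (g : PseudoRiemannianMetric E' N)
    (J : ∀ x : N, TangentSpace 𝓘(ℝ, E') x →L[ℝ] TangentSpace 𝓘(ℝ, E') x) (φ : M → N)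
    (D D' : ∀ x : M, Submodule ℝ (TangentSpace 𝓘(ℝ, E) x)) (μ : M → ℝ) : Prop where
  contMDiff : ContMDiff 𝓘(ℝ, E) 𝓘(ℝ, ℝ) ∞ μ
  shape : ∀ (x : M), ∀ X ∈ D x, ∀ Z : (∀ y : M, TangentSpace 𝓘(ℝ, E) y),
    ContMDiffAt 𝓘(ℝ, E) 𝓘(ℝ, E).tangent ∞
      (fun y ↦ (⟨y, Z y⟩ : TangentBundle 𝓘(ℝ, E) M)) x →
    (∀ᶠ y in 𝓝 x, Z y ∈ D' y) →
    shapeOperator g φ (fun y ↦ normOp g J φ y (Z y)) x X =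
      (show ℝ from mfderiv 𝓘(ℝ, E) 𝓘(ℝ, ℝ) μ x (tangOp g J φ x X)) • Z x
  vertical : ∀ (x : M), ∀ W ∈ D' x, mfderiv 𝓘(ℝ, E) 𝓘(ℝ, ℝ) μ x W = 0

/-- The real function `h` is not constant. -/
def IsNonconstant {X : Type*} (h : X → ℝ) : Prop := ∃ x y, h x ≠ h y

end PRSub

end

/-! Write `∇` for the Levi-Civita connection of `N`, `X` for vectors of `D` and `Z` for sections of
`D'`. On `D'` the normal field `F Z` is `J Z`, and `J` is parallel and skew for `g`, so `g(A_{FZ} X,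
W) = g(∇_X Z, J W)` for every tangent `W` (`metricAt_shapeAt`). If `W ∈ D`, then `J W` is tangent
and the shape condition says that `∇_X Z` has no component in `D`: the distribution `D` is totally
geodesic in `M`. If `W ∈ D'`, then `J W` is normal, and the symmetry of the second fundamental form
turns the right-hand side into `-g(∇_Z (J X), W)`. With `Y = P X` the condition becomes `g(∇_Z Y, W)
= -Y(μ) g(Z, W)`: the distribution `D'` is totally umbilical in `M`, with curvature vector given by
the gradient of `μ`. Both statements (`ShapeCondition.coord_geodesic`,
`ShapeCondition.coord_umbilical`) involve only the intrinsic geometry of `M`, and they are what a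
warped product metric with warping function `e^{-μ}` satisfies.

From a warped product to `μ`: in product coordinates the slices are tangent to `D` and `D'`
(`isAdapted_prodParam`), the block of the metric on `D` does not vary along the fibre, and the block
on `D'` scales like `f²`. The Koszul formula then gives the two identities for `μ = -log λ`
(`shapeOperator_eq_of_adapted`), and `W(μ) = 0` holds because `λ` depends on the first factor only.

From `μ` to a warped product: the two identities make the second fundamental forms of `D` and of
`D'` inside `M` symmetric, so both distributions are involutive. Applying `frobenius` to each gives
coordinates on a product in which the factors span `D` and `D'`. There the condition says that the
`D`-block has zero derivative along `D'`, that the derivative of the `D'`-block along `v ∈ D` is `-2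
dμ(v)` times the block, and that `μ` depends on the first factor only. Integration over a product of
balls yields `γ₁ + e^{-2μ} γ₂` (`ShapeCondition.coordMetric_split`). The function `λ = e^{-μ}` is
already defined on all of `M`, so the local pieces need no gluing.

The Frobenius theorem is derived from ordinary differential equations: an involutive distribution
has a commuting frame, the time-one map of the corresponding flows sweeps out the leaves, and its
smoothness follows from the inverse function theorem in the Banach space of continuous curves on the
unit interval. -/

set_option maxSynthPendingDepth 3
set_option linter.unusedSectionVars false

noncomputable section

namespace PRSub

/-! ### Superposition operators on spaces of continuous functions -/

section Superposition

universe u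

variable {K : Type*} [TopologicalSpace K]

/-- Pointwise application of a bilinear map to two continuous families of vectors. -/
def pointwiseBilin (K : Type*) [TopologicalSpace K] [CompactSpace K]
    {G E F : Type*} [NormedAddCommGroup G] [NormedSpace ℝ G] [NormedAddCommGroup E] [NormedSpace ℝ E]
    [NormedAddCommGroup F] [NormedSpace ℝ F] (B : G →L[ℝ] E →L[ℝ] F) :
    C(K, G) →L[ℝ] C(K, E) →L[ℝ] C(K, F) :=
  LinearMap.mkContinuous₂
    (LinearMap.mk₂ ℝ (fun (L : C(K, G)) (h : C(K, E)) =>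
        (⟨fun t => B (L t) (h t), (B.continuous.comp L.continuous).clm_apply h.continuous⟩ : C(K, F)))
      (fun _ _ _ => by ext; simp) (fun _ _ _ => by ext; simp)
      (fun _ _ _ => by ext; simp) (fun _ _ _ => by ext; simp)) ‖B‖
    (fun L h => by
      rw [ContinuousMap.norm_le _ (by positivity)]
      intro t
      refine (B.le_opNorm₂ _ _).trans ?_
      gcongr
      · exact L.norm_coe_le_norm t
      · exact h.norm_coe_le_norm t)

@[simp]
theorem pointwiseBilin_apply [CompactSpace K] {G E F : Type*} [NormedAddCommGroup G] [NormedSpace ℝ G]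
    [NormedAddCommGroup E] [NormedSpace ℝ E] [NormedAddCommGroup F] [NormedSpace ℝ F]
    (B : G →L[ℝ] E →L[ℝ] F) (L : C(K, G)) (h : C(K, E)) (t : K) :
    pointwiseBilin K B L h t = B (L t) (h t) := rfl

/-- The superposition operator `c ↦ A ∘ c`. -/
def superposition (K : Type*) [TopologicalSpace K] {E F : Type*} [TopologicalSpace E]
    [TopologicalSpace F] (A : E → F) (hA : Continuous A) (c : C(K, E)) : C(K, F) :=
  ContinuousMap.comp ⟨A, hA⟩ c

@[simp]
theorem superposition_apply {E F : Type*} [TopologicalSpace E]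
    [TopologicalSpace F] (A : E → F) (hA : Continuous A) (c : C(K, E)) (t : K) :
    superposition K A hA c t = A (c t) := rfl

theorem continuous_superposition {E F : Type*} [TopologicalSpace E]
    [TopologicalSpace F] (A : E → F) (hA : Continuous A) : Continuous (superposition K A hA) :=
  ContinuousMap.continuous_postcomp _

variable [CompactSpace K]

/-- For each `t` the mean value inequality on the segment from `c t` to `c t + h t` bounds the error
by `ε ‖h t‖`. One `δ` serves all `t`: the points of the segment are values at `t` of the curves `c +
s • h`, and `c ↦ A' ∘ c` is continuous in the sup norm. -/
theorem hasFDerivAt_superposition {G E F : Type*} [NormedAddCommGroup G] [NormedSpace ℝ G]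
    [NormedAddCommGroup E] [NormedSpace ℝ E]
    [NormedAddCommGroup F] [NormedSpace ℝ F] (B : G →L[ℝ] E →L[ℝ] F) (hB : ∀ x, ‖B x‖ ≤ ‖x‖)
    (A : E → F) (hA : Continuous A) (A' : E → G) (hA' : Continuous A')
    (hd : ∀ x, HasFDerivAt A (B (A' x)) x) (c : C(K, E)) :
    HasFDerivAt (superposition K A hA) (pointwiseBilin K B (superposition K A' hA' c)) c := by
  rw [hasFDerivAt_iff_isLittleO_nhds_zero, Asymptotics.isLittleO_iff]
  intro ε hε
  have hcont := (continuous_superposition (K := K) A' hA').continuousAt (x := c)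
  obtain ⟨δ, hδ, H⟩ := Metric.eventually_nhds_iff.1 (hcont (Metric.ball_mem_nhds _ hε))
  filter_upwards [Metric.ball_mem_nhds (0 : C(K, E)) hδ] with h hh
  rw [mem_ball_zero_iff] at hh
  rw [ContinuousMap.norm_le _ (by positivity)]
  intro t
  have key : ∀ y ∈ segment ℝ (c t) (c t + h t), ‖B (A' y) - B (A' (c t))‖ ≤ ε := by
    intro y hy
    rw [segment_eq_image'] at hy
    obtain ⟨s, hs, rfl⟩ := hy
    have h1 : dist (c + s • h) c < δ := by
      rw [dist_eq_norm, add_sub_cancel_left, norm_smul, Real.norm_of_nonneg hs.1]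
      exact (mul_le_of_le_one_left (norm_nonneg _) hs.2).trans_lt hh
    have h2 := (ContinuousMap.dist_apply_le_dist (f := superposition K A' hA' (c + s • h))
      (g := superposition K A' hA' c) t).trans (Metric.mem_ball.1 (H h1)).le
    rw [dist_eq_norm] at h2
    rw [← map_sub]
    exact (hB _).trans (by simpa using h2)
  have := (convex_segment (c t) (c t + h t)).norm_image_sub_le_of_norm_hasFDerivWithin_le'
    (f := A) (f' := fun y => B (A' y)) (φ := B (A' (c t))) (C := ε)
    (fun y _ => (hd y).hasFDerivWithinAt) key
    (left_mem_segment ℝ _ _) (right_mem_segment ℝ _ _)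
  have h3 : ‖h t‖ ≤ ‖h‖ := h.norm_coe_le_norm t
  have h4 : ‖A (c t + h t) - A (c t) - B (A' (c t)) (h t)‖ ≤ ε * ‖h t‖ := by simpa using this
  simpa using h4.trans (mul_le_mul_of_nonneg_left h3 hε.le)

/-- Induction on `n`: the derivative is pointwise application of the superposition operator of
`fderiv ℝ A`, to which the induction hypothesis applies. The target changes from `F` to `E →L[ℝ] F`,
so `F` is quantified inside the induction and shares the universe of `E`. -/
theorem contDiff_superposition_nat {E : Type u} [NormedAddCommGroup E] [NormedSpace ℝ E] (n : ℕ) :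
    ∀ {F : Type u} [NormedAddCommGroup F] [NormedSpace ℝ F] (A : E → F) (hA : ContDiff ℝ n A),
    ContDiff ℝ n (superposition K A hA.continuous) := by
  induction n with
  | zero =>
    intro F _ _ A hA
    exact contDiff_zero.2 (continuous_superposition _ _)
  | succ n ih =>
    intro F _ _ A hA
    have h := contDiff_succ_iff_fderiv.1 (by exact_mod_cast hA : ContDiff ℝ ((n : WithTop ℕ∞) + 1) A)
    have hD := hasFDerivAt_superposition (K := K) (ContinuousLinearMap.id ℝ (E →L[ℝ] F))
      (fun _ => le_rfl) A hA.continuous (fderiv ℝ A) h.2.2.continuous (fun x => (h.1 x).hasFDerivAt)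
    have : ContDiff ℝ ((n : WithTop ℕ∞) + 1) (superposition K A hA.continuous) := by
      rw [contDiff_succ_iff_hasFDerivAt]
      refine ⟨_, ?_, hD⟩
      exact (pointwiseBilin K (ContinuousLinearMap.id ℝ (E →L[ℝ] F))).contDiff.comp (ih (fderiv ℝ A) h.2.2)
    exact_mod_cast this

theorem contDiff_superposition {E F : Type u} [NormedAddCommGroup E] [NormedSpace ℝ E]
    [NormedAddCommGroup F] [NormedSpace ℝ F] (A : E → F) (hA : ContDiff ℝ ∞ A) :
    ContDiff ℝ ∞ (superposition K A hA.continuous) :=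
  contDiff_infty.2 fun n => contDiff_superposition_nat n A (hA.of_le (by exact_mod_cast le_top))

end Superposition

/-! ### Local inverses -/

/-- A map that is smooth near a point where its derivative is invertible restricts to a
diffeomorphism of open sets. -/
theorem exists_openPartialHomeomorph_contDiffOn {E F : Type*} [NormedAddCommGroup E]
    [NormedSpace ℝ E] [CompleteSpace E] [NormedAddCommGroup F] [NormedSpace ℝ F] {f : E → F} {a : E}
    (hf : ∀ᶠ x in 𝓝 a, ContDiffAt ℝ ∞ f x) (f' : E ≃L[ℝ] F)
    (hf' : HasFDerivAt f (f' : E →L[ℝ] F) a) :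
    ∃ e : OpenPartialHomeomorph E F, (∀ x, e x = f x) ∧ a ∈ e.source ∧
      ContDiffOn ℝ ∞ e e.source ∧ ContDiffOn ℝ ∞ e.symm e.target := by
  let e₀ := hf.self_of_nhds.toOpenPartialHomeomorph f hf' (by simp)
  have he₀ : ∀ x, e₀ x = f x := fun x => rfl
  have ha : a ∈ e₀.source := hf.self_of_nhds.mem_toOpenPartialHomeomorph_source hf' (by simp)
  have hcont : ContinuousAt (fderiv ℝ f) a :=
    (hf.self_of_nhds.fderiv_right (m := 0) (by simp)).continuousAt
  have hinv : ∀ᶠ x in 𝓝 a, ∃ L : E ≃L[ℝ] F, (L : E →L[ℝ] F) = fderiv ℝ f x := by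
    have : range ((↑) : (E ≃L[ℝ] F) → (E →L[ℝ] F)) ∈ 𝓝 (fderiv ℝ f a) := by
      rw [hf'.fderiv]; exact ContinuousLinearEquiv.nhds f'
    exact hcont this
  -- The inverse is smooth at the image of each point where `f` is smooth with invertible
  -- derivative. Both conditions are open, so restricting to `U` makes the inverse smooth on the
  -- whole target.
  obtain ⟨U, hU, hUo, haU⟩ := eventually_nhds_iff.1 (hf.and hinv)
  let e := e₀.restrOpen U hUo
  have hes : e.source = e₀.source ∩ U := e₀.restrOpen_source U hUo
  have hsm : ∀ x ∈ e.source, ContDiffAt ℝ ∞ e x := fun x hx => (hU x (hes ▸ hx).2).1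
  refine ⟨e, fun x => rfl, hes ▸ ⟨ha, haU⟩, fun x hx => (hsm x hx).contDiffWithinAt, ?_⟩
  intro y hy
  have hx := e.map_target hy
  obtain ⟨L, hL⟩ := (hU _ (hes ▸ hx).2).2
  refine (e.contDiffAt_symm hy (f₀' := L) ?_ (hsm _ hx)).contDiffWithinAt
  rw [hL]
  exact ((hsm _ hx).differentiableAt (by simp)).hasFDerivAt

end PRSub

end

noncomputable section

namespace PRSub

/-! ### Smooth dependence of solutions of ordinary differential equations on parameters -/

section Flow

open unitInterval

universe u

variable {E W : Type u} [NormedAddCommGroup E] [NormedSpace ℝ E]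
  [NormedAddCommGroup W] [NormedSpace ℝ W]

/-- The extension of a continuous function on the unit interval to a continuous function on `ℝ`. -/
def extendUnit {E : Type*} [TopologicalSpace E] (c : C(I, E)) (s : ℝ) : E :=
  c (projIcc (0 : ℝ) 1 zero_le_one s)

theorem continuous_extendUnit {E : Type*} [TopologicalSpace E] (c : C(I, E)) :
    Continuous (extendUnit c) :=
  c.continuous.comp continuous_projIcc

theorem extendUnit_coe {E : Type*} [TopologicalSpace E] (c : C(I, E)) (t : I) :
    extendUnit c t = c t := by
  simp [extendUnit]

/-- The operator `c ↦ ∫₀ᵗ c` on continuous functions on the unit interval. -/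
def primitive (E : Type*) [NormedAddCommGroup E] [NormedSpace ℝ E] : C(I, E) →L[ℝ] C(I, E) :=
  LinearMap.mkContinuous
    { toFun := fun c => ⟨fun t => ∫ s in (0 : ℝ)..t, extendUnit c s,
        (intervalIntegral.continuous_primitive
          (fun a b => (continuous_extendUnit c).intervalIntegrable a b) 0).comp
          continuous_subtype_val⟩
      map_add' := fun c d => by
        ext t
        exact intervalIntegral.integral_add ((continuous_extendUnit c).intervalIntegrable _ _)
          ((continuous_extendUnit d).intervalIntegrable _ _)
      map_smul' := fun r c => by
        ext t
        exact intervalIntegral.integral_smul r (extendUnit c) } 1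
    (fun c => by
      rw [one_mul, ContinuousMap.norm_le _ (norm_nonneg _)]
      intro t
      refine (intervalIntegral.norm_integral_le_of_norm_le_const (C := ‖c‖)
        fun s _ => c.norm_coe_le_norm _).trans ?_
      rw [sub_zero, abs_of_nonneg t.2.1]
      exact mul_le_of_le_one_right (norm_nonneg _) t.2.2)

theorem primitive_apply {E : Type*} [NormedAddCommGroup E] [NormedSpace ℝ E] (c : C(I, E)) (t : I) :
    primitive E c t = ∫ s in (0 : ℝ)..t, extendUnit c s := rfl

/-- Only the right derivative on `[0, 1)` is claimed: the extension is constant outside the unit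
interval, so it is in general not differentiable at `0`. Right derivatives are what the uniqueness
estimate in `linearized_solution_eq` consumes. -/
theorem hasDerivWithinAt_extendUnit [CompleteSpace E] {f : ℝ → E} (hf : Continuous f) {c : C(I, E)} {c₀ : E}
    (h : ∀ t : I, c t = c₀ + ∫ s in (0 : ℝ)..t, f s) {t : ℝ} (ht : t ∈ Ico (0 : ℝ) 1) :
    HasDerivWithinAt (extendUnit c) (f t) (Ici t) t := by
  have h1 : HasDerivAt (fun t => c₀ + ∫ s in (0 : ℝ)..t, f s) (f t) t :=
    (hf.integral_hasStrictDerivAt 0 t).hasDerivAt.const_add c₀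
  have h2 : ∀ s ∈ Icc (0 : ℝ) 1, extendUnit c s = c₀ + ∫ s in (0 : ℝ)..s, f s := fun s hs => by
    rw [← h ⟨s, hs⟩, ← extendUnit_coe]
  refine h1.hasDerivWithinAt.congr_of_eventuallyEq ?_ (h2 t ⟨ht.1, ht.2.le⟩)
  filter_upwards [Icc_mem_nhdsGE ht.2] with s hs using h2 s ⟨ht.1.trans hs.1, hs.2⟩

/-- The pair of a curve and a constant, as a curve in the product. -/
def pairConst (E W : Type*) [NormedAddCommGroup E] [NormedSpace ℝ E] [NormedAddCommGroup W]
    [NormedSpace ℝ W] : W × C(I, E) →L[ℝ] C(I, E × W) :=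
  ((ContinuousLinearMap.inr ℝ E W).compLeftContinuous ℝ I ∘L ContinuousLinearMap.const ℝ I).coprod
    ((ContinuousLinearMap.inl ℝ E W).compLeftContinuous ℝ I)

@[simp]
theorem pairConst_apply (x : W) (c : C(I, E)) (t : I) : pairConst E W (x, c) t = (c t, x) := by
  simp [pairConst]

/-- The integral operator whose fixed points in `c` are the solutions on the unit interval of
`c' = f (c, x)`, `c 0 = z`. -/
def integralOp (f : E × W → E) (hf : Continuous f) (q : (E × W) × C(I, E)) : C(I, E) :=
  ContinuousLinearMap.const ℝ I q.1.1 +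
    primitive E (superposition I f hf (pairConst E W (q.1.2, q.2)))

theorem integralOp_apply (f : E × W → E) (hf : Continuous f) (q : (E × W) × C(I, E)) (t : I) :
    integralOp f hf q t = q.1.1 + ∫ s in (0 : ℝ)..t, f (extendUnit q.2 s, q.1.2) := by
  simp [integralOp, primitive_apply, extendUnit]

theorem contDiff_integralOp (f : E × W → E) (hf : ContDiff ℝ ∞ f) :
    ContDiff ℝ ∞ (integralOp f hf.continuous) := by
  refine ((ContinuousLinearMap.const ℝ I : E →L[ℝ] C(I, E)).contDiff.comp (contDiff_fst.comp contDiff_fst)).add ?_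
  refine (primitive E).contDiff.comp ((contDiff_superposition f hf).comp ?_)
  exact (pairConst E W).contDiff.comp
    ((contDiff_snd.comp contDiff_fst).prodMk contDiff_snd)

/-- Differentiation under the integral sign is the chain rule here: `primitive` is linear and the
derivative of a superposition operator is taken pointwise. -/
theorem fderiv_integralOp_apply (f : E × W → E) (hf : ContDiff ℝ ∞ f) (q v : (E × W) × C(I, E))
    (t : I) :
    fderiv ℝ (integralOp f hf.continuous) q v t =
      v.1.1 + ∫ s in (0 : ℝ)..t, fderiv ℝ f (extendUnit q.2 s, q.1.2) (extendUnit v.2 s, v.1.2) := by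
  have hf' : Continuous (fderiv ℝ f) := hf.continuous_fderiv (by simp)
  let L : (E × W) × C(I, E) →L[ℝ] C(I, E × W) := pairConst E W ∘L
    ((ContinuousLinearMap.snd ℝ E W ∘L ContinuousLinearMap.fst ℝ _ _).prod
      (ContinuousLinearMap.snd ℝ _ _))
  have h1 := hasFDerivAt_superposition (K := I) (ContinuousLinearMap.id ℝ (E × W →L[ℝ] E))
    (fun _ => le_rfl) f hf.continuous (fderiv ℝ f) hf'
    (fun x => (hf.differentiable (by simp) x).hasFDerivAt) (L q)
  have h2 : HasFDerivAt (fun q : (E × W) × C(I, E) => superposition I f hf.continuous (L q)) _ q :=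
    h1.comp q L.hasFDerivAt
  have h3 : HasFDerivAt (fun q : (E × W) × C(I, E) =>
      primitive E (superposition I f hf.continuous (L q))) _ q :=
    (primitive E).hasFDerivAt.comp q h2
  have h4 : HasFDerivAt (fun q : (E × W) × C(I, E) => ContinuousLinearMap.const ℝ I q.1.1) _ q :=
    ((ContinuousLinearMap.const ℝ I) ∘L (ContinuousLinearMap.fst ℝ E W) ∘L
      (ContinuousLinearMap.fst ℝ _ (C(I, E)))).hasFDerivAt
  have h5 := h4.add h3
  have h6 : fderiv ℝ (integralOp f hf.continuous) q = _ := h5.fderiv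
  rw [h6]
  simp [primitive_apply, extendUnit, L]

/-- The solution of `c' = f (c, x)`, `c 0 = z` on the unit interval depends smoothly on `(z, x)` near
`(p, 0)` if `f` is smooth and `f (·, 0) = 0`. -/
theorem exists_solution_contDiffAt [CompleteSpace E] [CompleteSpace W] (f : E × W → E) (hf : ContDiff ℝ ∞ f) (hf0 : ∀ z, f (z, 0) = 0)
    (p : E) :
    ∃ γ : E × W → C(I, E), (∀ᶠ q in 𝓝 (p, (0 : W)), ContDiffAt ℝ ∞ γ q) ∧
      γ (p, 0) = ContinuousLinearMap.const ℝ I p ∧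
      ∀ᶠ q in 𝓝 (p, (0 : W)), integralOp f hf.continuous (q, γ q) = γ q := by
  let c₀ : C(I, E) := ContinuousLinearMap.const ℝ I p
  let b : (E × W) × C(I, E) := ((p, 0), c₀)
  have hKb : integralOp f hf.continuous b = c₀ := by
    ext t
    simp [integralOp_apply, b, c₀, hf0]
  -- A curve `c` solves the equation with data `q` exactly when `H (q, c) = (q, 0)`, so a smooth
  -- local inverse of `H` provides the solutions.
  let H : (E × W) × C(I, E) → (E × W) × C(I, E) := fun q => (q.1, q.2 - integralOp f hf.continuous q)
  have hH : ContDiff ℝ ∞ H := contDiff_fst.prodMk (contDiff_snd.sub (contDiff_integralOp f hf))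
  let T : E × W →L[ℝ] C(I, E) :=
    -(fderiv ℝ (integralOp f hf.continuous) b ∘L ContinuousLinearMap.inl ℝ _ _)
  let H' := ContinuousLinearEquiv.skewProd (ContinuousLinearEquiv.refl ℝ (E × W))
    (ContinuousLinearEquiv.refl ℝ C(I, E)) T
  have hf0' : ∀ v : E, fderiv ℝ f (p, 0) (v, 0) = 0 := by
    intro v
    have h1 : HasFDerivAt (fun z : E => f (z, (0 : W))) _ p :=
      ((hf.differentiable (by simp) (p, 0)).hasFDerivAt).comp (f := fun z : E => (z, (0 : W))) p
        (hasFDerivAt_prodMk_left p (0 : W))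
    have h2 : (fun z : E => f (z, (0 : W))) = fun _ => 0 := funext hf0
    rw [h2] at h1
    have := h1.unique (hasFDerivAt_const 0 p)
    simpa using congrArg (fun L : E →L[ℝ] E => L v) this
  have hHb : HasFDerivAt H (H' : (E × W) × C(I, E) →L[ℝ] (E × W) × C(I, E)) b := by
    have h1 := ((contDiff_integralOp f hf).differentiable (by simp) b).hasFDerivAt
    have h2 : HasFDerivAt H _ b := hasFDerivAt_fst.prodMk (hasFDerivAt_snd.sub h1)
    convert! h2 using 1
    refine ContinuousLinearMap.ext fun v => Prod.ext rfl ?_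
    -- As `f (·, 0) = 0`, the integral operator has zero derivative in the curve direction at `b`.
    -- The derivative of `H` there is triangular with identities on the diagonal, hence invertible,
    -- and no contraction estimate is required.
    have h3 : fderiv ℝ (integralOp f hf.continuous) b (0, v.2) = 0 := by
      ext t
      have : ∀ s, fderiv ℝ f (extendUnit c₀ s, 0) (extendUnit v.2 s, 0) = 0 := fun s => hf0' _
      rw [fderiv_integralOp_apply f hf]
      simp [b, this]
    have h4 : fderiv ℝ (integralOp f hf.continuous) b v =
        fderiv ℝ (integralOp f hf.continuous) b (v.1, 0) := by
      have : v = (v.1, 0) + (0, v.2) := by simp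
      conv_lhs => rw [this]
      rw [map_add, h3, add_zero]
    simp [H', T, h4, sub_eq_add_neg]
  obtain ⟨e, he, hbe, -, hsymm⟩ := exists_openPartialHomeomorph_contDiffOn
    (Eventually.of_forall fun x => hH.contDiffAt) H' hHb
  have heb : e b = ((p, 0), 0) := by
    rw [he]; simp [H, hKb, b]
  have hbt : ((p, (0 : W)), (0 : C(I, E))) ∈ e.target := heb ▸ e.map_source hbe
  have hnear : ∀ᶠ q in 𝓝 (p, (0 : W)), (q, (0 : C(I, E))) ∈ e.target :=
    (by fun_prop : Continuous fun q : E × W => (q, (0 : C(I, E)))).continuousAt.preimage_mem_nhds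
      (e.open_target.mem_nhds hbt)
  refine ⟨fun q => (e.symm (q, 0)).2, ?_, ?_, ?_⟩
  · filter_upwards [hnear] with q hq
    have h1 : ContDiffAt ℝ ∞ e.symm (q, (0 : C(I, E))) :=
      hsymm.contDiffAt (e.open_target.mem_nhds hq)
    exact contDiffAt_snd.comp q (h1.comp (f := fun q => (q, (0 : C(I, E)))) q
      (contDiff_id.prodMk contDiff_const).contDiffAt)
  · change (e.symm ((p, 0), 0)).2 = c₀
    rw [← heb, e.left_inv hbe]
  · filter_upwards [hnear] with q hq
    have h1 := e.right_inv hq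
    rw [he] at h1
    have h2 : (e.symm (q, 0)).1 = q := congrArg Prod.fst h1
    have h3 : (e.symm (q, 0)).2 - integralOp f hf.continuous (e.symm (q, 0)) = 0 :=
      congrArg Prod.snd h1
    have h4 : e.symm (q, 0) = (q, (e.symm (q, 0)).2) := Prod.ext h2 rfl
    rw [← h4]
    exact (sub_eq_zero.1 h3).symm

end Flow

end PRSub

end

noncomputable section

namespace PRSub

/-! ### Flows of commuting vector fields -/

section CommutingFlow

open unitInterval

universe u

variable {E W : Type u} [NormedAddCommGroup E] [NormedSpace ℝ E]
  [NormedAddCommGroup W] [NormedSpace ℝ W]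

theorem fderiv_uncurry_clm {a : E → W →L[ℝ] E} (ha : Differentiable ℝ a) (q v : E × W) :
    fderiv ℝ (fun q : E × W => a q.1 q.2) q v = fderiv ℝ a q.1 v.1 q.2 + a q.1 v.2 := by
  have h : HasFDerivAt (fun q : E × W => a q.1 q.2) _ q :=
    ((ha q.1).hasFDerivAt.comp q hasFDerivAt_fst).clm_apply hasFDerivAt_snd
  rw [h.fderiv]
  simp [add_comm]

/-- Along the solution `c` of `c' = a c x`, the solution `η` of the linearized equation with parameter
variation `w` is `t ↦ t • a (c t) w`, provided the vector fields `a · w` commute. -/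
theorem linearized_solution_eq [CompleteSpace E] {a : E → W →L[ℝ] E} (ha : ContDiff ℝ ∞ a)
    {c η : C(I, E)} {z : E} {x w : W}
    (hc : ∀ t : I, c t = z + ∫ s in (0 : ℝ)..t, a (extendUnit c s) x)
    (hη : ∀ t : I, η t = ∫ s in (0 : ℝ)..t,
      (fderiv ℝ a (extendUnit c s) (extendUnit η s) x + a (extendUnit c s) w))
    (hsymm : ∀ t : I, fderiv ℝ a (c t) (a (c t) x) w = fderiv ℝ a (c t) (a (c t) w) x) :
    η 1 = a (c 1) w := by
  have hcc := continuous_extendUnit c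
  have hηc := continuous_extendUnit η
  have hac : Continuous fun s => a (extendUnit c s) := ha.continuous.comp hcc
  have hdac : Continuous fun s => fderiv ℝ a (extendUnit c s) :=
    (ha.continuous_fderiv (by simp)).comp hcc
  -- The bound comes from compactness of the curve. Applying the derivative of `(z, x) ↦ a z x` to
  -- `(v, 0)` isolates `fderiv ℝ a z v x`.
  obtain ⟨K, hK⟩ : ∃ K : ℝ, ∀ t ∈ Icc (0 : ℝ) 1, ∀ v, ‖fderiv ℝ a (extendUnit c t) v x‖ ≤ K * ‖v‖ := by
    have hF : ContDiff ℝ ∞ (fun q : E × W => a q.1 q.2) :=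
      (ha.comp contDiff_fst).clm_apply contDiff_snd
    obtain ⟨K, hK⟩ := (isCompact_Icc (a := (0 : ℝ)) (b := 1)).exists_bound_of_continuousOn
      (f := fun s => fderiv ℝ (fun q : E × W => a q.1 q.2) (extendUnit c s, x))
      ((hF.continuous_fderiv (by simp)).comp (hcc.prodMk continuous_const)).continuousOn
    refine ⟨K, fun t ht v => ?_⟩
    have h := (ContinuousLinearMap.le_opNorm
      (fderiv ℝ (fun q : E × W => a q.1 q.2) (extendUnit c t, x)) (v, 0)).trans
      (mul_le_mul_of_nonneg_right (hK t ht) (norm_nonneg _))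
    rw [fderiv_uncurry_clm (ha.differentiable (by simp))] at h
    simpa using h
  have h1 : ∀ t ∈ Ico (0 : ℝ) 1, HasDerivWithinAt (extendUnit c) (a (extendUnit c t) x) (Ici t) t :=
    fun t ht => hasDerivWithinAt_extendUnit (hac.clm_apply continuous_const) hc ht
  have h2 : ∀ t ∈ Ico (0 : ℝ) 1, HasDerivWithinAt (extendUnit η)
      (fderiv ℝ a (extendUnit c t) (extendUnit η t) x + a (extendUnit c t) w) (Ici t) t :=
    fun t ht => hasDerivWithinAt_extendUnit (c₀ := 0)
      (((hdac.clm_apply hηc).clm_apply continuous_const).add (hac.clm_apply continuous_const))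
      (fun t => by rw [zero_add]; exact hη t) ht
  -- The curve `t • a (c t) w` solves the same inhomogeneous linear equation as `η`, by the symmetry
  -- `hsymm`. The difference `δ` therefore solves the homogeneous one with `δ 0 = 0` and vanishes by
  -- Grönwall.
  let δ : ℝ → E := fun t => extendUnit η t - t • a (extendUnit c t) w
  have h3 : ∀ t ∈ Ico (0 : ℝ) 1, HasDerivWithinAt δ
      (fderiv ℝ a (extendUnit c t) (δ t) x) (Ici t) t := by
    intro t ht
    have h4 : HasDerivWithinAt (fun t => a (extendUnit c t) w)
        (fderiv ℝ a (extendUnit c t) (a (extendUnit c t) x) w) (Ici t) t := by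
      have := ((ha.differentiable (by simp) (extendUnit c t)).hasFDerivAt).comp_hasDerivWithinAt t
        (h1 t ht)
      simpa using this.clm_apply (hasDerivWithinAt_const t (Ici t) w)
    have h5 := (h2 t ht).sub ((hasDerivWithinAt_id t (Ici t)).smul h4)
    refine h5.congr_deriv ?_
    have h6 : extendUnit c t = c ⟨t, ht.1, ht.2.le⟩ := by rw [← extendUnit_coe]
    have h7 := hsymm ⟨t, ht.1, ht.2.le⟩
    rw [← h6] at h7
    simp only [id, h7, δ, map_sub, map_smul, sub_apply, smul_apply, one_smul]
    abel
  have h8 := eq_zero_of_abs_deriv_le_mul_abs_self_of_eq_zero_right (f := δ) (K := K)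
    (a := 0) (b := 1)
    (hηc.sub (continuous_id.smul (hac.clm_apply continuous_const))).continuousOn h3
    (by
      have : extendUnit η 0 = η 0 := extendUnit_coe η 0
      simp [δ, this, hη 0])
    (fun t ht => hK t ⟨ht.1, ht.2.le⟩ _) 1 ⟨zero_le_one, le_rfl⟩
  have h10 : extendUnit η 1 = η 1 := extendUnit_coe η 1
  have h11 : extendUnit c 1 = c 1 := extendUnit_coe c 1
  simpa [δ, h10, h11, sub_eq_zero] using h8

/-- Commuting vector fields `a · w` generate a local action: `G (z, ·)` solves `dG = a G`,
`G (z, 0) = z`. -/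
theorem exists_commuting_flow [CompleteSpace E] [CompleteSpace W] {a : E → W →L[ℝ] E}
    (ha : ContDiff ℝ ∞ a) (p : E)
    (hsymm : ∀ᶠ z in 𝓝 p, ∀ w w', fderiv ℝ a z (a z w) w' = fderiv ℝ a z (a z w') w) :
    ∃ G : E × W → E, (∀ᶠ q in 𝓝 (p, (0 : W)), ContDiffAt ℝ ∞ G q) ∧
      (∀ᶠ z in 𝓝 p, G (z, 0) = z) ∧
      ∀ᶠ q in 𝓝 (p, (0 : W)), ∀ w, fderiv ℝ G q (0, w) = a (G q) w := by
  let f : E × W → E := fun q => a q.1 q.2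
  have hf : ContDiff ℝ ∞ f := (ha.comp contDiff_fst).clm_apply contDiff_snd
  obtain ⟨γ, hγ, hγp, hfix⟩ := exists_solution_contDiffAt f hf (fun z => by simp [f]) p
  have hev : ContDiff ℝ ∞ (ContinuousMap.evalCLM ℝ (1 : I) : C(I, E) →L[ℝ] E) :=
    ContinuousLinearMap.contDiff _
  refine ⟨fun q => γ q 1, ?_, ?_, ?_⟩
  · filter_upwards [hγ] with q hq using hev.contDiffAt.comp q hq
  · have : Tendsto (fun z : E => (z, (0 : W))) (𝓝 p) (𝓝 (p, 0)) :=
      (Continuous.prodMk continuous_id continuous_const).continuousAt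
    filter_upwards [this.eventually hfix] with z hz
    rw [← hz, integralOp_apply]
    simp [f]
  -- The symmetry is known only near `p` but is needed along the whole curve `γ q`. Continuity of
  -- `γ` in the sup norm keeps that curve in a ball around `p`.
  · obtain ⟨r, hr, hball⟩ := Metric.eventually_nhds_iff_ball.1 hsymm
    have hnear : ∀ᶠ q in 𝓝 (p, (0 : W)), γ q ∈ Metric.ball (γ (p, 0)) r :=
      hγ.self_of_nhds.continuousAt (Metric.ball_mem_nhds _ hr)
    filter_upwards [hγ, hfix.eventually_nhds, hnear] with q hγq hfixq hq w
    have hd := (hγq.differentiableAt (by simp)).hasFDerivAt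
    set η : C(I, E) := fderiv ℝ γ q (0, w) with hη
    have h1 : HasFDerivAt (fun q => γ q 1) _ q :=
      (ContinuousMap.evalCLM ℝ (1 : I) : C(I, E) →L[ℝ] E).hasFDerivAt.comp q hd
    have h2 : fderiv ℝ (fun q => γ q 1) q (0, w) = η 1 := by
      rw [h1.fderiv]; rfl
    rw [h2]
    -- Differentiating the fixed point equation in the direction `(0, w)` gives the linearized
    -- equation in integral form.
    have hη' : ∀ t, η t = fderiv ℝ (integralOp f hf.continuous) (q, γ q) ((0, w), η) t := by
      intro t
      have h3 : HasFDerivAt (fun q => integralOp f hf.continuous (q, γ q)) _ q :=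
        (((contDiff_integralOp f hf).differentiable (by simp) (q, γ q)).hasFDerivAt).comp q
          (f := fun q => (q, γ q)) ((hasFDerivAt_id q).prodMk hd)
      have h4 : HasFDerivAt (fun q => integralOp f hf.continuous (q, γ q)) (fderiv ℝ γ q) q :=
        hd.congr_of_eventuallyEq hfixq
      have h5 := congrArg (fun L => L (0, w)) (h4.unique h3)
      exact DFunLike.congr_fun h5 t
    refine linearized_solution_eq ha (z := q.1) (x := q.2) (fun t => ?_) (fun t => ?_) fun t => ?_
    · conv_lhs => rw [← hfixq.self_of_nhds]
      rw [integralOp_apply]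
    · rw [hη', fderiv_integralOp_apply f hf]
      simp only [f, fderiv_uncurry_clm (ha.differentiable (by simp)), zero_add]
    · refine hball _ ?_ _ _
      have h6 := (ContinuousMap.dist_apply_le_dist (f := γ q) (g := γ (p, 0)) t).trans_lt hq
      rw [hγp] at h6
      simpa using h6

end CommutingFlow

end PRSub

end

/-! ### The Frobenius theorem -/

noncomputable section

namespace PRSub

/-- A map that is smooth near a point agrees near the point with a globally smooth map. -/
theorem exists_contDiff_eventuallyEq {E F : Type*} [NormedAddCommGroup E] [NormedSpace ℝ E]
    [FiniteDimensional ℝ E] [NormedAddCommGroup F] [NormedSpace ℝ F] {a : E → F} {p : E}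
    (ha : ∀ᶠ z in 𝓝 p, ContDiffAt ℝ ∞ a z) : ∃ b : E → F, ContDiff ℝ ∞ b ∧ b =ᶠ[𝓝 p] a := by
  obtain ⟨r, hr, hball⟩ := Metric.eventually_nhds_iff_ball.1 ha
  -- The cutoff equals `1` near `p`, and its support stays inside the ball of radius `r` where `a`
  -- is smooth.
  let χ : ContDiffBump p := ⟨r / 3, r / 2, by positivity, by linarith⟩
  refine ⟨fun z => χ z • a z, contDiff_iff_contDiffAt.2 fun z => ?_, ?_⟩
  · by_cases hz : z ∈ Metric.ball p r
    · exact χ.contDiff.contDiffAt.smul (hball z hz)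
    · have h1 : z ∈ (Metric.closedBall p (r / 2))ᶜ := by
        intro h
        rw [Metric.mem_closedBall] at h
        exact hz (Metric.mem_ball.2 (by linarith))
      have h2 : (fun z => χ z • a z) =ᶠ[𝓝 z] fun _ => 0 := by
        filter_upwards [Metric.isClosed_closedBall.isOpen_compl.mem_nhds h1] with y hy
        have : χ y = 0 := χ.zero_of_le_dist (by
          simp only [mem_compl_iff, Metric.mem_closedBall, not_le] at hy
          exact hy.le)
        simp [this]
      exact contDiffAt_const.congr_of_eventuallyEq h2
  · filter_upwards [χ.eventuallyEq_one] with z hz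
    simp [hz]

section Frobenius

universe u

variable {E W₁ W₂ : Type u} [NormedAddCommGroup E] [NormedSpace ℝ E] [FiniteDimensional ℝ E]
  [NormedAddCommGroup W₁] [NormedSpace ℝ W₁] [FiniteDimensional ℝ W₁]
  [NormedAddCommGroup W₂] [NormedSpace ℝ W₂] [FiniteDimensional ℝ W₂]

/-- The Lie bracket of two vector fields on a vector space. -/
def bracket {E : Type*} [NormedAddCommGroup E] [NormedSpace ℝ E] (ζ ζ' : E → E) (z : E) : E :=
  fderiv ℝ ζ' z (ζ z) - fderiv ℝ ζ z (ζ' z)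

/-- The range of the field `Q` of projections is closed under Lie brackets near `p`. -/
def IsInvolutiveNear {E : Type*} [NormedAddCommGroup E] [NormedSpace ℝ E] (Q : E → E →L[ℝ] E)
    (p : E) : Prop :=
  ∀ᶠ z in 𝓝 p, ∀ ζ ζ' : E → E, DifferentiableAt ℝ ζ z → DifferentiableAt ℝ ζ' z →
    (∀ᶠ y in 𝓝 z, Q y (ζ y) = ζ y) → (∀ᶠ y in 𝓝 z, Q y (ζ' y) = ζ' y) →
    Q z (bracket ζ ζ' z) = bracket ζ ζ' z

/-- An involutive distribution has a commuting frame. -/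
theorem exists_commuting_frame (e : (W₁ × W₂) ≃L[ℝ] E) {Q : E → E →L[ℝ] E} {p : E}
    (hQ : ∀ᶠ z in 𝓝 p, ContDiffAt ℝ ∞ Q z) (hidem : ∀ᶠ z in 𝓝 p, ∀ v, Q z (Q z v) = Q z v)
    (hp : ∀ v w, Q p (e (v, w)) = e (0, w)) (hinv : IsInvolutiveNear Q p) :
    ∃ a : E → W₂ →L[ℝ] E, ContDiff ℝ ∞ a ∧ (∀ w, a p w = e (0, w)) ∧
      (∀ᶠ z in 𝓝 p, ∀ w, Q z (a z w) = a z w) ∧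
      ∀ᶠ z in 𝓝 p, ∀ w w', fderiv ℝ a z (a z w) w' = fderiv ℝ a z (a z w') w := by
  let ι : W₂ →L[ℝ] E := (e : W₁ × W₂ →L[ℝ] E) ∘L ContinuousLinearMap.inr ℝ W₁ W₂
  let ρ : E →L[ℝ] W₂ := ContinuousLinearMap.snd ℝ W₁ W₂ ∘L (e.symm : E →L[ℝ] W₁ × W₂)
  -- The frame is normalized by `ρ ∘ a = id`. Since `m p` is the identity, `m z` is invertible near
  -- `p`, and `Q z ∘ ι ∘ (m z)⁻¹` is such a frame of the distribution.
  let m : E → W₂ →L[ℝ] W₂ := fun z => ρ ∘L Q z ∘L ι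
  have hmp : m p = ContinuousLinearMap.id ℝ W₂ := by
    ext w; simp [m, ρ, ι, hp]
  have hm : ∀ᶠ z in 𝓝 p, ContDiffAt ℝ ∞ m z := by
    filter_upwards [hQ] with z hz
    exact contDiffAt_const.clm_comp (hz.clm_comp contDiffAt_const)
  have hmi : ∀ᶠ z in 𝓝 p, ∃ L : W₂ ≃L[ℝ] W₂, (L : W₂ →L[ℝ] W₂) = m z := by
    have : range ((↑) : (W₂ ≃L[ℝ] W₂) → (W₂ →L[ℝ] W₂)) ∈ 𝓝 (m p) := by
      rw [hmp]; exact ContinuousLinearEquiv.nhds (ContinuousLinearEquiv.refl ℝ W₂)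
    exact hm.self_of_nhds.continuousAt this
  let a₀ : E → W₂ →L[ℝ] E := fun z => (Q z ∘L ι) ∘L (m z).inverse
  have ha₀ : ∀ᶠ z in 𝓝 p, ContDiffAt ℝ ∞ a₀ z := by
    filter_upwards [hQ, hm, hmi] with z h1 h2 ⟨L, hL⟩
    refine (h1.clm_comp contDiffAt_const).clm_comp ?_
    have h3 : ContDiffAt ℝ ∞ ContinuousLinearMap.inverse (m z) := hL ▸ contDiffAt_map_inverse L
    exact h3.comp z h2
  obtain ⟨a, ha, haa₀⟩ := exists_contDiff_eventuallyEq ha₀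
  have hρ : ∀ᶠ z in 𝓝 p, ∀ w, ρ (a z w) = w := by
    filter_upwards [haa₀, hmi] with z h1 ⟨L, hL⟩ w
    have : m z ((m z).inverse w) = w := by
      rw [← hL, ContinuousLinearMap.inverse_equiv]; simp
    rw [h1]
    exact this
  have hQa : ∀ᶠ z in 𝓝 p, ∀ w, Q z (a z w) = a z w := by
    filter_upwards [haa₀, hidem] with z h1 h2 w
    rw [h1]
    exact h2 _
  refine ⟨a, ha, fun w => ?_, hQa, ?_⟩
  · rw [haa₀.self_of_nhds]
    have : (m p).inverse w = w := by
      rw [hmp]; simp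
    change Q p (ι ((m p).inverse w)) = _
    rw [this]
    exact hp 0 w
  · have hsmall : ∀ᶠ z in 𝓝 p, ‖Q z - Q p‖ < 1 := by
      have := Metric.continuousAt_iff'.1 hQ.self_of_nhds.continuousAt 1 one_pos
      simpa [dist_eq_norm] using this
    filter_upwards [hinv, hρ.eventually_nhds, hQa.eventually_nhds, hsmall] with z h1 h2 h3 h4 w w'
    have hd : ∀ w, HasFDerivAt (fun z => a z w) ((fderiv ℝ a z).flip w) z := fun w => by
      have h5 := (ha.differentiable (by simp) z).hasFDerivAt.clm_apply (hasFDerivAt_const w z)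
      convert! h5 using 1
      simp
    have hb := h1 (fun z => a z w) (fun z => a z w') (hd w).differentiableAt
      (hd w').differentiableAt (h3.mono fun y hy => hy w) (h3.mono fun y hy => hy w')
    set b := bracket (fun z => a z w) (fun z => a z w') z with hbdef
    have hb' : b = fderiv ℝ a z (a z w) w' - fderiv ℝ a z (a z w') w := by
      rw [hbdef, bracket, (hd w).fderiv, (hd w').fderiv]; rfl
    -- The normalization makes `ρ (a z w)` constant in `z`, so `ρ` kills the derivatives of the
    -- frame and with them every bracket of frame fields.
    have hρd : ∀ v w, ρ (fderiv ℝ a z v w) = 0 := by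
      intro v w
      have h6 : HasFDerivAt (fun z => ρ (a z w)) _ z := ρ.hasFDerivAt.comp z (hd w)
      have h7 : HasFDerivAt (fun z => ρ (a z w)) (0 : E →L[ℝ] W₂) z :=
        (hasFDerivAt_const w z).congr_of_eventuallyEq (h2.mono fun y hy => hy w)
      exact congrArg (fun L : E →L[ℝ] W₂ => L v) (h6.unique h7)
    have hρb : ρ b = 0 := by rw [hb', map_sub, hρd, hρd, sub_zero]
    have hQpb : Q p b = 0 := by
      have h8 : b = e ((e.symm b).1, 0) := by
        have : e.symm b = ((e.symm b).1, 0) := Prod.ext rfl hρb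
        rw [← this, e.apply_symm_apply]
      rw [h8, hp]; simp
    -- By involutivity `Q z b = b`, while `ρ b = 0` puts `b` in the kernel of `Q p`. Hence `b = (Q z
    -- - Q p) b`, and `‖Q z - Q p‖ < 1` forces `b = 0`.
    have h9 : ‖b‖ ≤ ‖Q z - Q p‖ * ‖b‖ := by
      calc ‖b‖ = ‖(Q z - Q p) b‖ := by rw [sub_apply, hb, hQpb, sub_zero]
        _ ≤ _ := ContinuousLinearMap.le_opNorm _ _
    have h10 : b = 0 := by
      by_contra hne
      have := norm_pos_iff.2 hne
      nlinarith
    exact sub_eq_zero.1 (hb' ▸ h10)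

/-- The Frobenius theorem: an involutive distribution is the kernel of the differential of a map, near
any point. -/
theorem frobenius (e : (W₁ × W₂) ≃L[ℝ] E) {Q : E → E →L[ℝ] E} {p : E}
    (hQ : ∀ᶠ z in 𝓝 p, ContDiffAt ℝ ∞ Q z) (hidem : ∀ᶠ z in 𝓝 p, ∀ v, Q z (Q z v) = Q z v)
    (hp : ∀ v w, Q p (e (v, w)) = e (0, w)) (hinv : IsInvolutiveNear Q p) :
    ∃ h : E → W₁, (∀ᶠ z in 𝓝 p, ContDiffAt ℝ ∞ h z) ∧
      (∀ᶠ z in 𝓝 p, ∀ ζ, fderiv ℝ h z ζ = 0 → Q z ζ = ζ) ∧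
      ∀ v w, fderiv ℝ h p (e (v, w)) = v := by
  have := FiniteDimensional.complete ℝ E
  have := FiniteDimensional.complete ℝ W₁
  have := FiniteDimensional.complete ℝ W₂
  obtain ⟨a, ha, hap, hQa, hsymm⟩ := exists_commuting_frame e hQ hidem hp hinv
  obtain ⟨G, hG, hG0, hGa⟩ := exists_commuting_flow ha p hsymm
  let T : W₁ × W₂ →L[ℝ] E × W₂ :=
    (((e : W₁ × W₂ →L[ℝ] E) ∘L ContinuousLinearMap.inl ℝ W₁ W₂) ∘L
      ContinuousLinearMap.fst ℝ W₁ W₂).prod (ContinuousLinearMap.snd ℝ W₁ W₂)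
  have hT : ∀ u, T u = (e (u.1, 0), u.2) := fun u => rfl
  let τ : W₁ × W₂ → E × W₂ := fun u => (p, 0) + T u
  have hτ : ∀ u, HasFDerivAt τ T u := fun u => T.hasFDerivAt.const_add _
  have hτ0 : τ 0 = (p, 0) := by simp [τ]
  have hτc : Tendsto τ (𝓝 0) (𝓝 (p, 0)) := hτ0 ▸ (hτ 0).continuousAt
  -- The first variable moves `p` along the transversal `e (W₁ × 0)`, and the second flows along the
  -- leaf. The derivative at the origin is `e`, so `Φ` is a local diffeomorphism, and the first
  -- component of its inverse is the required map.
  let Φ : W₁ × W₂ → E := G ∘ τ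
  have hΦ0 : Φ 0 = p := by simp only [Φ, Function.comp, hτ0]; exact hG0.self_of_nhds
  have hΦ : ∀ᶠ u in 𝓝 0, ContDiffAt ℝ ∞ Φ u := by
    filter_upwards [hτc.eventually hG] with u hu
    exact hu.comp u (contDiff_const.add T.contDiff).contDiffAt
  have hGd := (hG.self_of_nhds.differentiableAt (by simp)).hasFDerivAt
  have hG' : ∀ v w, fderiv ℝ G (p, 0) (v, w) = v + e (0, w) := by
    intro v w
    have h1 : fderiv ℝ G (p, 0) (v, 0) = v := by
      have h2 : HasFDerivAt (fun z : E => G (z, (0 : W₂))) _ p :=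
        hGd.comp (f := fun z : E => (z, (0 : W₂))) p (hasFDerivAt_prodMk_left p (0 : W₂))
      have h3 : HasFDerivAt (fun z : E => G (z, (0 : W₂))) (ContinuousLinearMap.id ℝ E) p :=
        (hasFDerivAt_id p).congr_of_eventuallyEq hG0
      exact congrArg (fun L : E →L[ℝ] E => L v) (h2.unique h3)
    have h4 : fderiv ℝ G (p, 0) (0, w) = e (0, w) := by
      rw [hGa.self_of_nhds, hG0.self_of_nhds, hap]
    have h5 : ((v, w) : E × W₂) = (v, 0) + (0, w) := by simp
    rw [h5, map_add, h1, h4]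
  have hΦ' : HasFDerivAt Φ (e : W₁ × W₂ →L[ℝ] E) 0 := by
    have h1 : HasFDerivAt Φ _ 0 := HasFDerivAt.comp (0 : W₁ × W₂) (hτ0.symm ▸ hGd) (hτ 0)
    convert! h1 using 1
    ext u <;> simp [hτ0, hT, hG']
  obtain ⟨Θ, hΘ, h0, -, hΘs⟩ := exists_openPartialHomeomorph_contDiffOn hΦ e hΦ'
  have hpt : p ∈ Θ.target := by
    have := Θ.map_source h0
    rwa [hΘ, hΦ0] at this
  have hsp : Θ.symm p = 0 := by
    have := Θ.left_inv h0
    rwa [hΘ, hΦ0] at this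
  have hsd : ∀ᶠ z in 𝓝 p, ContDiffAt ℝ ∞ Θ.symm z := by
    filter_upwards [Θ.open_target.mem_nhds hpt] with z hz
    exact hΘs.contDiffAt (Θ.open_target.mem_nhds hz)
  have hsc : Tendsto Θ.symm (𝓝 p) (𝓝 0) := hsp ▸ hsd.self_of_nhds.continuousAt
  have hh : ∀ᶠ z in 𝓝 p, HasFDerivAt (fun z => (Θ.symm z).1)
      (ContinuousLinearMap.fst ℝ W₁ W₂ ∘L fderiv ℝ Θ.symm z) z := by
    filter_upwards [hsd] with z hz
    exact hasFDerivAt_fst.comp z (hz.differentiableAt (by simp)).hasFDerivAt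
  have hinvd : ∀ᶠ z in 𝓝 p, ∀ ζ, fderiv ℝ Φ (Θ.symm z) (fderiv ℝ Θ.symm z ζ) = ζ := by
    filter_upwards [hsd, hsc.eventually hΦ, Θ.open_target.mem_nhds hpt] with z h1 h2 h3 ζ
    have h4 : HasFDerivAt (fun z => Φ (Θ.symm z)) _ z :=
      (h2.differentiableAt (by simp)).hasFDerivAt.comp z (h1.differentiableAt (by simp)).hasFDerivAt
    have h5 : HasFDerivAt (fun z => Φ (Θ.symm z)) (ContinuousLinearMap.id ℝ E) z := by
      refine (hasFDerivAt_id z).congr_of_eventuallyEq ?_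
      filter_upwards [Θ.open_target.mem_nhds h3] with y hy
      rw [← hΘ, Θ.right_inv hy]; rfl
    exact congrArg (fun L : E →L[ℝ] E => L ζ) (h4.unique h5)
  refine ⟨fun z => (Θ.symm z).1, ?_, ?_, ?_⟩
  · filter_upwards [hsd] with z hz using contDiffAt_fst.comp z hz
  -- A vector annihilated by the differential of the first component is the image under the
  -- derivative of `Φ` of some `(0, w)`. That image is `a z w`, which lies in the range of `Q z`.
  · filter_upwards [hh, hinvd, hsc.eventually (hτc.eventually (hG.and hGa)),
      Θ.open_target.mem_nhds hpt, hQa] with z h1 h2 h3 h4 h5 ζ hζ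
    rw [h1.fderiv] at hζ
    have h6 : fderiv ℝ Θ.symm z ζ = (0, (fderiv ℝ Θ.symm z ζ).2) := Prod.ext hζ rfl
    have h7 : HasFDerivAt Φ _ (Θ.symm z) :=
      HasFDerivAt.comp (Θ.symm z) (h3.1.differentiableAt (by simp)).hasFDerivAt (hτ _)
    have h8 := h2 ζ
    have h9 : G (τ (Θ.symm z)) = z := by
      have := Θ.right_inv h4
      rwa [hΘ] at this
    rw [h7.fderiv, h6] at h8
    have h10 : T (0, (fderiv ℝ Θ.symm z ζ).2) = (0, (fderiv ℝ Θ.symm z ζ).2) := by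
      rw [hT]; simp
    rw [ContinuousLinearMap.comp_apply, h10, h3.2, h9] at h8
    rw [← h8]
    exact h5 _
  · intro v w
    rw [hh.self_of_nhds.fderiv]
    have h1 := hinvd.self_of_nhds (e (v, w))
    rw [hsp, hΦ'.fderiv] at h1
    have h2 : fderiv ℝ Θ.symm p (e (v, w)) = (v, w) := e.injective h1
    simp [h2]

end Frobenius

end PRSub

end

noncomputable section

namespace PRSub

/-! ### Christoffel symbols of a metric on a vector space -/

section ChristoffelFirst

variable {E E' : Type*} [NormedAddCommGroup E] [NormedSpace ℝ E]
  [NormedAddCommGroup E'] [NormedSpace ℝ E']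

/-- The Christoffel symbols of the first kind of a field of bilinear forms on a vector space. -/
def christoffelFirst (γ : E → E →L[ℝ] E →L[ℝ] ℝ) (z u v w : E) : ℝ :=
  1 / 2 * (fderiv ℝ γ z u v w + fderiv ℝ γ z v u w - fderiv ℝ γ z w u v)

theorem fderiv_apply_symm {γ : E → E →L[ℝ] E →L[ℝ] ℝ} {z : E} (hγ : DifferentiableAt ℝ γ z)
    (hs : ∀ᶠ y in 𝓝 z, ∀ u v, γ y u v = γ y v u) (w u v : E) :
    fderiv ℝ γ z w u v = fderiv ℝ γ z w v u := by
  have h : ∀ u v, HasFDerivAt (fun y => γ y u v) _ z := fun u v =>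
    (hγ.hasFDerivAt.clm_apply (hasFDerivAt_const u z)).clm_apply (hasFDerivAt_const v z)
  have h1 := (h v u).congr_of_eventuallyEq (hs.mono fun y hy => hy u v)
  simpa using congrArg (fun L : E →L[ℝ] ℝ => L w) ((h u v).unique h1)

theorem hasFDerivAt_apply_apply {γ : E → E' →L[ℝ] E' →L[ℝ] ℝ} {γ' : E →L[ℝ] E' →L[ℝ] E' →L[ℝ] ℝ}
    {z : E} (hγ : HasFDerivAt γ γ' z)
    {ζ ξ : E → E'} {ζ' ξ' : E →L[ℝ] E'} (hζ : HasFDerivAt ζ ζ' z) (hξ : HasFDerivAt ξ ξ' z) :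
    ∃ L : E →L[ℝ] ℝ, HasFDerivAt (fun y => γ y (ζ y) (ξ y)) L z ∧
      ∀ w, L w = γ' w (ζ z) (ξ z) + γ z (ζ' w) (ξ z) + γ z (ζ z) (ξ' w) := by
  refine ⟨_, (hγ.clm_apply hζ).clm_apply hξ, fun w => ?_⟩
  simp
  ring

/-- The first Christoffel symbols of a pullback metric. -/
theorem christoffelFirst_pullback {γ : E → E →L[ℝ] E →L[ℝ] ℝ} {G : E' → E' →L[ℝ] E' →L[ℝ] ℝ}
    {f : E → E'} {z : E} (hγ : DifferentiableAt ℝ γ z) (hG : DifferentiableAt ℝ G (f z))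
    (hf : ContDiffAt ℝ ∞ f z) (hs : ∀ u v, G (f z) u v = G (f z) v u)
    (hpull : ∀ᶠ y in 𝓝 z, ∀ u v, γ y u v = G (f y) (fderiv ℝ f y u) (fderiv ℝ f y v))
    (u v w : E) :
    christoffelFirst γ z u v w = G (f z) (fderiv ℝ (fderiv ℝ f) z u v) (fderiv ℝ f z w) +
      christoffelFirst G (f z) (fderiv ℝ f z u) (fderiv ℝ f z v) (fderiv ℝ f z w) := by
  have hf1 := (hf.differentiableAt (by simp)).hasFDerivAt
  have hf2 := ((hf.fderiv_right (m := 1) (WithTop.coe_le_coe.2 le_top)).differentiableAt (by simp)).hasFDerivAt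
  have hsym : ∀ u v, fderiv ℝ (fderiv ℝ f) z u v = fderiv ℝ (fderiv ℝ f) z v u :=
    hf.isSymmSndFDerivAt (n := ∞) (by
      rw [minSmoothness_of_isRCLikeNormedField]; exact WithTop.coe_le_coe.2 le_top)
  have hf3 : ∀ v, HasFDerivAt (fun y => fderiv ℝ f y v) ((fderiv ℝ (fderiv ℝ f) z).flip v) z := by
    intro v
    exact (hf2.clm_apply (hasFDerivAt_const v z)).congr_fderiv (by ext; simp)
  have hD : ∀ a b c, fderiv ℝ γ z a b c =
      fderiv ℝ G (f z) (fderiv ℝ f z a) (fderiv ℝ f z b) (fderiv ℝ f z c) +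
      G (f z) (fderiv ℝ (fderiv ℝ f) z a b) (fderiv ℝ f z c) +
      G (f z) (fderiv ℝ f z b) (fderiv ℝ (fderiv ℝ f) z a c) := by
    intro a b c
    have h1 : HasFDerivAt (fun y => γ y b c) _ z :=
      (hγ.hasFDerivAt.clm_apply (hasFDerivAt_const b z)).clm_apply (hasFDerivAt_const c z)
    obtain ⟨L, hL, hL'⟩ := hasFDerivAt_apply_apply (hG.hasFDerivAt.comp z hf1) (hf3 b) (hf3 c)
    have h2 := hL.congr_of_eventuallyEq (hpull.mono fun y hy => hy b c)
    have h3 := congrArg (fun L : E →L[ℝ] ℝ => L a) (h1.unique h2)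
    simp only [hL'] at h3
    simpa using h3
  -- Of the six terms with second derivatives of `f`, symmetry cancels four. The other two coincide
  -- and absorb the factor `1 / 2`.
  rw [christoffelFirst, christoffelFirst, hD, hD, hD, hsym v u, hsym w u, hsym w v,
    hs (fderiv ℝ f z v), hs (fderiv ℝ f z u)]
  ring

/-- If `ξ` is orthogonal to `ζ`, `ζ'` and the second fundamental form in the direction `ξ` is symmetric
on them, then `ξ` is orthogonal to their bracket. -/
theorem apply_bracket_eq_zero {γ : E → E →L[ℝ] E →L[ℝ] ℝ} {z : E} (hγ : DifferentiableAt ℝ γ z)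
    (hs : ∀ᶠ y in 𝓝 z, ∀ u v, γ y u v = γ y v u) {ζ ζ' ξ : E → E} (hζ : DifferentiableAt ℝ ζ z)
    (hζ' : DifferentiableAt ℝ ζ' z) (hξ : DifferentiableAt ℝ ξ z)
    (ho : ∀ᶠ y in 𝓝 z, γ y (ζ y) (ξ y) = 0) (ho' : ∀ᶠ y in 𝓝 z, γ y (ζ' y) (ξ y) = 0)
    (hS : γ z (fderiv ℝ ξ z (ζ z)) (ζ' z) + christoffelFirst γ z (ζ z) (ξ z) (ζ' z) =
      γ z (fderiv ℝ ξ z (ζ' z)) (ζ z) + christoffelFirst γ z (ζ' z) (ξ z) (ζ z)) :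
    γ z (bracket ζ ζ' z) (ξ z) = 0 := by
  -- The identity `γ (η, ξ) = 0` is differentiated. Subtracting the result for `ζ` along `ζ'` from
  -- the one for `ζ'` along `ζ` leaves `γ (bracket ζ ζ', ξ)` plus the difference of the two sides of
  -- `hS`.
  have key : ∀ {η : E → E}, DifferentiableAt ℝ η z → (∀ᶠ y in 𝓝 z, γ y (η y) (ξ y) = 0) → ∀ w,
      fderiv ℝ γ z w (η z) (ξ z) + γ z (fderiv ℝ η z w) (ξ z) + γ z (η z) (fderiv ℝ ξ z w) = 0 := by
    intro η hη ho w
    obtain ⟨L, hL, hL'⟩ := hasFDerivAt_apply_apply hγ.hasFDerivAt hη.hasFDerivAt hξ.hasFDerivAt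
    rw [← hL', hL.unique ((hasFDerivAt_const (0 : ℝ) z).congr_of_eventuallyEq ho)]
    rfl
  have h1 := key hζ' ho' (ζ z)
  have h2 := key hζ ho (ζ' z)
  have hsz := hs.self_of_nhds
  have hD := fderiv_apply_symm hγ hs
  simp only [christoffelFirst] at hS
  rw [hsz (fderiv ℝ ξ z (ζ z)), hsz (fderiv ℝ ξ z (ζ' z)), hD (ζ z) (ξ z), hD (ζ' z) (ξ z),
    hD (ξ z) (ζ z)] at hS
  rw [bracket, map_sub, sub_apply]
  linarith

end ChristoffelFirst

end PRSub

end

noncomputable section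

namespace PRSub

/-- In coordinates on the finite-dimensional source a linear map is the tuple of its values on a
basis, so smoothness can be tested vector by vector. -/
theorem contDiffAt_clm_apply_iff {D E F : Type*} [NormedAddCommGroup D] [NormedSpace ℝ D]
    [NormedAddCommGroup E] [NormedSpace ℝ E] [FiniteDimensional ℝ E] [NormedAddCommGroup F]
    [NormedSpace ℝ F] {f : D → E →L[ℝ] F} {x : D} {n : WithTop ℕ∞} :
    ContDiffAt ℝ n f x ↔ ∀ y, ContDiffAt ℝ n (fun x => f x y) x := by
  refine ⟨fun h y => h.clm_apply contDiffAt_const, fun h => ?_⟩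
  let e₁ : E ≃L[ℝ] (Fin (Module.finrank ℝ E) → ℝ) := ContinuousLinearEquiv.ofFinrankEq (by simp)
  let e₂ := (e₁.arrowCongr (1 : F ≃L[ℝ] F)).trans
    (ContinuousLinearEquiv.piRing (Fin (Module.finrank ℝ E)))
  rw [← Function.id_comp f, ← e₂.symm_comp_self]
  exact e₂.symm.contDiff.contDiffAt.comp x (contDiffAt_pi.mpr fun i => h _)

section Coordinates

variable {E : Type*} [NormedAddCommGroup E] [NormedSpace ℝ E]
  {E' : Type*} [NormedAddCommGroup E'] [NormedSpace ℝ E']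
  {N : Type*} [TopologicalSpace N] [ChartedSpace E' N] [IsManifold 𝓘(ℝ, E') ∞ N]

/-! ### Vector-valued descriptions of the data along a map from a vector space

Tangent vectors of `N` are regarded as elements of the model space `E'`. -/

/-- The differential of a map from a vector space. -/
def dmap (χ : E → N) (z : E) : E →L[ℝ] E' := mfderiv 𝓘(ℝ, E) 𝓘(ℝ, E') χ z

/-- The value of the metric, as a bilinear form on the model space. -/
def metricAt (g : PseudoRiemannianMetric E' N) (q : N) : E' →L[ℝ] E' →L[ℝ] ℝ := g.val q

/-- The value of an endomorphism field, as an endomorphism of the model space. -/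
def endAt (J : ∀ x : N, TangentSpace 𝓘(ℝ, E') x →L[ℝ] TangentSpace 𝓘(ℝ, E') x) (q : N) :
    E' →L[ℝ] E' := J q

/-- The metric induced by a map from a vector space, as a field of bilinear forms. -/
def coordMetric (g : PseudoRiemannianMetric E' N) (χ : E → N) : E → E →L[ℝ] E →L[ℝ] ℝ :=
  fun z => inducedMetric (E := E) g χ z

theorem coordMetric_apply (g : PseudoRiemannianMetric E' N) (χ : E → N) (z u v : E) :
    coordMetric g χ z u v = metricAt g (χ z) (dmap (E' := E') χ z u) (dmap (E' := E') χ z v) := rfl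

theorem metricAt_symm (g : PseudoRiemannianMetric E' N) (q : N) (u v : E') :
    metricAt g q u v = metricAt g q v u := g.symm q u v

theorem coordMetric_symm (g : PseudoRiemannianMetric E' N) (χ : E → N) (z u v : E) :
    coordMetric g χ z u v = coordMetric g χ z v u := g.symm _ _ _

/-- The covariant derivative along a map from a vector space. -/
def covCoord (g : PseudoRiemannianMetric E' N) (χ : E → N) (ξ : E → E') (z u : E) : E' :=
  covAlong (E := E) g χ (fun y => ξ y) z u

/-- The Christoffel symbols as a map on the model space. -/
def christoffelAt (g : PseudoRiemannianMetric E' N) (q : N) (u v : E') : E' := christoffel g q u v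

/-- The components of a field along a map, in the preferred chart at `q`. -/
def components (q : N) {M : Type*} (χ : M → N) (ξ : M → E') (y : M) : E' :=
  mfderiv 𝓘(ℝ, E') 𝓘(ℝ, E') (extChartAt 𝓘(ℝ, E') q) (χ y) (ξ y)

theorem covCoord_eq (g : PseudoRiemannianMetric E' N) (χ : E → N) (ξ : E → E') (z u : E) :
    covCoord g χ ξ z u = fderiv ℝ (components (χ z) χ ξ) z u +
      christoffelAt g (χ z) (dmap (E' := E') χ z u) (ξ z) := by
  rw [← mfderiv_eq_fderiv]; rfl

/-- Smoothness is stated in the total space of the tangent bundle, where smooth bilinear forms and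
endomorphism fields of `N` can be applied to the resulting field. -/
theorem contMDiffAt_mfderiv_apply {χ : E → N} {z : E} (hχ : ContMDiffAt 𝓘(ℝ, E) 𝓘(ℝ, E') ∞ χ z)
    {ζ : E → E} (hζ : ContDiffAt ℝ ∞ ζ z) :
    ContMDiffAt 𝓘(ℝ, E) 𝓘(ℝ, E').tangent ∞
      (fun y => TotalSpace.mk' E' (E := (TangentSpace 𝓘(ℝ, E') : N → Type _)) (χ y)
        (dmap (E' := E') χ y (ζ y))) z := by
  have h1 := ContMDiffAt.mfderiv_const (I := 𝓘(ℝ, E)) (I' := 𝓘(ℝ, E')) (m := ∞) hχ (by simp)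
  have h2 : ContMDiffAt 𝓘(ℝ, E) 𝓘(ℝ, E).tangent ∞
      (fun y => TotalSpace.mk' E (E := (TangentSpace 𝓘(ℝ, E) : E → Type _)) (id y) (ζ y)) z :=
    (contMDiffAt_vectorSpace_iff_contDiffAt (V := fun y => ζ y)).2 hζ
  exact ContMDiffAt.clm_apply_of_inCoordinates h1 h2 hχ

theorem contDiffAt_metric_apply (g : PseudoRiemannianMetric E' N) {χ : E → N} {z : E}
    (hχ : ContMDiffAt 𝓘(ℝ, E) 𝓘(ℝ, E') ∞ χ z) {ξ η : E → E'}
    (hξ : ContMDiffAt 𝓘(ℝ, E) 𝓘(ℝ, E').tangent ∞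
      (fun y => TotalSpace.mk' E' (E := (TangentSpace 𝓘(ℝ, E') : N → Type _)) (χ y) (ξ y)) z)
    (hη : ContMDiffAt 𝓘(ℝ, E) 𝓘(ℝ, E').tangent ∞
      (fun y => TotalSpace.mk' E' (E := (TangentSpace 𝓘(ℝ, E') : N → Type _)) (χ y) (η y)) z) :
    ContDiffAt ℝ ∞ (fun y => metricAt g (χ y) (ξ y) (η y)) z := by
  have h := ContMDiffAt.clm_bundle_apply₂ (E₃ := fun _ => ℝ) (F₃ := ℝ) (b := χ)
    (ψ := fun y => g.val (χ y)) (n := ∞) (g.contMDiff.contMDiffAt.comp z hχ) hξ hη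
  rw [contMDiffAt_totalSpace] at h
  exact h.2.contDiffAt

theorem contDiffAt_coordMetric [FiniteDimensional ℝ E] (g : PseudoRiemannianMetric E' N) {χ : E → N}
    {z : E} (hχ : ContMDiffAt 𝓘(ℝ, E) 𝓘(ℝ, E') ∞ χ z) : ContDiffAt ℝ ∞ (coordMetric g χ) z :=
  contDiffAt_clm_apply_iff.2 fun u => contDiffAt_clm_apply_iff.2 fun v =>
    contDiffAt_metric_apply g hχ (contMDiffAt_mfderiv_apply hχ (contDiffAt_const (c := u)))
      (contMDiffAt_mfderiv_apply hχ (contDiffAt_const (c := v)))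

/-! ### The preferred chart -/

theorem contMDiffAt_extChartAt_symm' {q : N} {w : E'} (hw : w ∈ (extChartAt 𝓘(ℝ, E') q).target) :
    ContMDiffAt 𝓘(ℝ, E') 𝓘(ℝ, E') ∞ (extChartAt 𝓘(ℝ, E') q).symm w :=
  (contMDiffOn_extChartAt_symm q).contMDiffAt ((isOpen_extChartAt_target q).mem_nhds hw)

/-- The model space is identified with the tangent space at `q` through this very chart, so the
derivative is the identity at the centre. At other points of the chart domain it need not be. -/
theorem dmap_extChartAt_symm_self (q : N) :
    dmap (E' := E') (extChartAt 𝓘(ℝ, E') q).symm (extChartAt 𝓘(ℝ, E') q q) =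
      ContinuousLinearMap.id ℝ E' := by
  have := mfderivWithin_range_extChartAt_symm (I := 𝓘(ℝ, E')) (x := q)
  rw [modelWithCornersSelf_coe, range_id, mfderivWithin_univ] at this
  exact this

theorem components_self (χ : E → N) (ξ : E → E') (z : E) : components (χ z) χ ξ z = ξ z := by
  have := mfderiv_extChartAt_self (I := 𝓘(ℝ, E')) (x := χ z)
  exact congrArg (fun L : E' →L[ℝ] E' => L (ξ z)) this

theorem dmap_extChartAt_symm_components {q : N} {M : Type*} (χ : M → N) (ξ : M → E') {y : M}
    (hy : χ y ∈ (extChartAt 𝓘(ℝ, E') q).source) :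
    dmap (E' := E') (extChartAt 𝓘(ℝ, E') q).symm (extChartAt 𝓘(ℝ, E') q (χ y))
      (components q χ ξ y) = ξ y := by
  have := mfderivWithin_extChartAt_symm_comp_mfderiv_extChartAt' (I := 𝓘(ℝ, E')) hy
  rw [modelWithCornersSelf_coe, range_id, mfderivWithin_univ] at this
  exact congrArg (fun L : E' →L[ℝ] E' => L (ξ y)) this

theorem components_dmap_extChartAt_symm {q p : N} (c : E')
    (hp : p ∈ (extChartAt 𝓘(ℝ, E') q).source) :
    components q id (fun p => dmap (E' := E') (extChartAt 𝓘(ℝ, E') q).symm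
      (extChartAt 𝓘(ℝ, E') q p) c) p = c := by
  have := mfderiv_extChartAt_comp_mfderivWithin_extChartAt_symm' (I := 𝓘(ℝ, E')) hp
  rw [modelWithCornersSelf_coe, range_id, mfderivWithin_univ] at this
  exact congrArg (fun L : E' →L[ℝ] E' => L c) this

/-- The coordinate expression of a map in the preferred chart at the image of a point. -/
def inChart (q : N) (χ : E → N) (y : E) : E' := extChartAt 𝓘(ℝ, E') q (χ y)

theorem contDiffAt_inChart {χ : E → N} {z : E} (hχ : ContMDiffAt 𝓘(ℝ, E) 𝓘(ℝ, E') ∞ χ z) :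
    ContDiffAt ℝ ∞ (inChart (E' := E') (χ z) χ) z :=
  ((contMDiffAt_extChartAt (I := 𝓘(ℝ, E')) (n := ∞) (x := χ z)).comp z hχ).contDiffAt

theorem eventually_mem_source {χ : E → N} {z : E} (hχ : ContinuousAt χ z) :
    ∀ᶠ y in 𝓝 z, χ y ∈ (extChartAt 𝓘(ℝ, E') (χ z)).source :=
  hχ (extChartAt_source_mem_nhds (χ z))

theorem eventually_mdifferentiableAt {χ : E → N} {z : E}
    (hχ : ContMDiffAt 𝓘(ℝ, E) 𝓘(ℝ, E') ∞ χ z) :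
    ∀ᶠ y in 𝓝 z, MDifferentiableAt 𝓘(ℝ, E) 𝓘(ℝ, E') χ y := by
  have h : ContMDiffAt 𝓘(ℝ, E) 𝓘(ℝ, E') 1 χ z := hχ.of_le (WithTop.coe_le_coe.2 le_top)
  have := (contMDiffAt_iff_contMDiffAt_nhds (by simp)).1 h
  exact this.mono fun y hy => hy.mdifferentiableAt (by simp)

theorem fderiv_inChart {χ : E → N} {q : N} {y : E}
    (hχ : MDifferentiableAt 𝓘(ℝ, E) 𝓘(ℝ, E') χ y)
    (hy : χ y ∈ (extChartAt 𝓘(ℝ, E') q).source) (u : E) :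
    fderiv ℝ (inChart (E' := E') q χ) y u = components q χ (fun y => dmap (E' := E') χ y u) y := by
  rw [extChartAt_source] at hy
  have h := mfderiv_comp y (mdifferentiableAt_extChartAt (I := 𝓘(ℝ, E')) hy) hχ
  have h2 : mfderiv 𝓘(ℝ, E) 𝓘(ℝ, E') (inChart (E' := E') q χ) y =
    fderiv ℝ (inChart (E' := E') q χ) y := mfderiv_eq_fderiv
  rw [← h2]
  exact congrArg (fun L : E →L[ℝ] E' => L u) h

theorem fderiv_inChart_self {χ : E → N} {z : E} (hχ : MDifferentiableAt 𝓘(ℝ, E) 𝓘(ℝ, E') χ z)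
    (u : E) : fderiv ℝ (inChart (E' := E') (χ z) χ) z u = dmap (E' := E') χ z u := by
  rw [fderiv_inChart hχ (mem_extChartAt_source (χ z)), components_self]

theorem coordMetric_eq_chartMetric (g : PseudoRiemannianMetric E' N) {χ : E → N} {q : N} {y : E}
    (hχ : MDifferentiableAt 𝓘(ℝ, E) 𝓘(ℝ, E') χ y)
    (hy : χ y ∈ (extChartAt 𝓘(ℝ, E') q).source) (u v : E) :
    coordMetric g χ y u v = chartMetric g q (inChart q χ y)
      (fderiv ℝ (inChart (E' := E') q χ) y u) (fderiv ℝ (inChart (E' := E') q χ) y v) := by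
  rw [fderiv_inChart hχ hy, fderiv_inChart hχ hy]
  have h1 := dmap_extChartAt_symm_components (q := q) χ (fun y => dmap (E' := E') χ y u) hy
  have h2 := dmap_extChartAt_symm_components (q := q) χ (fun y => dmap (E' := E') χ y v) hy
  rw [coordMetric_apply]
  change _ = metricAt g ((extChartAt 𝓘(ℝ, E') q).symm (inChart q χ y)) (dmap (E' := E') _ _ _)
    (dmap (E' := E') _ _ _)
  rw [inChart, h1, h2, (extChartAt 𝓘(ℝ, E') q).left_inv hy]

theorem chartMetric_eq_coordMetric (g : PseudoRiemannianMetric E' N) (q : N) :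
    chartMetric g q = coordMetric g (extChartAt 𝓘(ℝ, E') q).symm := rfl

theorem chartMetric_self (g : PseudoRiemannianMetric E' N) (q : N) :
    chartMetric g q (extChartAt 𝓘(ℝ, E') q q) = metricAt g q := by
  ext u v
  rw [chartMetric_eq_coordMetric, coordMetric_apply, dmap_extChartAt_symm_self,
    (extChartAt 𝓘(ℝ, E') q).left_inv (mem_extChartAt_source q)]
  rfl

theorem contDiffAt_chartMetric [FiniteDimensional ℝ E'] (g : PseudoRiemannianMetric E' N) (q : N) :
    ContDiffAt ℝ ∞ (chartMetric g q) (extChartAt 𝓘(ℝ, E') q q) :=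
  contDiffAt_coordMetric g (contMDiffAt_extChartAt_symm' (mem_extChartAt_target q))

/-- Pairing with the metric undoes `sharp` and lowers the index. Symbols of the first kind have a
simple transformation law under pullback, `christoffelFirst_pullback`. -/
theorem metricAt_christoffelAt [FiniteDimensional ℝ E'] (g : PseudoRiemannianMetric E' N) (q : N)
    (u v w : E') : metricAt g q (christoffelAt g q u v) w =
      christoffelFirst (chartMetric g q) (extChartAt 𝓘(ℝ, E') q q) u v w := by
  have hG := ((contDiffAt_chartMetric g q).differentiableAt (by simp)).hasFDerivAt
  have h1 : ∀ a, HasFDerivAt (fun z => chartMetric g q z a) _ (extChartAt 𝓘(ℝ, E') q q) :=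
    fun a => hG.clm_apply (hasFDerivAt_const a _)
  have h2 : ∀ a b, HasFDerivAt (fun z => chartMetric g q z a b) _ (extChartAt 𝓘(ℝ, E') q q) :=
    fun a b => (h1 a).clm_apply (hasFDerivAt_const b _)
  have h := apply_sharp (metricAt g q) (g.nondegenerate q) ((1 / 2 : ℝ) •
    (fderiv ℝ (fun z ↦ chartMetric g q z v) (extChartAt 𝓘(ℝ, E') q q) u
      + fderiv ℝ (fun z ↦ chartMetric g q z u) (extChartAt 𝓘(ℝ, E') q q) v
      - fderiv ℝ (fun z ↦ chartMetric g q z u v) (extChartAt 𝓘(ℝ, E') q q)))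
  have h' := congrArg (fun L : E' →L[ℝ] ℝ => L w) h
  refine Eq.trans h' ?_
  rw [(h1 u).fderiv, (h1 v).fderiv, (h2 u v).fderiv]
  simp [christoffelFirst]

/-- The Koszul formula for the tangential part of the covariant derivative along a map. -/
theorem metricAt_covCoord_dmap [FiniteDimensional ℝ E] [FiniteDimensional ℝ E']
    (g : PseudoRiemannianMetric E' N) {χ : E → N} {z : E}
    (hχ : ContMDiffAt 𝓘(ℝ, E) 𝓘(ℝ, E') ∞ χ z) {ζ : E → E} (hζ : DifferentiableAt ℝ ζ z) (u w : E) :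
    metricAt g (χ z) (covCoord g χ (fun y => dmap (E' := E') χ y (ζ y)) z u)
        (dmap (E' := E') χ z w) =
      coordMetric g χ z (fderiv ℝ ζ z u) w + christoffelFirst (coordMetric g χ) z u (ζ z) w := by
  have hd := eventually_mdifferentiableAt hχ
  have hs := eventually_mem_source (E' := E') hχ.continuousAt
  have hf := contDiffAt_inChart hχ
  have hf2 := ((hf.fderiv_right (m := 1) (WithTop.coe_le_coe.2 le_top)).differentiableAt
    (by simp)).hasFDerivAt
  -- In the chart at `χ z` the field `dχ ζ` has components `Df (ζ)`, with `f` the coordinate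
  -- expression of `χ`. The second derivative of `f` produced here is the extra term in
  -- `christoffelFirst_pullback`.
  have hcomp : components (χ z) χ (fun y => dmap (E' := E') χ y (ζ y)) =ᶠ[𝓝 z]
      fun y => fderiv ℝ (inChart (E' := E') (χ z) χ) y (ζ y) := by
    filter_upwards [hd, hs] with y h1 h2
    rw [fderiv_inChart h1 h2]; rfl
  have hcd := (hf2.clm_apply hζ.hasFDerivAt).congr_of_eventuallyEq hcomp
  have hz : extChartAt 𝓘(ℝ, E') (χ z) (χ z) = inChart (χ z) χ z := rfl
  have hpull := christoffelFirst_pullback (γ := coordMetric g χ) (G := chartMetric g (χ z))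
    (f := inChart (χ z) χ) (z := z)
    ((contDiffAt_coordMetric g hχ).differentiableAt (by simp))
    ((contDiffAt_chartMetric g (χ z)).differentiableAt (by simp)) hf
    (fun u v => by rw [← hz, chartMetric_self, metricAt_symm])
    (by filter_upwards [hd, hs] with y h1 h2 u v using coordMetric_eq_chartMetric g h1 h2 u v)
    u (ζ z) w
  have hself := fderiv_inChart_self hd.self_of_nhds
  rw [covCoord_eq, hcd.fderiv, hpull, map_add, add_apply, metricAt_christoffelAt, ← hz,
    chartMetric_self]
  simp only [hself, add_apply, ContinuousLinearMap.comp_apply,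
    ContinuousLinearMap.flip_apply, map_add, coordMetric_apply]
  ring

end Coordinates

end PRSub

end

noncomputable section

namespace PRSub

/-! ### Parallel `J` and the symmetric second fundamental form -/

section ParaKahler

variable {E : Type*} [NormedAddCommGroup E] [NormedSpace ℝ E]
  {E' : Type*} [NormedAddCommGroup E'] [NormedSpace ℝ E']
  {N : Type*} [TopologicalSpace N] [ChartedSpace E' N] [IsManifold 𝓘(ℝ, E') ∞ N]
  {g : PseudoRiemannianMetric E' N}
  {J : ∀ x : N, TangentSpace 𝓘(ℝ, E') x →L[ℝ] TangentSpace 𝓘(ℝ, E') x}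

/-- The differential of a vector-valued function on a manifold. -/
def vderiv {F : Type*} [NormedAddCommGroup F] [NormedSpace ℝ F] (f : N → F) (q : N) : E' →L[ℝ] F :=
  mfderiv 𝓘(ℝ, E') 𝓘(ℝ, F) f q

theorem metricAt_nondegenerate (g : PseudoRiemannianMetric E' N) {q : N} {v : E'}
    (h : ∀ w : E', metricAt g q v w = 0) : v = 0 :=
  g.nondegenerate q v h

theorem totalSpace_mk_eq {p p' : N} (h : p' = p) (v : E') :
    (TotalSpace.mk' E' (E := (TangentSpace 𝓘(ℝ, E') : N → Type _)) p v) =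
      TotalSpace.mk' E' (E := (TangentSpace 𝓘(ℝ, E') : N → Type _)) p' v := by
  subst h; rfl

/-- The components of an endomorphism field in the preferred chart at `q`. -/
def endComponents (J : ∀ x : N, TangentSpace 𝓘(ℝ, E') x →L[ℝ] TangentSpace 𝓘(ℝ, E') x) (q p : N) :
    E' →L[ℝ] E' :=
  vderiv (E' := E') (extChartAt 𝓘(ℝ, E') q) p ∘L endAt J p ∘L
    dmap (E' := E') (extChartAt 𝓘(ℝ, E') q).symm (extChartAt 𝓘(ℝ, E') q p)

theorem endComponents_components {q : N} {M : Type*} (χ : M → N) (ξ : M → E') {y : M}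
    (hy : χ y ∈ (extChartAt 𝓘(ℝ, E') q).source) :
    endComponents J q (χ y) (components q χ ξ y) =
      components q χ (fun y => endAt J (χ y) (ξ y)) y := by
  simp only [endComponents, ContinuousLinearMap.comp_apply]
  rw [dmap_extChartAt_symm_components χ ξ hy]
  rfl

theorem endComponents_self (q : N) : endComponents J q q = endAt J q := by
  ext v
  have h := endComponents_components (J := J) (q := q) (id : N → N) (fun _ => v) (y := q)
    (mem_extChartAt_source q)
  have h1 : ∀ w : E', components q (id : N → N) (fun _ => w) q = w := fun w =>
    congrArg (fun L : E' →L[ℝ] E' => L w) (mfderiv_extChartAt_self (I := 𝓘(ℝ, E')) (x := q))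
  have h2 : components q (id : N → N) (fun y => endAt J (id y) v) q = endAt J q v :=
    congrArg (fun L : E' →L[ℝ] E' => L _) (mfderiv_extChartAt_self (I := 𝓘(ℝ, E')) (x := q))
  rw [h1, h2] at h
  exact h

theorem contMDiffAt_endComponents (hK : IsParaKahler g J) (q : N) :
    ContMDiffAt 𝓘(ℝ, E') 𝓘(ℝ, E' →L[ℝ] E') ∞ (endComponents J q) q := by
  have h := ((contMDiffAt_hom_bundle _).1 (hK.contMDiff.contMDiffAt (x := q))).2
  refine h.congr_of_eventuallyEq ?_
  filter_upwards [extChartAt_source_mem_nhds (I := 𝓘(ℝ, E')) q] with p hp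
  rw [extChartAt_source] at hp
  have h1 := inTangentCoordinates_eq_mfderiv_comp (I := 𝓘(ℝ, E')) (I' := 𝓘(ℝ, E')) (f := (id : N → N))
    (g := (id : N → N)) (ϕ := fun p => J p) (x₀ := q) (x := p) hp hp
  rw [modelWithCornersSelf_coe, range_id, mfderivWithin_univ] at h1
  exact h1.symm

/-- This is `∇J = 0` as an identity between components at one point. It comes from testing
parallelism on a field with constant components in the chart, and unlike the hypothesis on vector
fields of `N` it applies to fields along a map. -/
theorem mfderiv_endComponents_add (hK : IsParaKahler g J) (q : N) (u c : E') :
    vderiv (E' := E') (endComponents J q) q u c +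
      christoffelAt g q u (endAt J q c) = endAt J q (christoffelAt g q u c) := by
  -- The field whose components in the chart at `q` are constantly `c`, so that `∇_u Y` reduces to
  -- the Christoffel term.
  let Y : N → E' := fun p => dmap (E' := E') (extChartAt 𝓘(ℝ, E') q).symm (extChartAt 𝓘(ℝ, E') q p) c
  have hYq : Y q = c := by
    simp only [Y, dmap_extChartAt_symm_self]; rfl
  have hYc : ∀ᶠ p in 𝓝 q, components q id Y p = c := by
    filter_upwards [extChartAt_source_mem_nhds (I := 𝓘(ℝ, E')) q] with p hp
    exact components_dmap_extChartAt_symm c hp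
  have hY : MDifferentiableAt 𝓘(ℝ, E') 𝓘(ℝ, E').tangent
      (fun y ↦ (⟨y, Y y⟩ : TangentBundle 𝓘(ℝ, E') N)) q := by
    have h1 := contMDiffAt_mfderiv_apply (contMDiffAt_extChartAt_symm' (mem_extChartAt_target q))
      (contDiffAt_const (c := c))
    have h2 := h1.comp q (contMDiffAt_extChartAt (I := 𝓘(ℝ, E')) (n := ∞))
    refine (h2.mdifferentiableAt (by simp)).congr_of_eventuallyEq ?_
    filter_upwards [extChartAt_source_mem_nhds (I := 𝓘(ℝ, E')) q] with p hp
    have h3 := (extChartAt 𝓘(ℝ, E') q).left_inv hp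
    exact totalSpace_mk_eq h3 (Y p)
  have hpar := hK.parallel q u Y hY
  have hmf : ∀ v : E', (mfderiv 𝓘(ℝ, E') 𝓘(ℝ, E') (fun y : N => y) q : E' →L[ℝ] E') v = v := by
    intro v
    exact congrArg (fun L : E' →L[ℝ] E' => L v) (mfderiv_id (I := 𝓘(ℝ, E')) (x := q))
  have h1 : (covDeriv g Y q u : E') = christoffelAt g q u c := by
    have h2 : HasMFDerivAt 𝓘(ℝ, E') 𝓘(ℝ, E') (components q id Y) q (0 : E' →L[ℝ] E') :=
      (hasMFDerivAt_const c q).congr_of_eventuallyEq hYc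
    have h3 : (covDeriv g Y q u : E') =
      vderiv (E' := E') (components q id Y) q u +
      christoffelAt g q ((mfderiv 𝓘(ℝ, E') 𝓘(ℝ, E') (fun y : N => y) q : E' →L[ℝ] E') u) (Y q) := rfl
    rw [h3, vderiv, h2.mfderiv, hmf, hYq]
    exact zero_add _
  have h4 : (covDeriv g (fun y => J y (Y y)) q u : E') =
      vderiv (E' := E') (endComponents J q) q u c +
      christoffelAt g q u (endAt J q c) := by
    have h2 : HasMFDerivAt 𝓘(ℝ, E') 𝓘(ℝ, E') (fun p => endComponents J q p c) q
        ((ContinuousLinearMap.apply ℝ E' c) ∘L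
          vderiv (E' := E') (endComponents J q) q) :=
      HasMFDerivAt.comp q (ContinuousLinearMap.apply ℝ E' c).hasMFDerivAt
        ((contMDiffAt_endComponents hK q).mdifferentiableAt (by simp)).hasMFDerivAt
    have h5 : components q id (fun y => endAt J (id y) (Y y)) =ᶠ[𝓝 q] fun p => endComponents J q p c := by
      filter_upwards [hYc, extChartAt_source_mem_nhds (I := 𝓘(ℝ, E')) q] with p h6 h7
      rw [← endComponents_components id Y h7, h6]
      rfl
    have h8 := (h2.congr_of_eventuallyEq h5).mfderiv
    have h3 : (covDeriv g (fun y => J y (Y y)) q u : E') =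
      vderiv (E' := E') (components q id (fun y => endAt J (id y) (Y y))) q u +
      christoffelAt g q ((mfderiv 𝓘(ℝ, E') 𝓘(ℝ, E') (fun y : N => y) q : E' →L[ℝ] E') u)
        (endAt J q (Y q)) := rfl
    rw [h3, vderiv, h8, hmf, hYq]
    rfl
  rw [← h4, ← h1]
  exact hpar

/-- Fields along `χ` need not extend to `N`. The product rule in the chart is used instead, and
`mfderiv_endComponents_add` removes the derivative of the components of `J`. -/
theorem covCoord_endAt (hK : IsParaKahler g J) {χ : E → N} {z : E}
    (hχ : MDifferentiableAt 𝓘(ℝ, E) 𝓘(ℝ, E') χ z) {ξ : E → E'}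
    (hξ : DifferentiableAt ℝ (components (χ z) χ ξ) z) (u : E) :
    covCoord g χ (fun y => endAt J (χ y) (ξ y)) z u = endAt J (χ z) (covCoord g χ ξ z u) := by
  have h1 : HasFDerivAt (fun y => endComponents J (χ z) (χ y))
      (vderiv (E' := E') (endComponents J (χ z)) (χ z) ∘L dmap (E' := E') χ z) z :=
    (HasMFDerivAt.comp z ((contMDiffAt_endComponents hK (χ z)).mdifferentiableAt
      (by simp)).hasMFDerivAt hχ.hasMFDerivAt).hasFDerivAt
  have h2 : components (χ z) χ (fun y => endAt J (χ y) (ξ y)) =ᶠ[𝓝 z]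
      fun y => endComponents J (χ z) (χ y) (components (χ z) χ ξ y) := by
    filter_upwards [eventually_mem_source (E' := E') hχ.continuousAt] with y hy
    rw [endComponents_components χ ξ hy]
  have h3 := (h1.clm_apply hξ.hasFDerivAt).congr_of_eventuallyEq h2
  rw [covCoord_eq, covCoord_eq, h3.fderiv, map_add,
    ← mfderiv_endComponents_add hK (χ z) _ (ξ z), components_self, endComponents_self]
  simp only [add_apply, ContinuousLinearMap.comp_apply, ContinuousLinearMap.flip_apply]
  abel

theorem differentiableAt_components_dmap {χ : E → N} {z : E}
    (hχ : ContMDiffAt 𝓘(ℝ, E) 𝓘(ℝ, E') ∞ χ z) {ζ : E → E} (hζ : DifferentiableAt ℝ ζ z) :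
    DifferentiableAt ℝ (components (χ z) χ (fun y => dmap (E' := E') χ y (ζ y))) z := by
  have hf2 := (((contDiffAt_inChart hχ).fderiv_right (m := 1)
    (WithTop.coe_le_coe.2 le_top)).differentiableAt (by simp))
  refine (hf2.clm_apply hζ).congr_of_eventuallyEq ?_
  filter_upwards [eventually_mdifferentiableAt hχ, eventually_mem_source (E' := E') hχ.continuousAt]
    with y h1 h2
  rw [fderiv_inChart h1 h2]; rfl

/-- The second fundamental form is symmetric: modulo tangent vectors, `∇_u (dχ ζ)` depends only on
`u` and `ζ z`, symmetrically. -/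
theorem metricAt_covCoord_symm [FiniteDimensional ℝ E'] {χ : E → N} {z : E}
    (hχ : ContMDiffAt 𝓘(ℝ, E) 𝓘(ℝ, E') ∞ χ z) {ζ ξ : E → E} (hζ : DifferentiableAt ℝ ζ z)
    (hξ : DifferentiableAt ℝ ξ z) {ν : E'}
    (hν : ∀ w : E, metricAt g (χ z) (dmap (E' := E') χ z w) ν = 0) :
    metricAt g (χ z) (covCoord g χ (fun y => dmap (E' := E') χ y (ζ y)) z (ξ z)) ν =
      metricAt g (χ z) (covCoord g χ (fun y => dmap (E' := E') χ y (ξ y)) z (ζ z)) ν := by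
  have hd := eventually_mdifferentiableAt hχ
  have hs := eventually_mem_source (E' := E') hχ.continuousAt
  have hf := contDiffAt_inChart hχ
  have hf2 := ((hf.fderiv_right (m := 1) (WithTop.coe_le_coe.2 le_top)).differentiableAt
    (by simp)).hasFDerivAt
  have hsym := (hf.isSymmSndFDerivAt (n := ∞) (by
    rw [minSmoothness_of_isRCLikeNormedField]; exact WithTop.coe_le_coe.2 le_top)).eq
  have hself := fderiv_inChart_self hd.self_of_nhds
  -- The second derivative and the Christoffel term are symmetric in `u` and `ζ z`. The remaining
  -- term is tangent, and `ν` annihilates it.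
  have key : ∀ {ζ : E → E}, DifferentiableAt ℝ ζ z → ∀ u,
      covCoord g χ (fun y => dmap (E' := E') χ y (ζ y)) z u =
        fderiv ℝ (fderiv ℝ (inChart (E' := E') (χ z) χ)) z u (ζ z) +
        dmap (E' := E') χ z (fderiv ℝ ζ z u) +
        christoffelAt g (χ z) (dmap (E' := E') χ z u) (dmap (E' := E') χ z (ζ z)) := by
    intro ζ hζ u
    have hcomp : components (χ z) χ (fun y => dmap (E' := E') χ y (ζ y)) =ᶠ[𝓝 z]
        fun y => fderiv ℝ (inChart (E' := E') (χ z) χ) y (ζ y) := by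
      filter_upwards [hd, hs] with y h1 h2
      rw [fderiv_inChart h1 h2]; rfl
    rw [covCoord_eq, ((hf2.clm_apply hζ.hasFDerivAt).congr_of_eventuallyEq hcomp).fderiv]
    simp only [add_apply, ContinuousLinearMap.comp_apply, ContinuousLinearMap.flip_apply, hself]
    abel
  have hΓ : ∀ u v : E', christoffelAt g (χ z) u v = christoffelAt g (χ z) v u := by
    intro u v
    refine sub_eq_zero.1 (metricAt_nondegenerate g (q := χ z) fun w => ?_)
    have hsymm := fderiv_apply_symm ((contDiffAt_chartMetric g (χ z)).differentiableAt (by simp))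
      (Eventually.of_forall fun y u v => by
        rw [chartMetric_eq_coordMetric, coordMetric_symm])
    rw [map_sub, sub_apply, metricAt_christoffelAt, metricAt_christoffelAt, christoffelFirst,
      christoffelFirst, hsymm w u v]
    ring
  rw [key hζ, key hξ, hsym (ξ z), hΓ (dmap χ z (ξ z))]
  simp only [map_add, add_apply, hν]

end ParaKahler

end PRSub

end

noncomputable section

namespace PRSub

/-! ### Linear algebra of a PR-submanifold at a point -/

section Submanifold

variable {E : Type*} [NormedAddCommGroup E] [NormedSpace ℝ E] [FiniteDimensional ℝ E]
  {M : Type*} [TopologicalSpace M] [ChartedSpace E M] [IsManifold 𝓘(ℝ, E) ∞ M]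
  {E' : Type*} [NormedAddCommGroup E'] [NormedSpace ℝ E'] [FiniteDimensional ℝ E']
  {N : Type*} [TopologicalSpace N] [ChartedSpace E' N] [IsManifold 𝓘(ℝ, E') ∞ N]
  {g : PseudoRiemannianMetric E' N}
  {J : ∀ x : N, TangentSpace 𝓘(ℝ, E') x →L[ℝ] TangentSpace 𝓘(ℝ, E') x}
  {φ : M → N} {D D' : ∀ x : M, Submodule ℝ (TangentSpace 𝓘(ℝ, E) x)}

/-- The differential of a map between manifolds, as a map between the model spaces. -/
def mmap (φ : M → N) (x : M) : E →L[ℝ] E' := mfderiv 𝓘(ℝ, E) 𝓘(ℝ, E') φ x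

/-- A distribution, as a family of subspaces of the model space. -/
def distAt (D : ∀ x : M, Submodule ℝ (TangentSpace 𝓘(ℝ, E) x)) (x : M) : Submodule ℝ E := D x

/-- The tangential part, as a vector of the model space. -/
def tanAt (g : PseudoRiemannianMetric E' N) (φ : M → N) (x : M) (ν : E') : E :=
  tanPart (E := E) g φ x ν

/-- The operator `P`, on the model space. -/
def tangAt (g : PseudoRiemannianMetric E' N)
    (J : ∀ x : N, TangentSpace 𝓘(ℝ, E') x →L[ℝ] TangentSpace 𝓘(ℝ, E') x) (φ : M → N) (x : M)
    (X : E) : E := tangOp (E := E) g J φ x X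

/-- The operator `F`, on the model space. -/
def normAt (g : PseudoRiemannianMetric E' N)
    (J : ∀ x : N, TangentSpace 𝓘(ℝ, E') x →L[ℝ] TangentSpace 𝓘(ℝ, E') x) (φ : M → N) (x : M)
    (X : E) : E' := normOp (E := E) g J φ x X

/-- The shape operator of the normal field `F Z`, as a vector of the model space. -/
def shapeAt (g : PseudoRiemannianMetric E' N)
    (J : ∀ x : N, TangentSpace 𝓘(ℝ, E') x →L[ℝ] TangentSpace 𝓘(ℝ, E') x) (φ : M → N) (Z : M → E)
    (x : M) (X : E) : E :=
  shapeOperator (E := E) g φ (fun y => normOp (E := E) g J φ y (Z y)) x X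

theorem inducedMetric_tanAt (hφ : IsPseudoRiemannianSubmanifold (E := E) g φ) (x : M) (ν : E')
    (w : E) : metricAt g (φ x) (mmap (E' := E') φ x (tanAt (E := E) g φ x ν)) (mmap (E' := E') φ x w) =
      metricAt g (φ x) ν (mmap (E' := E') φ x w) := by
  have h := apply_sharp (E := E) (inducedMetric (E := E) g φ x) (hφ.nondegenerate x)
    ((metricAt g (φ x) ν).comp (mmap (E' := E') φ x))
  exact congrArg (fun L : E →L[ℝ] ℝ => L w) h

theorem eq_zero_of_metricAt_mmap (hφ : IsPseudoRiemannianSubmanifold (E := E) g φ) {x : M} {v : E}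
    (h : ∀ w : E, metricAt g (φ x) (mmap (E' := E') φ x v) (mmap (E' := E') φ x w) = 0) : v = 0 :=
  hφ.nondegenerate x v h

theorem tanAt_mmap (hφ : IsPseudoRiemannianSubmanifold (E := E) g φ) (x : M) (v : E) :
    tanAt (E := E) g φ x (mmap (E' := E') φ x v) = v := by
  refine sub_eq_zero.1 (eq_zero_of_metricAt_mmap hφ (x := x) fun w => ?_)
  rw [map_sub, map_sub, sub_apply, inducedMetric_tanAt hφ, sub_self]

theorem tanAt_eq_zero (hφ : IsPseudoRiemannianSubmanifold (E := E) g φ) {x : M} {ν : E'}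
    (h : ∀ w : E, metricAt g (φ x) ν (mmap (E' := E') φ x w) = 0) : tanAt (E := E) g φ x ν = 0 := by
  refine eq_zero_of_metricAt_mmap hφ (x := x) fun w => ?_
  rw [inducedMetric_tanAt hφ, h]

theorem endAt_endAt (hK : IsParaKahler g J) (q : N) (u : E') : endAt J q (endAt J q u) = u :=
  hK.sq q u

theorem metricAt_endAt (hK : IsParaKahler g J) (q : N) (u v : E') :
    metricAt g q (endAt J q u) v = -metricAt g q u (endAt J q v) := by
  have h1 : metricAt g q (endAt J q u) (endAt J q (endAt J q v)) =
    -metricAt g q u (endAt J q v) := hK.anti q u (endAt J q v)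
  rwa [endAt_endAt hK] at h1

theorem exists_endAt_mmap (hM : IsPRSubmanifold g J φ D D') {x : M} {X : E} (hX : X ∈ distAt D x) :
    ∃ Y ∈ distAt D x, endAt J (φ x) (mmap (E' := E') φ x X) = mmap (E' := E') φ x Y := by
  have h : endAt J (φ x) (mmap (E' := E') φ x X) ∈
      (fun X ↦ endAt J (φ x) (mmap (E' := E') φ x X)) '' (distAt D x : Set E) := ⟨X, hX, rfl⟩
  have h2 := (hM.invariant x).subset h
  obtain ⟨Y, hY, h3⟩ := h2
  exact ⟨Y, hY, h3.symm⟩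

theorem metricAt_endAt_mmap (hM : IsPRSubmanifold g J φ D D') {x : M} {Z : E}
    (hZ : Z ∈ distAt D' x) (w : E) :
    metricAt g (φ x) (endAt J (φ x) (mmap (E' := E') φ x Z)) (mmap (E' := E') φ x w) = 0 :=
  hM.antiInvariant x Z hZ w

/-- Since `J` is skew with square one, `g(X, Z) = -g(J X, J Z)`, where `J X` is tangent and `J Z` is
normal. -/
theorem metricAt_mmap_orthogonal (hK : IsParaKahler g J) (hM : IsPRSubmanifold g J φ D D') {x : M}
    {X Z : E} (hX : X ∈ distAt D x) (hZ : Z ∈ distAt D' x) :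
    metricAt g (φ x) (mmap (E' := E') φ x X) (mmap (E' := E') φ x Z) = 0 := by
  obtain ⟨Y, -, hY⟩ := exists_endAt_mmap hM hX
  have h := metricAt_endAt_mmap hM hZ Y
  rw [← hY, metricAt_endAt hK, endAt_endAt hK, neg_eq_zero, metricAt_symm] at h
  exact h

theorem exists_add_of_isCompl (hM : IsPRSubmanifold g J φ D D') (x : M) (v : E) :
    ∃ X ∈ distAt D x, ∃ Z ∈ distAt D' x, X + Z = v := by
  have h : (v : E) ∈ distAt D x ⊔ distAt D' x := by
    have h1 : distAt D x ⊔ distAt D' x = ⊤ := (hM.isCompl x).sup_eq_top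
    rw [h1]; trivial
  obtain ⟨X, hX, Z, hZ, h2⟩ := Submodule.mem_sup.1 h
  exact ⟨X, hX, Z, hZ, h2⟩

theorem mmap_injective (hφ : IsPseudoRiemannianSubmanifold (E := E) g φ) {x : M} {u v : E}
    (h : mmap (E' := E') φ x u = mmap (E' := E') φ x v) : u = v :=
  hφ.injective_mfderiv x h

theorem endAt_injective (hK : IsParaKahler g J) {q : N} {u v : E'} (h : endAt J q u = endAt J q v) :
    u = v := by
  rw [← endAt_endAt hK q u, h, endAt_endAt hK]

/-- If `J v` is normal, then so is `J X` for the `D`-component `X` of `v`. But `J X` is also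
tangent, so it vanishes by nondegeneracy. Thus `D'` consists of all tangent vectors that `J` makes
normal, which identifies the fibre slices of a warped product. -/
theorem mem_distAt_antiInvariant (hK : IsParaKahler g J) (hM : IsPRSubmanifold g J φ D D') {x : M}
    {v : E} (h : ∀ w : E, metricAt g (φ x) (endAt J (φ x) (mmap (E' := E') φ x v))
      (mmap (E' := E') φ x w) = 0) : v ∈ distAt D' x := by
  obtain ⟨X, hX, Z, hZ, rfl⟩ := exists_add_of_isCompl hM x v
  obtain ⟨Y, -, hY⟩ := exists_endAt_mmap hM hX
  have hφ := hM.toIsPseudoRiemannianSubmanifold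
  have h1 : Y = 0 := eq_zero_of_metricAt_mmap hφ (x := x) fun w => by
    have := h w
    rwa [map_add, map_add, map_add, add_apply, metricAt_endAt_mmap hM hZ, add_zero, hY] at this
  rw [h1, map_zero] at hY
  have h2 : X = 0 := mmap_injective hφ (x := x) (endAt_injective hK (q := φ x) (by
    rw [hY, map_zero, map_zero]))
  rwa [h2, zero_add]

/-- If `J v` is tangent, then so is `J Z` for the `D'`-component `Z` of `v`. It is also normal,
hence zero. Thus `D` consists of all tangent vectors that `J` keeps tangent, which identifies the
base slices of a warped product. -/
theorem mem_distAt_invariant (hK : IsParaKahler g J) (hM : IsPRSubmanifold g J φ D D') {x : M}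
    {v w : E} (h : endAt J (φ x) (mmap (E' := E') φ x v) = mmap (E' := E') φ x w) :
    v ∈ distAt D x := by
  obtain ⟨X, hX, Z, hZ, rfl⟩ := exists_add_of_isCompl hM x v
  obtain ⟨Y, -, hY⟩ := exists_endAt_mmap hM hX
  have hφ := hM.toIsPseudoRiemannianSubmanifold
  have h1 : endAt J (φ x) (mmap (E' := E') φ x Z) = mmap (E' := E') φ x (w - Y) := by
    rw [map_sub, ← h, ← hY, map_add, map_add]; abel
  have h2 : w - Y = 0 := eq_zero_of_metricAt_mmap hφ (x := x) fun w' => by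
    rw [← h1, metricAt_endAt_mmap hM hZ]
  rw [h2, map_zero] at h1
  have h3 : Z = 0 := mmap_injective hφ (x := x) (endAt_injective hK (q := φ x) (by
    rw [h1, map_zero, map_zero]))
  rwa [h3, add_zero]

theorem normAt_eq (hM : IsPRSubmanifold g J φ D D') {x : M} {Z : E} (hZ : Z ∈ distAt D' x) :
    normAt g J φ x Z = endAt J (φ x) (mmap (E' := E') φ x Z) := by
  have h : normAt g J φ x Z = endAt J (φ x) (mmap (E' := E') φ x Z) - mmap (E' := E') φ x
    (tanAt (E := E) g φ x (endAt J (φ x) (mmap (E' := E') φ x Z))) := rfl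
  rw [h, tanAt_eq_zero hM.toIsPseudoRiemannianSubmanifold (fun w => metricAt_endAt_mmap hM hZ w),
    map_zero, sub_zero]

theorem tangAt_eq (hM : IsPRSubmanifold g J φ D D') {x : M} {X Y : E}
    (h : endAt J (φ x) (mmap (E' := E') φ x X) = mmap (E' := E') φ x Y) :
    tangAt g J φ x X = Y := by
  have h1 : tangAt g J φ x X =
    tanAt (E := E) g φ x (endAt J (φ x) (mmap (E' := E') φ x X)) := rfl
  rw [h1, h, tanAt_mmap hM.toIsPseudoRiemannianSubmanifold]

/-! ### Local parametrizations -/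

variable {W : Type*} [NormedAddCommGroup W] [NormedSpace ℝ W]

/-- A diffeomorphism of an open subset of a vector space onto an open subset of a manifold. -/
structure IsParam (σ : OpenPartialHomeomorph W M) : Prop where
  contMDiffOn : ContMDiffOn 𝓘(ℝ, W) 𝓘(ℝ, E) ∞ σ σ.source
  contMDiffOn_symm : ContMDiffOn 𝓘(ℝ, E) 𝓘(ℝ, W) ∞ σ.symm σ.target

namespace IsParam

variable {σ : OpenPartialHomeomorph W M} {z : W}

theorem contMDiffAt (hσ : IsParam (E := E) σ) (hz : z ∈ σ.source) :
    ContMDiffAt 𝓘(ℝ, W) 𝓘(ℝ, E) ∞ σ z :=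
  hσ.contMDiffOn.contMDiffAt (σ.open_source.mem_nhds hz)

theorem contMDiffAt_symm (hσ : IsParam (E := E) σ) (hz : z ∈ σ.source) :
    ContMDiffAt 𝓘(ℝ, E) 𝓘(ℝ, W) ∞ σ.symm (σ z) :=
  hσ.contMDiffOn_symm.contMDiffAt (σ.open_target.mem_nhds (σ.map_source hz))

theorem mdifferentiableAt (hσ : IsParam (E := E) σ) (hz : z ∈ σ.source) :
    MDifferentiableAt 𝓘(ℝ, W) 𝓘(ℝ, E) σ z := (hσ.contMDiffAt hz).mdifferentiableAt (by simp)

theorem mdifferentiableAt_symm (hσ : IsParam (E := E) σ) (hz : z ∈ σ.source) :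
    MDifferentiableAt 𝓘(ℝ, E) 𝓘(ℝ, W) σ.symm (σ z) :=
  (hσ.contMDiffAt_symm hz).mdifferentiableAt (by simp)

theorem vderiv_symm_dmap (hσ : IsParam (E := E) σ) (hz : z ∈ σ.source) (u : W) :
    vderiv (E' := E) σ.symm (σ z) (dmap (E' := E) σ z u) = u := by
  have h := mfderiv_comp z (hσ.mdifferentiableAt_symm hz) (hσ.mdifferentiableAt hz)
  have h2 : HasMFDerivAt 𝓘(ℝ, W) 𝓘(ℝ, W) (σ.symm ∘ σ) z (ContinuousLinearMap.id ℝ W) := by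
    refine (hasMFDerivAt_id (I := 𝓘(ℝ, W)) z).congr_of_eventuallyEq ?_
    filter_upwards [σ.open_source.mem_nhds hz] with y hy using σ.left_inv hy
  rw [h2.mfderiv] at h
  exact (congrArg (fun L : W →L[ℝ] W => L u) h).symm

theorem dmap_vderiv_symm (hσ : IsParam (E := E) σ) (hz : z ∈ σ.source) (v : E) :
    dmap (E' := E) σ z (vderiv (E' := E) σ.symm (σ z) v) = v := by
  have h3 : MDifferentiableAt 𝓘(ℝ, W) 𝓘(ℝ, E) σ (σ.symm (σ z)) := by
    rw [σ.left_inv hz]; exact hσ.mdifferentiableAt hz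
  have h := mfderiv_comp (σ z) h3 (hσ.mdifferentiableAt_symm hz)
  have h2 : HasMFDerivAt 𝓘(ℝ, E) 𝓘(ℝ, E) (σ ∘ σ.symm) (σ z) (ContinuousLinearMap.id ℝ E) := by
    refine (hasMFDerivAt_id (I := 𝓘(ℝ, E)) (σ z)).congr_of_eventuallyEq ?_
    filter_upwards [σ.open_target.mem_nhds (σ.map_source hz)] with y hy using σ.right_inv hy
  rw [h2.mfderiv] at h
  have h4 : dmap (E' := E) σ (σ.symm (σ z)) (vderiv (E' := E) σ.symm (σ z) v) = v :=
    (congrArg (fun L : E →L[ℝ] E => L v) h).symm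
  rwa [σ.left_inv hz] at h4

theorem contMDiffAt_comp (hσ : IsParam (E := E) σ) (hz : z ∈ σ.source)
    (hφ : ContMDiff 𝓘(ℝ, E) 𝓘(ℝ, E') ∞ φ) :
    ContMDiffAt 𝓘(ℝ, W) 𝓘(ℝ, E') ∞ (fun y => φ (σ y)) z :=
  hφ.contMDiffAt.comp z (hσ.contMDiffAt hz)

theorem dmap_comp (hσ : IsParam (E := E) σ) (hz : z ∈ σ.source)
    (hφ : ContMDiff 𝓘(ℝ, E) 𝓘(ℝ, E') ∞ φ) (u : W) :
    dmap (E' := E') (fun y => φ (σ y)) z u = mmap (E' := E') φ (σ z) (dmap (E' := E) σ z u) :=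
  congrArg (fun L : W →L[ℝ] E' => L u)
    (mfderiv_comp z (hφ.mdifferentiableAt (by simp)) (hσ.mdifferentiableAt hz))

end IsParam

theorem differentiableAt_components_endAt (hK : IsParaKahler g J) {χ : W → N} {z : W}
    (hχ : MDifferentiableAt 𝓘(ℝ, W) 𝓘(ℝ, E') χ z) {ξ : W → E'}
    (hξ : DifferentiableAt ℝ (components (χ z) χ ξ) z) :
    DifferentiableAt ℝ (components (χ z) χ fun y => endAt J (χ y) (ξ y)) z := by
  have h1 : HasFDerivAt (fun y => endComponents J (χ z) (χ y))
      (vderiv (E' := E') (endComponents J (χ z)) (χ z) ∘L dmap (E' := E') χ z) z :=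
    (HasMFDerivAt.comp z ((contMDiffAt_endComponents hK (χ z)).mdifferentiableAt
      (by simp)).hasMFDerivAt hχ.hasMFDerivAt).hasFDerivAt
  refine (h1.differentiableAt.clm_apply hξ).congr_of_eventuallyEq ?_
  filter_upwards [eventually_mem_source (E' := E') hχ.continuousAt] with y hy
  rw [endComponents_components χ ξ hy]

/-- Covariant differentiation along `φ` is local and obeys the chain rule, so it can be computed
along `φ ∘ σ`, where fields are maps between vector spaces. -/
theorem covAlong_param {σ : OpenPartialHomeomorph W M} (hσ : IsParam (E := E) σ) {z : W}
    (hz : z ∈ σ.source) (hφ : ContMDiff 𝓘(ℝ, E) 𝓘(ℝ, E') ∞ φ) {ξ : M → E'} {η : W → E'}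
    (hη : ∀ᶠ y in 𝓝 z, ξ (σ y) = η y)
    (hd : DifferentiableAt ℝ (components (φ (σ z)) (fun y => φ (σ y)) η) z) (u : W) :
    (covAlong (E := E) g φ (fun y => ξ y) (σ z) (dmap (E' := E) σ z u) : E') =
      covCoord g (fun y => φ (σ y)) η z u := by
  have h1 : components (φ (σ z)) φ ξ ∘ σ =ᶠ[𝓝 z]
      components (φ (σ z)) (fun y => φ (σ y)) η := by
    filter_upwards [hη] with y hy
    simp only [components, Function.comp, hy]
    rfl
  have hd' : DifferentiableAt ℝ (components (φ (σ z)) φ ξ ∘ σ) z := hd.congr_of_eventuallyEq h1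
  -- `mfderiv` takes the value `0` where a map is not differentiable, so the chain rule needs
  -- differentiability on `M`. It is recovered by composing with the smooth inverse of `σ`.
  have h2 : MDifferentiableAt 𝓘(ℝ, E) 𝓘(ℝ, E') (components (φ (σ z)) φ ξ) (σ z) := by
    have h3 : MDifferentiableAt 𝓘(ℝ, W) 𝓘(ℝ, E') (components (φ (σ z)) φ ξ ∘ σ) (σ.symm (σ z)) := by
      rw [σ.left_inv hz]; exact hd'.mdifferentiableAt
    refine (h3.comp (σ z) (hσ.mdifferentiableAt_symm hz)).congr_of_eventuallyEq ?_
    filter_upwards [σ.open_target.mem_nhds (σ.map_source hz)] with p hp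
    simp only [Function.comp, σ.right_inv hp]
  have h4 : fderiv ℝ (components (φ (σ z)) (fun y => φ (σ y)) η) z u =
      vderiv (E' := E) (components (φ (σ z)) φ ξ) (σ z) (dmap (E' := E) σ z u) := by
    rw [← h1.fderiv_eq, ← mfderiv_eq_fderiv]
    exact congrArg (fun L : W →L[ℝ] E' => L u) (mfderiv_comp z h2 (hσ.mdifferentiableAt hz))
  rw [covCoord_eq, h4, hσ.dmap_comp hz hφ, ← hη.self_of_nhds]
  rfl

end Submanifold

end PRSub

end

noncomputable section

namespace PRSub

/-! ### The shape operator as intrinsic geometry of `M` -/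

section Bridge

variable {E : Type*} [NormedAddCommGroup E] [NormedSpace ℝ E] [FiniteDimensional ℝ E]
  {M : Type*} [TopologicalSpace M] [ChartedSpace E M] [IsManifold 𝓘(ℝ, E) ∞ M]
  {E' : Type*} [NormedAddCommGroup E'] [NormedSpace ℝ E'] [FiniteDimensional ℝ E']
  {N : Type*} [TopologicalSpace N] [ChartedSpace E' N] [IsManifold 𝓘(ℝ, E') ∞ N]
  {g : PseudoRiemannianMetric E' N}
  {J : ∀ x : N, TangentSpace 𝓘(ℝ, E') x →L[ℝ] TangentSpace 𝓘(ℝ, E') x}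
  {φ : M → N} {D D' : ∀ x : M, Submodule ℝ (TangentSpace 𝓘(ℝ, E) x)}
  {W : Type*} [NormedAddCommGroup W] [NormedSpace ℝ W] [FiniteDimensional ℝ W]
  {σ : OpenPartialHomeomorph W M} {z : W}

theorem covCoord_congr {χ : W → N} {ξ η : W → E'} (h : ξ =ᶠ[𝓝 z] η) (u : W) :
    covCoord g χ ξ z u = covCoord g χ η z u := by
  have h1 : components (χ z) χ ξ =ᶠ[𝓝 z] components (χ z) χ η := by
    filter_upwards [h] with y hy
    simp only [components, hy]
    rfl
  rw [covCoord_eq, covCoord_eq, h1.fderiv_eq, h.self_of_nhds]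

/-- The pullback of a distribution by a parametrization. -/
def pullDist (D : ∀ x : M, Submodule ℝ (TangentSpace 𝓘(ℝ, E) x)) (σ : OpenPartialHomeomorph W M)
    (y : W) : Submodule ℝ W := (distAt D (σ y)).comap (dmap (E' := E) σ y).toLinearMap

theorem mem_pullDist {u : W} : u ∈ pullDist D σ z ↔ dmap (E' := E) σ z u ∈ distAt D (σ z) := Iff.rfl

/-- Since `F Z = J Z`, one has `g(A_{FZ} X, W) = -g(∇_X (J Z), W) = -g(J ∇_X Z, W) = g(∇_X Z, J W)`.
The result is then analysed according to whether `J W` is tangent or normal. -/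
theorem metricAt_shapeAt (hK : IsParaKahler g J) (hM : IsPRSubmanifold g J φ D D')
    (hσ : IsParam (E := E) σ) (hz : z ∈ σ.source) {ζ : W → W} (hζ : DifferentiableAt ℝ ζ z)
    {Z : M → E} (hZ : ∀ᶠ y in 𝓝 z, Z (σ y) = dmap (E' := E) σ y (ζ y))
    (hD' : ∀ᶠ y in 𝓝 z, ζ y ∈ pullDist D' σ y) (u w : W) :
    metricAt g (φ (σ z)) (mmap (E' := E') φ (σ z)
        (shapeAt g J φ Z (σ z) (dmap (E' := E) σ z u)))
      (dmap (E' := E') (fun y => φ (σ y)) z w) =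
    metricAt g (φ (σ z)) (covCoord g (fun y => φ (σ y))
        (fun y => dmap (E' := E') (fun y => φ (σ y)) y (ζ y)) z u)
      (endAt J (φ (σ z)) (dmap (E' := E') (fun y => φ (σ y)) z w)) := by
  have hφ := hM.toIsPseudoRiemannianSubmanifold
  have hχ := hσ.contMDiffAt_comp hz hφ.contMDiff
  have hd := differentiableAt_components_dmap hχ hζ
  have hη : ∀ᶠ y in 𝓝 z, normAt g J φ (σ y) (Z (σ y)) =
      endAt J (φ (σ y)) (dmap (E' := E') (fun y => φ (σ y)) y (ζ y)) := by
    filter_upwards [hZ, hD', σ.open_source.mem_nhds hz] with y h1 h2 h3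
    rw [h1, normAt_eq hM (mem_pullDist.1 h2), hσ.dmap_comp h3 hφ.contMDiff]
  let ξ : M → E' := fun p => normAt g J φ p (Z p)
  have h := covAlong_param (g := g) hσ hz hφ.contMDiff (ξ := ξ) hη
    (differentiableAt_components_endAt hK (hχ.mdifferentiableAt (by simp)) hd) u
  rw [covCoord_endAt hK (hχ.mdifferentiableAt (by simp)) hd] at h
  have h2 : shapeAt g J φ Z (σ z) (dmap (E' := E) σ z u) = -tanAt (E := E) g φ (σ z)
    (covAlong (E := E) g φ (fun p => ξ p) (σ z) (dmap (E' := E) σ z u)) := rfl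
  rw [h2, h, hσ.dmap_comp hz hφ.contMDiff, map_neg, map_neg, neg_apply, inducedMetric_tanAt hφ,
    metricAt_endAt hK, neg_neg]

/-- The case of tangent `J W`: only the tangential part of `∇_X Z` is seen, and the Koszul formula
expresses it by the induced metric. -/
theorem metricAt_covCoord_endAt_of_eq (hM : IsPRSubmanifold g J φ D D')
    (hσ : IsParam (E := E) σ) (hz : z ∈ σ.source) {ζ : W → W} (hζ : DifferentiableAt ℝ ζ z)
    (u : W) {w w' : W}
    (h : endAt J (φ (σ z)) (dmap (E' := E') (fun y => φ (σ y)) z w) =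
      dmap (E' := E') (fun y => φ (σ y)) z w') :
    metricAt g (φ (σ z)) (covCoord g (fun y => φ (σ y))
        (fun y => dmap (E' := E') (fun y => φ (σ y)) y (ζ y)) z u)
      (endAt J (φ (σ z)) (dmap (E' := E') (fun y => φ (σ y)) z w)) =
    coordMetric g (fun y => φ (σ y)) z (fderiv ℝ ζ z u) w' +
      christoffelFirst (coordMetric g (fun y => φ (σ y))) z u (ζ z) w' := by
  rw [h]
  exact metricAt_covCoord_dmap g
    (hσ.contMDiffAt_comp hz hM.toIsPseudoRiemannianSubmanifold.contMDiff) hζ u w'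

/-- The case of normal `J W`: symmetry of the second fundamental form replaces `∇_X Z` by `∇_Z X`,
and `g(∇_Z X, J W) = -g(∇_Z (J X), W)`. As `J X` is tangent, this is again intrinsic to `M`. -/
theorem metricAt_covCoord_endAt_of_mem (hK : IsParaKahler g J) (hM : IsPRSubmanifold g J φ D D')
    (hσ : IsParam (E := E) σ) (hz : z ∈ σ.source) {ζ ξ p : W → W} (hζ : DifferentiableAt ℝ ζ z)
    (hξ : DifferentiableAt ℝ ξ z) (hp : DifferentiableAt ℝ p z) {w : W} (hw : w ∈ pullDist D' σ z)
    (h : ∀ᶠ y in 𝓝 z, endAt J (φ (σ y)) (dmap (E' := E') (fun y => φ (σ y)) y (ξ y)) =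
      dmap (E' := E') (fun y => φ (σ y)) y (p y)) :
    metricAt g (φ (σ z)) (covCoord g (fun y => φ (σ y))
        (fun y => dmap (E' := E') (fun y => φ (σ y)) y (ζ y)) z (ξ z))
      (endAt J (φ (σ z)) (dmap (E' := E') (fun y => φ (σ y)) z w)) =
    -(coordMetric g (fun y => φ (σ y)) z (fderiv ℝ p z (ζ z)) w +
      christoffelFirst (coordMetric g (fun y => φ (σ y))) z (ζ z) (p z) w) := by
  have hφ := hM.toIsPseudoRiemannianSubmanifold
  have hχ := hσ.contMDiffAt_comp hz hφ.contMDiff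
  have h1 := metricAt_covCoord_symm (g := g) hχ hζ hξ
    (ν := endAt J (φ (σ z)) (dmap (E' := E') (fun y => φ (σ y)) z w)) fun v => by
      rw [hσ.dmap_comp hz hφ.contMDiff, hσ.dmap_comp hz hφ.contMDiff, metricAt_symm]
      exact metricAt_endAt_mmap hM hw _
  rw [h1, ← metricAt_covCoord_dmap g hχ hp, ← covCoord_congr (χ := fun y => φ (σ y)) h,
    covCoord_endAt hK (hχ.mdifferentiableAt (by simp)) (differentiableAt_components_dmap hχ hξ),
    metricAt_endAt hK, neg_neg]

/-! ### The operator `P` in a parametrization -/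

/-- The operator `P` (the tangential part of `J`) in a parametrization. -/
def tangCoord (g : PseudoRiemannianMetric E' N)
    (J : ∀ x : N, TangentSpace 𝓘(ℝ, E') x →L[ℝ] TangentSpace 𝓘(ℝ, E') x) (χ : W → N) (y : W) :
    W →L[ℝ] W :=
  ContinuousLinearMap.inverse (coordMetric g χ y) ∘L
    (metricAt g (χ y)).bilinearComp (endAt J (χ y) ∘L dmap (E' := E') χ y) (dmap (E' := E') χ y)

theorem isInvertible_of_nondegenerate (b : W →L[ℝ] W →L[ℝ] ℝ)
    (hb : ∀ v, (∀ w, b v w = 0) → v = 0) : b.IsInvertible := by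
  have hinj : Function.Injective (b : W →ₗ[ℝ] (W →L[ℝ] ℝ)) := by
    rw [← LinearMap.ker_eq_bot, LinearMap.ker_eq_bot']
    exact fun v hv => hb v fun w => congrArg (fun f : W →L[ℝ] ℝ => f w) hv
  have hdim : Module.finrank ℝ W = Module.finrank ℝ (W →L[ℝ] ℝ) := by
    rw [← (LinearMap.toContinuousLinearMap (𝕜 := ℝ) (E := W) (F' := ℝ)).finrank_eq]
    exact (Subspace.dual_finrank_eq (K := ℝ) (V := W)).symm
  exact ⟨(LinearEquiv.ofInjectiveOfFinrankEq
    (b : W →ₗ[ℝ] (W →L[ℝ] ℝ)) hinj hdim).toContinuousLinearEquiv, by ext v w; rfl⟩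

theorem coordMetric_nondegenerate (hφ : IsPseudoRiemannianSubmanifold (E := E) g φ)
    (hσ : IsParam (E := E) σ) (hz : z ∈ σ.source) {v : W}
    (h : ∀ w, coordMetric g (fun y => φ (σ y)) z v w = 0) : v = 0 := by
  have h1 : dmap (E' := E) σ z v = 0 := eq_zero_of_metricAt_mmap hφ (x := σ z) fun w => by
    have := h (vderiv (E' := E) σ.symm (σ z) w)
    rwa [coordMetric_apply, hσ.dmap_comp hz hφ.contMDiff, hσ.dmap_comp hz hφ.contMDiff,
      hσ.dmap_vderiv_symm hz] at this
  rw [← hσ.vderiv_symm_dmap hz v, h1, map_zero]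

/-- Smoothness of `D` and `D'` is not part of their definition. It enters through `P`, obtained from
the smooth form `g(J ·, ·)` by raising an index: `P²` projects onto `D` along `D'`. -/
theorem contDiffAt_tangCoord (hK : IsParaKahler g J)
    (hφ : IsPseudoRiemannianSubmanifold (E := E) g φ)
    (hσ : IsParam (E := E) σ) (hz : z ∈ σ.source) :
    ContDiffAt ℝ ∞ (tangCoord g J (fun y => φ (σ y))) z := by
  have hχ := hσ.contMDiffAt_comp hz hφ.contMDiff
  obtain ⟨e, he⟩ := isInvertible_of_nondegenerate (coordMetric g (fun y => φ (σ y)) z)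
    fun v hv => coordMetric_nondegenerate hφ hσ hz hv
  have h1 : ContDiffAt ℝ ∞ ContinuousLinearMap.inverse (coordMetric g (fun y => φ (σ y)) z) := by
    rw [← he]; exact contDiffAt_map_inverse e
  refine (h1.comp z (contDiffAt_coordMetric g hχ)).clm_comp ?_
  refine contDiffAt_clm_apply_iff.2 fun u => contDiffAt_clm_apply_iff.2 fun v => ?_
  have hJ := ContMDiffAt.clm_bundle_apply (b := fun y => φ (σ y))
    (ϕ := fun y => J (φ (σ y))) (n := ∞) (hK.contMDiff.contMDiffAt.comp z hχ)
    (contMDiffAt_mfderiv_apply hχ (contDiffAt_const (c := u)))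
  exact contDiffAt_metric_apply g hχ hJ (contMDiffAt_mfderiv_apply hχ (contDiffAt_const (c := v)))

theorem tangCoord_eq (hφ : IsPseudoRiemannianSubmanifold (E := E) g φ)
    (hσ : IsParam (E := E) σ) (hz : z ∈ σ.source) {u v : W}
    (h : endAt J (φ (σ z)) (dmap (E' := E') (fun y => φ (σ y)) z u) =
      dmap (E' := E') (fun y => φ (σ y)) z v) : tangCoord g J (fun y => φ (σ y)) z u = v := by
  have hinv := isInvertible_of_nondegenerate (coordMetric g (fun y => φ (σ y)) z)
    fun v hv => coordMetric_nondegenerate hφ hσ hz hv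
  have h1 : (metricAt g (φ (σ z))).bilinearComp
      (endAt J (φ (σ z)) ∘L dmap (E' := E') (fun y => φ (σ y)) z)
      (dmap (E' := E') (fun y => φ (σ y)) z) u = coordMetric g (fun y => φ (σ y)) z v := by
    ext w
    rw [coordMetric_apply, ← h]
    rfl
  rw [tangCoord, ContinuousLinearMap.comp_apply, h1, hinv.inverse_apply_self]

theorem tangCoord_eq_zero (hM : IsPRSubmanifold g J φ D D')
    (hσ : IsParam (E := E) σ) (hz : z ∈ σ.source) {u : W} (hu : u ∈ pullDist D' σ z) :
    tangCoord g J (fun y => φ (σ y)) z u = 0 := by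
  have hφ := hM.toIsPseudoRiemannianSubmanifold
  have h1 : (metricAt g (φ (σ z))).bilinearComp
      (endAt J (φ (σ z)) ∘L dmap (E' := E') (fun y => φ (σ y)) z)
      (dmap (E' := E') (fun y => φ (σ y)) z) u = 0 := by
    ext w
    have := metricAt_endAt_mmap hM (mem_pullDist.1 hu) (dmap (E' := E) σ z w)
    rw [← hσ.dmap_comp hz hφ.contMDiff, ← hσ.dmap_comp hz hφ.contMDiff] at this
    exact this
  rw [tangCoord, ContinuousLinearMap.comp_apply, h1, map_zero]

theorem exists_endAt_dmap (hM : IsPRSubmanifold g J φ D D') (hσ : IsParam (E := E) σ)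
    (hz : z ∈ σ.source) {u : W} (hu : u ∈ pullDist D σ z) :
    ∃ v ∈ pullDist D σ z, endAt J (φ (σ z)) (dmap (E' := E') (fun y => φ (σ y)) z u) =
      dmap (E' := E') (fun y => φ (σ y)) z v := by
  have hφ := hM.toIsPseudoRiemannianSubmanifold
  obtain ⟨Y, hY, h⟩ := exists_endAt_mmap hM (mem_pullDist.1 hu)
  refine ⟨vderiv (E' := E) σ.symm (σ z) Y, ?_, ?_⟩
  · rw [mem_pullDist, hσ.dmap_vderiv_symm hz]; exact hY
  · rw [hσ.dmap_comp hz hφ.contMDiff, hσ.dmap_comp hz hφ.contMDiff, hσ.dmap_vderiv_symm hz, h]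

theorem endAt_dmap_tangCoord (hM : IsPRSubmanifold g J φ D D') (hσ : IsParam (E := E) σ)
    (hz : z ∈ σ.source) {u : W} (hu : u ∈ pullDist D σ z) :
    endAt J (φ (σ z)) (dmap (E' := E') (fun y => φ (σ y)) z u) =
      dmap (E' := E') (fun y => φ (σ y)) z (tangCoord g J (fun y => φ (σ y)) z u) := by
  obtain ⟨v, -, h⟩ := exists_endAt_dmap hM hσ hz hu
  rw [tangCoord_eq hM.toIsPseudoRiemannianSubmanifold hσ hz h, h]

theorem tangCoord_mem (hM : IsPRSubmanifold g J φ D D') (hσ : IsParam (E := E) σ)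
    (hz : z ∈ σ.source) {u : W} (hu : u ∈ pullDist D σ z) :
    tangCoord g J (fun y => φ (σ y)) z u ∈ pullDist D σ z := by
  obtain ⟨v, hv, h⟩ := exists_endAt_dmap hM hσ hz hu
  rwa [tangCoord_eq hM.toIsPseudoRiemannianSubmanifold hσ hz h]

theorem tangCoord_tangCoord (hK : IsParaKahler g J) (hM : IsPRSubmanifold g J φ D D')
    (hσ : IsParam (E := E) σ) (hz : z ∈ σ.source) {u : W} (hu : u ∈ pullDist D σ z) :
    tangCoord g J (fun y => φ (σ y)) z (tangCoord g J (fun y => φ (σ y)) z u) = u := by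
  refine tangCoord_eq hM.toIsPseudoRiemannianSubmanifold hσ hz ?_
  rw [← endAt_dmap_tangCoord hM hσ hz hu, endAt_endAt hK]

theorem tangAt_dmap (hM : IsPRSubmanifold g J φ D D') (hσ : IsParam (E := E) σ)
    (hz : z ∈ σ.source) {u : W} (hu : u ∈ pullDist D σ z) :
    tangAt g J φ (σ z) (dmap (E' := E) σ z u) =
      dmap (E' := E) σ z (tangCoord g J (fun y => φ (σ y)) z u) := by
  have hφ := hM.toIsPseudoRiemannianSubmanifold
  refine tangAt_eq hM ?_
  rw [← hσ.dmap_comp hz hφ.contMDiff, ← hσ.dmap_comp hz hφ.contMDiff,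
    endAt_dmap_tangCoord hM hσ hz hu]

theorem coordMetric_orthogonal (hK : IsParaKahler g J) (hM : IsPRSubmanifold g J φ D D')
    (hσ : IsParam (E := E) σ) (hz : z ∈ σ.source) {u w : W} (hu : u ∈ pullDist D σ z)
    (hw : w ∈ pullDist D' σ z) : coordMetric g (fun y => φ (σ y)) z u w = 0 := by
  have hφ := hM.toIsPseudoRiemannianSubmanifold
  rw [coordMetric_apply, hσ.dmap_comp hz hφ.contMDiff, hσ.dmap_comp hz hφ.contMDiff]
  exact metricAt_mmap_orthogonal hK hM hu hw

theorem exists_add_pullDist (hM : IsPRSubmanifold g J φ D D') (hσ : IsParam (E := E) σ)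
    (hz : z ∈ σ.source) (v : W) : ∃ u ∈ pullDist D σ z, ∃ w ∈ pullDist D' σ z, u + w = v := by
  obtain ⟨X, hX, Z, hZ, h⟩ := exists_add_of_isCompl hM (σ z) (dmap (E' := E) σ z v)
  refine ⟨vderiv (E' := E) σ.symm (σ z) X, ?_, vderiv (E' := E) σ.symm (σ z) Z, ?_, ?_⟩
  · rwa [mem_pullDist, hσ.dmap_vderiv_symm hz]
  · rwa [mem_pullDist, hσ.dmap_vderiv_symm hz]
  · rw [← map_add, h, hσ.vderiv_symm_dmap hz]

/-! ### The shape condition in a parametrization -/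

/-- The local section `ζ` is pushed forward to a field on `M`, whose values outside the image of `σ`
play no role. The shape condition is then paired with an arbitrary tangent vector. -/
theorem ShapeCondition.metricAt_covCoord {μ : M → ℝ} (hS : ShapeCondition g J φ D D' μ)
    (hK : IsParaKahler g J) (hM : IsPRSubmanifold g J φ D D')
    (hσ : IsParam (E := E) σ) (hz : z ∈ σ.source) {ζ : W → W} (hζ : ContDiffAt ℝ ∞ ζ z)
    (hD' : ∀ᶠ y in 𝓝 z, ζ y ∈ pullDist D' σ y) {u : W} (hu : u ∈ pullDist D σ z) (w : W) :
    metricAt g (φ (σ z)) (covCoord g (fun y => φ (σ y))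
        (fun y => dmap (E' := E') (fun y => φ (σ y)) y (ζ y)) z u)
      (endAt J (φ (σ z)) (dmap (E' := E') (fun y => φ (σ y)) z w)) =
    vderiv (E' := E) μ (σ z) (dmap (E' := E) σ z (tangCoord g J (fun y => φ (σ y)) z u)) *
      coordMetric g (fun y => φ (σ y)) z (ζ z) w := by
  have hφ := hM.toIsPseudoRiemannianSubmanifold
  let Z : M → E := fun q => dmap (E' := E) σ (σ.symm q) (ζ (σ.symm q))
  have hZ : ∀ᶠ y in 𝓝 z, Z (σ y) = dmap (E' := E) σ y (ζ y) := by
    filter_upwards [σ.open_source.mem_nhds hz] with y hy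
    simp only [Z, σ.left_inv hy]
  have hZs : ContMDiffAt 𝓘(ℝ, E) 𝓘(ℝ, E).tangent ∞
      (fun y ↦ (⟨y, Z y⟩ : TangentBundle 𝓘(ℝ, E) M)) (σ z) := by
    have h1 := contMDiffAt_mfderiv_apply (hσ.contMDiffAt hz) hζ
    rw [← σ.left_inv hz] at h1
    refine (h1.comp (σ z) (hσ.contMDiffAt_symm hz)).congr_of_eventuallyEq ?_
    filter_upwards [σ.open_target.mem_nhds (σ.map_source hz)] with p hp
    exact totalSpace_mk_eq (σ.right_inv hp) (Z p)
  have hZD : ∀ᶠ q in 𝓝 (σ z), Z q ∈ distAt D' q := by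
    have h2 : Tendsto σ.symm (𝓝 (σ z)) (𝓝 z) := by
      have := (hσ.mdifferentiableAt_symm hz).continuousAt
      rwa [ContinuousAt, σ.left_inv hz] at this
    filter_upwards [h2.eventually hD', σ.open_target.mem_nhds (σ.map_source hz)] with q h3 hq
    rw [mem_pullDist, σ.right_inv hq] at h3
    exact h3
  have h := hS.shape (σ z) (dmap (E' := E) σ z u) hu Z hZs hZD
  have h' : shapeAt g J φ Z (σ z) (dmap (E' := E) σ z u) =
    vderiv (E' := E) μ (σ z) (tangAt g J φ (σ z) (dmap (E' := E) σ z u)) • Z (σ z) := h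
  rw [← metricAt_shapeAt hK hM hσ hz (hζ.differentiableAt (by simp)) hZ hD' u w, h',
    hZ.self_of_nhds, tangAt_dmap hM hσ hz hu, map_smul, map_smul, smul_apply,
    ← hσ.dmap_comp hz hφ.contMDiff, smul_eq_mul, coordMetric_apply]

/-- The distribution `D` is totally geodesic. -/
theorem ShapeCondition.coord_geodesic {μ : M → ℝ} (hS : ShapeCondition g J φ D D' μ)
    (hK : IsParaKahler g J) (hM : IsPRSubmanifold g J φ D D')
    (hσ : IsParam (E := E) σ) (hz : z ∈ σ.source) {ζ : W → W} (hζ : ContDiffAt ℝ ∞ ζ z)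
    (hD' : ∀ᶠ y in 𝓝 z, ζ y ∈ pullDist D' σ y) {u w : W} (hu : u ∈ pullDist D σ z)
    (hw : w ∈ pullDist D σ z) :
    coordMetric g (fun y => φ (σ y)) z (fderiv ℝ ζ z u) w +
      christoffelFirst (coordMetric g (fun y => φ (σ y))) z u (ζ z) w = 0 := by
  -- The test vector is `P w`, for which `J (P w) = w`. The right-hand side of the shape condition
  -- vanishes because `D` and `D'` are orthogonal.
  have hw' := tangCoord_mem hM hσ hz hw
  have h := endAt_dmap_tangCoord hM hσ hz hw'
  rw [tangCoord_tangCoord hK hM hσ hz hw] at h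
  rw [← metricAt_covCoord_endAt_of_eq hM hσ hz (hζ.differentiableAt (by simp)) u h,
    hS.metricAt_covCoord hK hM hσ hz hζ hD' hu, coordMetric_symm,
    coordMetric_orthogonal hK hM hσ hz hw' hD'.self_of_nhds, mul_zero]

/-- The distribution `D'` is totally umbilical. -/
theorem ShapeCondition.coord_umbilical {μ : M → ℝ} (hS : ShapeCondition g J φ D D' μ)
    (hK : IsParaKahler g J) (hM : IsPRSubmanifold g J φ D D')
    (hσ : IsParam (E := E) σ) (hz : z ∈ σ.source) {ζ p : W → W} (hζ : ContDiffAt ℝ ∞ ζ z)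
    (hD' : ∀ᶠ y in 𝓝 z, ζ y ∈ pullDist D' σ y) (hp : DifferentiableAt ℝ p z)
    (hD : ∀ᶠ y in 𝓝 z, p y ∈ pullDist D σ y) {w : W} (hw : w ∈ pullDist D' σ z) :
    coordMetric g (fun y => φ (σ y)) z (fderiv ℝ p z (ζ z)) w +
      christoffelFirst (coordMetric g (fun y => φ (σ y))) z (ζ z) (p z) w =
    -(vderiv (E' := E) μ (σ z) (dmap (E' := E) σ z (p z)) *
      coordMetric g (fun y => φ (σ y)) z (ζ z) w) := by
  have hφ := hM.toIsPseudoRiemannianSubmanifold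
  -- The shape condition is used with `X = P p`: then `J X = p`, and `μ` is differentiated along `P
  -- X = p`.
  have hξ : DifferentiableAt ℝ (fun y => tangCoord g J (fun y => φ (σ y)) y (p y)) z :=
    ((contDiffAt_tangCoord hK hφ hσ hz).differentiableAt (by simp)).clm_apply hp
  have h := metricAt_covCoord_endAt_of_mem hK hM hσ hz (hζ.differentiableAt (by simp)) hξ hp hw
    (by
      filter_upwards [hD, σ.open_source.mem_nhds hz] with y h1 hy
      rw [← endAt_dmap_tangCoord hM hσ hy h1, endAt_endAt hK])
  rw [hS.metricAt_covCoord hK hM hσ hz hζ hD' (tangCoord_mem hM hσ hz hD.self_of_nhds),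
    tangCoord_tangCoord hK hM hσ hz hD.self_of_nhds] at h
  linarith

/-- The shape condition at a point, from its expression in a parametrization. -/
theorem shapeOperator_eq_of_coord {μ : M → ℝ} (hK : IsParaKahler g J)
    (hM : IsPRSubmanifold g J φ D D') (hσ : IsParam (E := E) σ) (hz : z ∈ σ.source)
    (H : ∀ ζ : W → W, DifferentiableAt ℝ ζ z → (∀ᶠ y in 𝓝 z, ζ y ∈ pullDist D' σ y) →
      ∀ u ∈ pullDist D σ z, ∀ w,
      metricAt g (φ (σ z)) (covCoord g (fun y => φ (σ y))
          (fun y => dmap (E' := E') (fun y => φ (σ y)) y (ζ y)) z u)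
        (endAt J (φ (σ z)) (dmap (E' := E') (fun y => φ (σ y)) z w)) =
      vderiv (E' := E) μ (σ z) (dmap (E' := E) σ z (tangCoord g J (fun y => φ (σ y)) z u)) *
        coordMetric g (fun y => φ (σ y)) z (ζ z) w)
    {X : E} (hX : X ∈ distAt D (σ z)) {Z : M → E}
    (hZs : ContMDiffAt 𝓘(ℝ, E) 𝓘(ℝ, E).tangent ∞
      (fun y ↦ (⟨y, Z y⟩ : TangentBundle 𝓘(ℝ, E) M)) (σ z))
    (hZD : ∀ᶠ q in 𝓝 (σ z), Z q ∈ distAt D' q) :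
    shapeAt g J φ Z (σ z) X = vderiv (E' := E) μ (σ z) (tangAt g J φ (σ z) X) • Z (σ z) := by
  have hφ := hM.toIsPseudoRiemannianSubmanifold
  -- The given section of `D'` read in the parametrization; it is an arbitrary section rather than a
  -- coordinate field.
  let ζ : W → W := fun y => vderiv (E' := E) σ.symm (σ y) (Z (σ y))
  have hζ : DifferentiableAt ℝ ζ z := by
    have h1 := ContMDiffAt.mfderiv_const (I := 𝓘(ℝ, E)) (I' := 𝓘(ℝ, W)) (m := ∞)
      (hσ.contMDiffAt_symm hz) (by simp)
    have h2 := (ContMDiffAt.clm_apply_of_inCoordinates h1 hZs (hσ.contMDiffAt_symm hz)).comp z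
      (hσ.contMDiffAt hz)
    have h3 : ContMDiffAt 𝓘(ℝ, W) 𝓘(ℝ, W).tangent ∞
        (fun y => TotalSpace.mk' W (E := (TangentSpace 𝓘(ℝ, W) : W → Type _)) (id y) (ζ y)) z := by
      refine h2.congr_of_eventuallyEq ?_
      filter_upwards [σ.open_source.mem_nhds hz] with y hy
      exact totalSpace_mk_eq (σ.left_inv hy) (ζ y)
    exact ((contMDiffAt_vectorSpace_iff_contDiffAt (V := fun y => ζ y)).1 h3).differentiableAt
      (by simp)
  have hZ : ∀ᶠ y in 𝓝 z, Z (σ y) = dmap (E' := E) σ y (ζ y) := by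
    filter_upwards [σ.open_source.mem_nhds hz] with y hy
    simp only [ζ, hσ.dmap_vderiv_symm hy]
  have hD' : ∀ᶠ y in 𝓝 z, ζ y ∈ pullDist D' σ y := by
    filter_upwards [hZ, (hσ.contMDiffAt hz).continuousAt.eventually hZD] with y h1 h2
    rw [mem_pullDist, ← h1]; exact h2
  obtain ⟨u, rfl⟩ : ∃ u, dmap (E' := E) σ z u = X := ⟨_, hσ.dmap_vderiv_symm hz X⟩
  refine sub_eq_zero.1 (eq_zero_of_metricAt_mmap hφ (x := σ z) fun w => ?_)
  obtain ⟨w, rfl⟩ : ∃ w', dmap (E' := E) σ z w' = w := ⟨_, hσ.dmap_vderiv_symm hz w⟩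
  have h1 := metricAt_shapeAt hK hM hσ hz hζ hZ hD' u w
  rw [H ζ hζ hD' u hX w, hσ.dmap_comp hz hφ.contMDiff] at h1
  rw [map_sub, map_sub, sub_apply, h1, map_smul, map_smul, smul_apply, hZ.self_of_nhds,
    tangAt_dmap hM hσ hz hX, smul_eq_mul, coordMetric_apply, hσ.dmap_comp hz hφ.contMDiff,
    hσ.dmap_comp hz hφ.contMDiff, sub_self]

end Bridge

end PRSub

end

noncomputable section

namespace PRSub

/-! ### Parametrizations adapted to the two distributions -/

section Adapted

variable {E : Type*} [NormedAddCommGroup E] [NormedSpace ℝ E] [FiniteDimensional ℝ E]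
  {M : Type*} [TopologicalSpace M] [ChartedSpace E M] [IsManifold 𝓘(ℝ, E) ∞ M]
  {E' : Type*} [NormedAddCommGroup E'] [NormedSpace ℝ E'] [FiniteDimensional ℝ E']
  {N : Type*} [TopologicalSpace N] [ChartedSpace E' N] [IsManifold 𝓘(ℝ, E') ∞ N]
  {g : PseudoRiemannianMetric E' N}
  {J : ∀ x : N, TangentSpace 𝓘(ℝ, E') x →L[ℝ] TangentSpace 𝓘(ℝ, E') x}
  {φ : M → N} {D D' : ∀ x : M, Submodule ℝ (TangentSpace 𝓘(ℝ, E) x)}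
  {W₁ : Type*} [NormedAddCommGroup W₁] [NormedSpace ℝ W₁] [FiniteDimensional ℝ W₁]
  {W₂ : Type*} [NormedAddCommGroup W₂] [NormedSpace ℝ W₂] [FiniteDimensional ℝ W₂]
  {σ : OpenPartialHomeomorph (W₁ × W₂) M} {z : W₁ × W₂}

theorem hasDerivAt_line {W F : Type*} [NormedAddCommGroup W] [NormedSpace ℝ W]
    [NormedAddCommGroup F] [NormedSpace ℝ F] {f : W → F} {z : W} (hf : DifferentiableAt ℝ f z)
    (v : W) : HasDerivAt (fun t : ℝ => f (z + t • v)) (fderiv ℝ f z v) 0 := by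
  have h1 : HasDerivAt (fun t : ℝ => z + t • v) v 0 := by
    simpa using ((hasDerivAt_id (0 : ℝ)).smul_const v).const_add z
  have h2 : HasFDerivAt f (fderiv ℝ f z) (z + (0 : ℝ) • v) := by simpa using hf.hasFDerivAt
  exact h2.comp_hasDerivAt 0 h1

theorem fderiv_eq_zero_of_line {W F : Type*} [NormedAddCommGroup W] [NormedSpace ℝ W]
    [NormedAddCommGroup F] [NormedSpace ℝ F] {f : W → F} {z v : W} (hf : DifferentiableAt ℝ f z)
    (h : ∀ᶠ t : ℝ in 𝓝 0, f (z + t • v) = f z) : fderiv ℝ f z v = 0 :=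
  (hasDerivAt_line hf v).unique ((hasDerivAt_const (0 : ℝ) (f z)).congr_of_eventuallyEq h)

theorem hasFDerivAt_apply_const {W : Type*} [NormedAddCommGroup W] [NormedSpace ℝ W]
    {γ : W → W →L[ℝ] W →L[ℝ] ℝ} {z : W} (hγ : DifferentiableAt ℝ γ z) (b c : W) :
    HasFDerivAt (fun y => γ y b c) (((fderiv ℝ γ z).flip b).flip c) z := by
  have h := (hγ.hasFDerivAt.clm_apply (hasFDerivAt_const b z)).clm_apply (hasFDerivAt_const c z)
  refine h.congr_fderiv ?_
  ext v
  simp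

theorem eventually_line {W : Type*} [NormedAddCommGroup W] [NormedSpace ℝ W] {z : W} (v : W)
    {p : W → Prop} (h : ∀ᶠ y in 𝓝 z, p y) : ∀ᶠ t : ℝ in 𝓝 0, p (z + t • v) := by
  have : Tendsto (fun t : ℝ => z + t • v) (𝓝 0) (𝓝 z) := by
    have h2 : Continuous fun t : ℝ => z + t • v := by fun_prop
    simpa using h2.tendsto 0
  exact this.eventually h

/-- The parametrization `σ` of an open subset of `M` by a product is adapted to the decomposition
`TM = D ⊕ D'` at `y`. -/
def IsAdapted (D D' : ∀ x : M, Submodule ℝ (TangentSpace 𝓘(ℝ, E) x))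
    (σ : OpenPartialHomeomorph (W₁ × W₂) M) (y : W₁ × W₂) : Prop :=
  (∀ u : W₁, ((u, 0) : W₁ × W₂) ∈ pullDist D σ y) ∧
    ∀ w : W₂, ((0, w) : W₁ × W₂) ∈ pullDist D' σ y

theorem eq_zero_of_mem_distAt (hM : IsPRSubmanifold g J φ D D') {x : M} {v : E}
    (h : v ∈ distAt D x) (h' : v ∈ distAt D' x) : v = 0 :=
  Submodule.disjoint_def.1 (hM.isCompl x).disjoint v h h'

theorem eq_zero_of_mem_pullDist {W : Type*} [NormedAddCommGroup W] [NormedSpace ℝ W]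
    [FiniteDimensional ℝ W] {σ : OpenPartialHomeomorph W M} {z : W} (hM : IsPRSubmanifold g J φ D D')
    (hσ : IsParam (E := E) σ) (hz : z ∈ σ.source)
    {v : W} (h : v ∈ pullDist D σ z) (h' : v ∈ pullDist D' σ z) : v = 0 := by
  have h0 := eq_zero_of_mem_distAt hM (mem_pullDist.1 h) (mem_pullDist.1 h')
  rw [← hσ.vderiv_symm_dmap hz v, h0, map_zero]

theorem IsAdapted.snd_eq_zero (h : IsAdapted D D' σ z) (hM : IsPRSubmanifold g J φ D D')
    (hσ : IsParam (E := E) σ) (hz : z ∈ σ.source) {v : W₁ × W₂} (hv : v ∈ pullDist D σ z) :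
    v.2 = 0 := by
  have h1 := sub_mem hv (h.1 v.1)
  have h2 : v - (v.1, 0) = (0, v.2) := by ext <;> simp
  rw [h2] at h1
  exact congrArg Prod.snd (eq_zero_of_mem_pullDist hM hσ hz h1 (h.2 v.2))

theorem IsAdapted.fst_eq_zero (h : IsAdapted D D' σ z) (hM : IsPRSubmanifold g J φ D D')
    (hσ : IsParam (E := E) σ) (hz : z ∈ σ.source) {v : W₁ × W₂} (hv : v ∈ pullDist D' σ z) :
    v.1 = 0 := by
  have h1 := sub_mem hv (h.2 v.2)
  have h2 : v - (0, v.2) = (v.1, 0) := by ext <;> simp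
  rw [h2] at h1
  exact congrArg Prod.fst (eq_zero_of_mem_pullDist hM hσ hz (h.1 v.1) h1)

theorem IsAdapted.coordMetric_cross (h : IsAdapted D D' σ z) (hK : IsParaKahler g J)
    (hM : IsPRSubmanifold g J φ D D') (hσ : IsParam (E := E) σ) (hz : z ∈ σ.source) (u : W₁)
    (w : W₂) : coordMetric g (fun y => φ (σ y)) z (u, 0) (0, w) = 0 :=
  coordMetric_orthogonal hK hM hσ hz (h.1 u) (h.2 w)

theorem differentiableAt_coordMetric (hφ : IsPseudoRiemannianSubmanifold (E := E) g φ)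
    {W : Type*} [NormedAddCommGroup W] [NormedSpace ℝ W] [FiniteDimensional ℝ W]
    {σ : OpenPartialHomeomorph W M} {z : W} (hσ : IsParam (E := E) σ) (hz : z ∈ σ.source) :
    DifferentiableAt ℝ (coordMetric g (fun y => φ (σ y))) z :=
  (contDiffAt_coordMetric g (hσ.contMDiffAt_comp hz hφ.contMDiff)).differentiableAt (by simp)

/-- The mixed block of the metric vanishes on a neighbourhood, hence so do its derivatives. In an
adapted parametrization only one derivative survives in each Christoffel symbol needed. -/
theorem fderiv_coordMetric_cross (h : ∀ᶠ y in 𝓝 z, IsAdapted D D' σ y) (hK : IsParaKahler g J)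
    (hM : IsPRSubmanifold g J φ D D') (hσ : IsParam (E := E) σ) (hz : z ∈ σ.source) (u : W₁)
    (w : W₂) (v : W₁ × W₂) :
    fderiv ℝ (coordMetric g (fun y => φ (σ y))) z v (u, 0) (0, w) = 0 := by
  have h1 := (hasFDerivAt_apply_const
    (differentiableAt_coordMetric hM.toIsPseudoRiemannianSubmanifold hσ hz) (u, 0) (0, w))
  have h2 : (fun y => coordMetric g (fun y => φ (σ y)) y (u, 0) (0, w)) =ᶠ[𝓝 z] fun _ => 0 := by
    filter_upwards [h, σ.open_source.mem_nhds hz] with y hy hs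
    exact hy.coordMetric_cross hK hM hσ hs u w
  have h3 := h1.unique ((hasFDerivAt_const (0 : ℝ) z).congr_of_eventuallyEq h2)
  exact congrArg (fun L : (W₁ × W₂) →L[ℝ] ℝ => L v) h3

theorem fderiv_coordMetric_cross' (h : ∀ᶠ y in 𝓝 z, IsAdapted D D' σ y) (hK : IsParaKahler g J)
    (hM : IsPRSubmanifold g J φ D D') (hσ : IsParam (E := E) σ) (hz : z ∈ σ.source) (u : W₁)
    (w : W₂) (v : W₁ × W₂) :
    fderiv ℝ (coordMetric g (fun y => φ (σ y))) z v (0, w) (u, 0) = 0 := by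
  rw [fderiv_apply_symm (differentiableAt_coordMetric hM.toIsPseudoRiemannianSubmanifold hσ hz)
    (Eventually.of_forall fun y u v => coordMetric_symm g _ y u v),
    fderiv_coordMetric_cross h hK hM hσ hz]

theorem vderiv_dmap {μ : M → ℝ} (hμ : ContMDiff 𝓘(ℝ, E) 𝓘(ℝ, ℝ) ∞ μ) {W : Type*}
    [NormedAddCommGroup W] [NormedSpace ℝ W] {σ : OpenPartialHomeomorph W M} {z : W}
    (hσ : IsParam (E := E) σ) (hz : z ∈ σ.source) (v : W) :
    vderiv (E' := E) μ (σ z) (dmap (E' := E) σ z v) = fderiv ℝ (fun y => μ (σ y)) z v := by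
  rw [← mfderiv_eq_fderiv]
  exact (congrArg (fun L : W →L[ℝ] ℝ => L v)
    (mfderiv_comp z (hμ.mdifferentiableAt (by simp)) (hσ.mdifferentiableAt hz))).symm

theorem contDiffAt_comp_param {μ : M → ℝ} (hμ : ContMDiff 𝓘(ℝ, E) 𝓘(ℝ, ℝ) ∞ μ) {W : Type*}
    [NormedAddCommGroup W] [NormedSpace ℝ W] {σ : OpenPartialHomeomorph W M} {z : W}
    (hσ : IsParam (E := E) σ) (hz : z ∈ σ.source) : ContDiffAt ℝ ∞ (fun y => μ (σ y)) z :=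
  (hμ.contMDiffAt.comp z (hσ.contMDiffAt hz)).contDiffAt

/-- The shape condition, from the form of the metric in an adapted parametrization. -/
theorem shapeOperator_eq_of_adapted {μ : M → ℝ} (hμ : ContMDiff 𝓘(ℝ, E) 𝓘(ℝ, ℝ) ∞ μ)
    (hK : IsParaKahler g J) (hM : IsPRSubmanifold g J φ D D') (hσ : IsParam (E := E) σ)
    (hz : z ∈ σ.source) (had : ∀ᶠ y in 𝓝 z, IsAdapted D D' σ y)
    (h₁ : ∀ (v : W₂) (b c : W₁), ∀ᶠ t : ℝ in 𝓝 0,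
      coordMetric g (fun y => φ (σ y)) (z + t • (0, v)) (b, 0) (c, 0) =
        coordMetric g (fun y => φ (σ y)) z (b, 0) (c, 0))
    (h₂ : ∀ (v : W₁) (b c : W₂), ∀ᶠ t : ℝ in 𝓝 0,
      coordMetric g (fun y => φ (σ y)) (z + t • (v, 0)) (0, b) (0, c) =
        Real.exp (-2 * (μ (σ (z + t • (v, 0))) - μ (σ z))) *
          coordMetric g (fun y => φ (σ y)) z (0, b) (0, c))
    {X : E} (hX : X ∈ distAt D (σ z)) {Z : M → E}
    (hZs : ContMDiffAt 𝓘(ℝ, E) 𝓘(ℝ, E).tangent ∞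
      (fun y ↦ (⟨y, Z y⟩ : TangentBundle 𝓘(ℝ, E) M)) (σ z))
    (hZD : ∀ᶠ q in 𝓝 (σ z), Z q ∈ distAt D' q) :
    shapeAt g J φ Z (σ z) X = vderiv (E' := E) μ (σ z) (tangAt g J φ (σ z) X) • Z (σ z) := by
  have hφ := hM.toIsPseudoRiemannianSubmanifold
  have hγ := differentiableAt_coordMetric hφ hσ hz
  have had' := had.self_of_nhds
  set γ := coordMetric g (fun y => φ (σ y)) with hγdef
  refine shapeOperator_eq_of_coord hK hM hσ hz (fun ζ hζ hD' u hu w => ?_) hX hZs hZD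
  obtain ⟨ζ₂, hζ₂⟩ : ∃ ζ₂, ζ z = (0, ζ₂) := ⟨(ζ z).2, by
    rw [← had'.fst_eq_zero hM hσ hz hD'.self_of_nhds]⟩
  obtain ⟨u, rfl⟩ : ∃ u₁ : W₁, (u₁, 0) = u := ⟨u.1, by rw [← had'.snd_eq_zero hM hσ hz hu]⟩
  have hdζ : ∀ v, (fderiv ℝ ζ z v).1 = 0 := by
    intro v
    have h1 : HasFDerivAt (fun y => (ζ y).1) ((ContinuousLinearMap.fst ℝ W₁ W₂) ∘L fderiv ℝ ζ z) z :=
      (ContinuousLinearMap.fst ℝ W₁ W₂).hasFDerivAt.comp z hζ.hasFDerivAt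
    have h2 : (fun y => (ζ y).1) =ᶠ[𝓝 z] fun _ => 0 := by
      filter_upwards [had, hD', σ.open_source.mem_nhds hz] with y h3 h4 h5
      exact h3.fst_eq_zero hM hσ h5 h4
    have h3 := h1.unique ((hasFDerivAt_const (0 : W₁) z).congr_of_eventuallyEq h2)
    exact congrArg (fun L : (W₁ × W₂) →L[ℝ] W₁ => L v) h3
  -- Test vectors in `D`: the only derivative left is that of the `D`-block along `D'`, which is
  -- zero by `h₁`.
  have key₁ : ∀ w : W₁, metricAt g (φ (σ z)) (covCoord g (fun y => φ (σ y))
        (fun y => dmap (E' := E') (fun y => φ (σ y)) y (ζ y)) z (u, 0))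
      (endAt J (φ (σ z)) (dmap (E' := E') (fun y => φ (σ y)) z (w, 0))) = 0 := by
    intro w
    obtain ⟨w', hw', h⟩ := exists_endAt_dmap hM hσ hz (had'.1 w)
    obtain ⟨w', rfl⟩ : ∃ u₁ : W₁, (u₁, 0) = w' := ⟨w'.1, by rw [← had'.snd_eq_zero hM hσ hz hw']⟩
    rw [metricAt_covCoord_endAt_of_eq hM hσ hz hζ _ h, hζ₂, ← hγdef, christoffelFirst,
      fderiv_coordMetric_cross had hK hM hσ hz, fderiv_coordMetric_cross' had hK hM hσ hz]
    have h3 : fderiv ℝ ζ z (u, 0) = (0, (fderiv ℝ ζ z (u, 0)).2) := by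
      ext <;> simp [hdζ]
    have h4 : γ z (fderiv ℝ ζ z (u, 0)) (w', 0) = 0 := by
      rw [h3, hγdef, coordMetric_symm, had'.coordMetric_cross hK hM hσ hz]
    have h5 : fderiv ℝ γ z (0, ζ₂) (u, 0) (w', 0) = 0 := by
      have h6 := hasFDerivAt_apply_const hγ (u, 0) (w', 0)
      have h7 := fderiv_eq_zero_of_line h6.differentiableAt (h₁ ζ₂ u w')
      rw [h6.fderiv] at h7
      exact h7
    rw [h4, h5]; ring
  -- Test vectors in `D'`: with `(p, 0) = P (u, 0)` kept constant as a field, the only derivative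
  -- left is that of the `D'`-block along `(p, 0)`. By `h₂` it equals `-2 dμ(p, 0)` times the block.
  have key₂ : ∀ w : W₂, metricAt g (φ (σ z)) (covCoord g (fun y => φ (σ y))
        (fun y => dmap (E' := E') (fun y => φ (σ y)) y (ζ y)) z (u, 0))
      (endAt J (φ (σ z)) (dmap (E' := E') (fun y => φ (σ y)) z (0, w))) =
      vderiv (E' := E) μ (σ z) (dmap (E' := E) σ z (tangCoord g J (fun y => φ (σ y)) z (u, 0))) *
        γ z (0, ζ₂) (0, w) := by
    intro w
    obtain ⟨p, hp⟩ : ∃ p : W₁, tangCoord g J (fun y => φ (σ y)) z (u, 0) = (p, 0) :=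
      ⟨(tangCoord g J (fun y => φ (σ y)) z (u, 0)).1, Prod.ext rfl
        (had'.snd_eq_zero hM hσ hz (tangCoord_mem hM hσ hz hu))⟩
    have hξz : tangCoord g J (fun y => φ (σ y)) z (p, 0) = (u, 0) := by
      rw [← hp, tangCoord_tangCoord hK hM hσ hz hu]
    have h := metricAt_covCoord_endAt_of_mem hK hM hσ hz hζ
      (((contDiffAt_tangCoord hK hφ hσ hz).differentiableAt (by simp)).clm_apply
        (differentiableAt_const (p, 0))) (differentiableAt_const (p, 0)) (had'.2 w) (by
      filter_upwards [had, σ.open_source.mem_nhds hz] with y h1 hy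
      rw [← endAt_dmap_tangCoord hM hσ hy (h1.1 p), endAt_endAt hK])
    rw [hξz] at h
    rw [h, hζ₂, hp, ← hγdef, christoffelFirst, fderiv_coordMetric_cross had hK hM hσ hz,
      fderiv_coordMetric_cross' had hK hM hσ hz, vderiv_dmap hμ hσ hz]
    have h6 := hasFDerivAt_apply_const hγ (0, ζ₂) (0, w)
    have hm := (contDiffAt_comp_param hμ hσ hz).differentiableAt (by simp)
    have h7 := hasDerivAt_line h6.differentiableAt ((p, 0) : W₁ × W₂)
    have h8 := (((hasDerivAt_line hm ((p, 0) : W₁ × W₂)).sub_const (μ (σ z))).const_mul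
      (-2)).exp.mul_const (γ z (0, ζ₂) (0, w))
    have h9 := h7.unique (h8.congr_of_eventuallyEq (h₂ p ζ₂ w))
    rw [h6.fderiv] at h9
    have h10 : fderiv ℝ γ z (p, 0) (0, ζ₂) (0, w) =
        -2 * fderiv ℝ (fun y => μ (σ y)) z (p, 0) * γ z (0, ζ₂) (0, w) := by
      refine Eq.trans h9 ?_
      simp
    rw [h10]
    simp
    ring
  have hw : w = (w.1, 0) + (0, w.2) := by ext <;> simp
  have h3 : γ z (ζ z) w = γ z (0, ζ₂) (0, w.2) := by
    rw [hζ₂, hw, map_add, hγdef, coordMetric_symm, had'.coordMetric_cross hK hM hσ hz]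
    simp
  rw [h3, ← key₂ w.2]
  conv_lhs => rw [hw, map_add, map_add, map_add, key₁, zero_add]

end Adapted

end PRSub

end

/-! ### Product coordinates on a warped product -/

noncomputable section

namespace PRSub

theorem isParam_chartAt_symm {W : Type*} [NormedAddCommGroup W] [NormedSpace ℝ W]
    {B : Type*} [TopologicalSpace B] [ChartedSpace W B] [IsManifold 𝓘(ℝ, W) ∞ B] (b : B) :
    IsParam (E := W) (chartAt W b).symm where
  contMDiffOn := contMDiffOn_chart_symm
  contMDiffOn_symm := contMDiffOn_chart

section Warped

variable {E : Type*} [NormedAddCommGroup E] [NormedSpace ℝ E] [FiniteDimensional ℝ E]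
  {M : Type*} [TopologicalSpace M] [ChartedSpace E M] [IsManifold 𝓘(ℝ, E) ∞ M]
  {E' : Type*} [NormedAddCommGroup E'] [NormedSpace ℝ E'] [FiniteDimensional ℝ E']
  {N : Type*} [TopologicalSpace N] [ChartedSpace E' N] [IsManifold 𝓘(ℝ, E') ∞ N]
  {g : PseudoRiemannianMetric E' N}
  {J : ∀ x : N, TangentSpace 𝓘(ℝ, E') x →L[ℝ] TangentSpace 𝓘(ℝ, E') x}
  {φ : M → N} {D D' : ∀ x : M, Submodule ℝ (TangentSpace 𝓘(ℝ, E) x)}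
  {W₁ : Type*} [NormedAddCommGroup W₁] [NormedSpace ℝ W₁] [FiniteDimensional ℝ W₁]
  {W₂ : Type*} [NormedAddCommGroup W₂] [NormedSpace ℝ W₂] [FiniteDimensional ℝ W₂]
  {B : Type*} [TopologicalSpace B] [ChartedSpace W₁ B] [IsManifold 𝓘(ℝ, W₁) ∞ B]
  {F : Type*} [TopologicalSpace F] [ChartedSpace W₂ F] [IsManifold 𝓘(ℝ, W₂) ∞ F]
  {Ψ : B × F → M} {β : OpenPartialHomeomorph W₁ B} {κ : OpenPartialHomeomorph W₂ F}

/-- The differential of a map from a product manifold, as a map between the model spaces. -/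
def prodmap (Ψ : B × F → M) (q : B × F) : (W₁ × W₂) →L[ℝ] E :=
  mfderiv (𝓘(ℝ, W₁).prod 𝓘(ℝ, W₂)) 𝓘(ℝ, E) Ψ q

/-- `σ` is the expression of `Ψ` in the parametrizations `β` and `κ` of the two factors. -/
structure IsProdParam (Ψ : B × F → M) (β : OpenPartialHomeomorph W₁ B)
    (κ : OpenPartialHomeomorph W₂ F) (σ : OpenPartialHomeomorph (W₁ × W₂) M) : Prop where
  isParam : IsParam (E := E) σ
  fst_mem : ∀ y ∈ σ.source, y.1 ∈ β.source
  snd_mem : ∀ y ∈ σ.source, y.2 ∈ κ.source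
  apply_eq : ∀ y ∈ σ.source, σ y = Ψ (β y.1, κ y.2)

/-- The last clause, smoothness of the projection to the base near `σ z`, is what makes the warping
function smooth on `M`, where no smoothness is assumed of it. -/
theorem exists_isProdParam (hβ : IsParam (E := W₁) β) (hκ : IsParam (E := W₂) κ) {z : W₁ × W₂}
    (h1 : z.1 ∈ β.source) (h2 : z.2 ∈ κ.source)
    (hΨ : IsLocalDiffeomorphAt (𝓘(ℝ, W₁).prod 𝓘(ℝ, W₂)) 𝓘(ℝ, E) ∞ Ψ (β z.1, κ z.2)) :
    ∃ σ : OpenPartialHomeomorph (W₁ × W₂) M, z ∈ σ.source ∧ IsProdParam (E := E) Ψ β κ σ ∧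
      ContMDiffAt 𝓘(ℝ, E) 𝓘(ℝ, W₁) ∞ (fun x => β ((σ.symm x).1)) (σ z) := by
  obtain ⟨Φ, hΦ, hΨΦ⟩ := hΨ
  let τ : OpenPartialHomeomorph (W₁ × W₂) (B × F) := β.prod κ
  have hτ : ∀ y ∈ τ.source, ContMDiffAt 𝓘(ℝ, W₁ × W₂) (𝓘(ℝ, W₁).prod 𝓘(ℝ, W₂)) ∞ τ y := by
    intro y hy
    have h3 : ContMDiffAt 𝓘(ℝ, W₁ × W₂) 𝓘(ℝ, W₁) ∞ (fun y : W₁ × W₂ => β y.1) y :=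
      (hβ.contMDiffAt hy.1).comp y contDiff_fst.contMDiff.contMDiffAt
    have h4 : ContMDiffAt 𝓘(ℝ, W₁ × W₂) 𝓘(ℝ, W₂) ∞ (fun y : W₁ × W₂ => κ y.2) y :=
      (hκ.contMDiffAt hy.2).comp y contDiff_snd.contMDiff.contMDiffAt
    exact h3.prodMk h4
  have hτs : ∀ q ∈ τ.target, ContMDiffAt (𝓘(ℝ, W₁).prod 𝓘(ℝ, W₂)) 𝓘(ℝ, W₁ × W₂) ∞ τ.symm q := by
    intro q hq
    have h3 : ContMDiffAt (𝓘(ℝ, W₁).prod 𝓘(ℝ, W₂)) 𝓘(ℝ, W₁) ∞ (fun q : B × F => β.symm q.1) q :=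
      (hβ.contMDiffOn_symm.contMDiffAt (β.open_target.mem_nhds hq.1)).comp q contMDiffAt_fst
    have h4 : ContMDiffAt (𝓘(ℝ, W₁).prod 𝓘(ℝ, W₂)) 𝓘(ℝ, W₂) ∞ (fun q : B × F => κ.symm q.2) q :=
      (hκ.contMDiffOn_symm.contMDiffAt (κ.open_target.mem_nhds hq.2)).comp q contMDiffAt_snd
    exact h3.prodMk_space h4
  have hΦs : ∀ x ∈ Φ.target,
      ContMDiffAt 𝓘(ℝ, E) (𝓘(ℝ, W₁).prod 𝓘(ℝ, W₂)) ∞ Φ.toOpenPartialHomeomorph.symm x :=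
    fun x hx => Φ.contMDiffOn_invFun.contMDiffAt (Φ.open_target.mem_nhds hx)
  let σ : OpenPartialHomeomorph (W₁ × W₂) M := τ.trans Φ.toOpenPartialHomeomorph
  have hz : z ∈ σ.source := ⟨⟨h1, h2⟩, hΦ⟩
  refine ⟨σ, hz, ⟨⟨?_, ?_⟩, fun y hy => hy.1.1, fun y hy => hy.1.2, ?_⟩, ?_⟩
  · intro y hy
    exact ((Φ.contMDiffOn_toFun.contMDiffAt (Φ.open_source.mem_nhds hy.2)).comp y
      (hτ y hy.1)).contMDiffWithinAt
  · intro x hx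
    exact ((hτs _ hx.2).comp x (hΦs x hx.1)).contMDiffWithinAt
  · intro y hy
    exact (hΨΦ hy.2).symm
  · have h3 := σ.map_source hz
    refine (contMDiffAt_fst.comp (σ z) (hΦs (σ z) h3.1)).congr_of_eventuallyEq ?_
    filter_upwards [σ.open_target.mem_nhds h3] with x hx
    exact β.right_inv hx.2.1

theorem dmap_prodParam {σ : OpenPartialHomeomorph (W₁ × W₂) M}
    (hβ : IsParam (E := W₁) β) (hκ : IsParam (E := W₂) κ)
    (hΨ : ContMDiff (𝓘(ℝ, W₁).prod 𝓘(ℝ, W₂)) 𝓘(ℝ, E) ∞ Ψ) (hσ : IsProdParam (E := E) Ψ β κ σ)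
    {y : W₁ × W₂} (hy : y ∈ σ.source) (u : W₁ × W₂) :
    dmap (E' := E) σ y u =
      prodmap Ψ (β y.1, κ y.2) (dmap (E' := W₁) β y.1 u.1, dmap (E' := W₂) κ y.2 u.2) := by
  have h1 : HasMFDerivAt 𝓘(ℝ, W₁ × W₂) 𝓘(ℝ, W₁) (fun y : W₁ × W₂ => β y.1) y
      (dmap (E' := W₁) β y.1 ∘L ContinuousLinearMap.fst ℝ W₁ W₂) :=
    (hβ.mdifferentiableAt (hσ.fst_mem y hy)).hasMFDerivAt.comp y
      (ContinuousLinearMap.fst ℝ W₁ W₂).hasMFDerivAt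
  have h2 : HasMFDerivAt 𝓘(ℝ, W₁ × W₂) 𝓘(ℝ, W₂) (fun y : W₁ × W₂ => κ y.2) y
      (dmap (E' := W₂) κ y.2 ∘L ContinuousLinearMap.snd ℝ W₁ W₂) :=
    (hκ.mdifferentiableAt (hσ.snd_mem y hy)).hasMFDerivAt.comp y
      (ContinuousLinearMap.snd ℝ W₁ W₂).hasMFDerivAt
  have h3 := (hΨ.mdifferentiableAt (by simp) (x := (β y.1, κ y.2))).hasMFDerivAt.comp y
    (h1.prodMk h2)
  have h4 : σ =ᶠ[𝓝 y] Ψ ∘ fun y : W₁ × W₂ => (β y.1, κ y.2) := by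
    filter_upwards [σ.open_source.mem_nhds hy] with y' hy' using hσ.apply_eq y' hy'
  exact congrArg (fun L : (W₁ × W₂) →L[ℝ] E => L u) (h3.congr_of_eventuallyEq h4).mfderiv

theorem warpedMetric_apply (gB : PseudoRiemannianMetric W₁ B) (gF : PseudoRiemannianMetric W₂ F)
    (f : B → ℝ) (q : B × F) (v w : W₁ × W₂) : warpedMetric gB gF f q v w =
      metricAt gB q.1 v.1 w.1 + f q.1 ^ 2 * metricAt gF q.2 v.2 w.2 := by
  have h1 : (mfderiv (𝓘(ℝ, W₁).prod 𝓘(ℝ, W₂)) 𝓘(ℝ, W₁) (Prod.fst : B × F → B) q :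
    W₁ × W₂ →L[ℝ] W₁) = ContinuousLinearMap.fst ℝ W₁ W₂ := mfderiv_fst
  have h2 : (mfderiv (𝓘(ℝ, W₁).prod 𝓘(ℝ, W₂)) 𝓘(ℝ, W₂) (Prod.snd : B × F → F) q :
    W₁ × W₂ →L[ℝ] W₂) = ContinuousLinearMap.snd ℝ W₁ W₂ := mfderiv_snd
  exact congrArg₂ (fun (L₁ : W₁ × W₂ →L[ℝ] W₁) (L₂ : W₁ × W₂ →L[ℝ] W₂) =>
    metricAt gB q.1 (L₁ v) (L₁ w) + f q.1 ^ 2 * metricAt gF q.2 (L₂ v) (L₂ w)) h1 h2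

theorem coordMetric_prodParam {σ : OpenPartialHomeomorph (W₁ × W₂) M}
    (hφ : IsPseudoRiemannianSubmanifold (E := E) g φ)
    {gB : PseudoRiemannianMetric W₁ B} {gF : PseudoRiemannianMetric W₂ F} {f : B → ℝ}
    (hβ : IsParam (E := W₁) β) (hκ : IsParam (E := W₂) κ)
    (hΨ : ContMDiff (𝓘(ℝ, W₁).prod 𝓘(ℝ, W₂)) 𝓘(ℝ, E) ∞ Ψ) (hσ : IsProdParam (E := E) Ψ β κ σ)
    (hiso : ∀ (q : B × F) (v w : TangentSpace (𝓘(ℝ, W₁).prod 𝓘(ℝ, W₂)) q),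
      inducedMetric (E := E) g φ (Ψ q)
          (mfderiv (𝓘(ℝ, W₁).prod 𝓘(ℝ, W₂)) 𝓘(ℝ, E) Ψ q v)
          (mfderiv (𝓘(ℝ, W₁).prod 𝓘(ℝ, W₂)) 𝓘(ℝ, E) Ψ q w) =
        warpedMetric gB gF f q v w)
    {y : W₁ × W₂} (hy : y ∈ σ.source) (u v : W₁ × W₂) :
    coordMetric g (fun y => φ (σ y)) y u v = coordMetric gB β y.1 u.1 v.1 +
      f (β y.1) ^ 2 * coordMetric gF κ y.2 u.2 v.2 := by
  have h : metricAt g (φ (Ψ (β y.1, κ y.2)))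
      (mmap (E' := E') φ (Ψ (β y.1, κ y.2)) (prodmap Ψ (β y.1, κ y.2)
        (dmap (E' := W₁) β y.1 u.1, dmap (E' := W₂) κ y.2 u.2)))
      (mmap (E' := E') φ (Ψ (β y.1, κ y.2)) (prodmap Ψ (β y.1, κ y.2)
        (dmap (E' := W₁) β y.1 v.1, dmap (E' := W₂) κ y.2 v.2))) = _ :=
    (hiso (β y.1, κ y.2) (dmap (E' := W₁) β y.1 u.1, dmap (E' := W₂) κ y.2 u.2)
      (dmap (E' := W₁) β y.1 v.1, dmap (E' := W₂) κ y.2 v.2)).trans (warpedMetric_apply gB gF f _ _ _)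
  rw [coordMetric_apply, hσ.isParam.dmap_comp hy hφ.contMDiff, hσ.isParam.dmap_comp hy hφ.contMDiff,
    dmap_prodParam hβ hκ hΨ hσ hy, dmap_prodParam hβ hκ hΨ hσ hy, hσ.apply_eq y hy, h]
  rfl

theorem mmap_slice_left (hφ : ContMDiff 𝓘(ℝ, E) 𝓘(ℝ, E') ∞ φ)
    (hΨ : ContMDiff (𝓘(ℝ, W₁).prod 𝓘(ℝ, W₂)) 𝓘(ℝ, E) ∞ Ψ) (b : B) (c : F) (v : W₁) :
    mmap (E := W₁) (E' := E') (fun x : B => φ (Ψ (x, c))) b v =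
      mmap (E' := E') φ (Ψ (b, c)) (prodmap (E := E) (W₁ := W₁) (W₂ := W₂) Ψ (b, c) (v, 0)) := by
  have h1 : HasMFDerivAt 𝓘(ℝ, W₁) (𝓘(ℝ, W₁).prod 𝓘(ℝ, W₂)) (fun x : B => (x, c)) b
      (ContinuousLinearMap.inl ℝ W₁ W₂) :=
    (hasMFDerivAt_id b).prodMk (hasMFDerivAt_const c b)
  have h2 := (hΨ.mdifferentiableAt (by simp) (x := (b, c))).hasMFDerivAt.comp b h1
  have h3 := (hφ.mdifferentiableAt (by simp) (x := Ψ (b, c))).hasMFDerivAt.comp b h2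
  exact congrArg (fun L : W₁ →L[ℝ] E' => L v) h3.mfderiv

theorem mmap_slice_right (hφ : ContMDiff 𝓘(ℝ, E) 𝓘(ℝ, E') ∞ φ)
    (hΨ : ContMDiff (𝓘(ℝ, W₁).prod 𝓘(ℝ, W₂)) 𝓘(ℝ, E) ∞ Ψ) (b : B) (c : F) (v : W₂) :
    mmap (E := W₂) (E' := E') (fun x : F => φ (Ψ (b, x))) c v =
      mmap (E' := E') φ (Ψ (b, c)) (prodmap (E := E) (W₁ := W₁) (W₂ := W₂) Ψ (b, c) (0, v)) := by
  have h1 : HasMFDerivAt 𝓘(ℝ, W₂) (𝓘(ℝ, W₁).prod 𝓘(ℝ, W₂)) (fun x : F => (b, x)) c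
      (ContinuousLinearMap.inr ℝ W₁ W₂) :=
    (hasMFDerivAt_const b c).prodMk (hasMFDerivAt_id c)
  have h2 := (hΨ.mdifferentiableAt (by simp) (x := (b, c))).hasMFDerivAt.comp c h1
  have h3 := (hφ.mdifferentiableAt (by simp) (x := Ψ (b, c))).hasMFDerivAt.comp c h2
  exact congrArg (fun L : W₂ →L[ℝ] E' => L v) h3.mfderiv

/-- Base vectors lie in `D` because `J` keeps them tangent to the slice. For a fibre vector `w`, `J
w` is orthogonal to the fibre by anti-invariance. It is orthogonal to the base because `g(J w, v) =
-g(w, J v)` with `J v` tangent to the base. Hence `J w` is normal and `w ∈ D'`. -/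
theorem isAdapted_prodParam {σ : OpenPartialHomeomorph (W₁ × W₂) M} (hK : IsParaKahler g J)
    (hM : IsPRSubmanifold g J φ D D')
    {gB : PseudoRiemannianMetric W₁ B} {gF : PseudoRiemannianMetric W₂ F} {f : B → ℝ}
    (hβ : IsParam (E := W₁) β) (hκ : IsParam (E := W₂) κ)
    (hΨ : ContMDiff (𝓘(ℝ, W₁).prod 𝓘(ℝ, W₂)) 𝓘(ℝ, E) ∞ Ψ) (hσ : IsProdParam (E := E) Ψ β κ σ)
    (hiso : ∀ (q : B × F) (v w : TangentSpace (𝓘(ℝ, W₁).prod 𝓘(ℝ, W₂)) q),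
      inducedMetric (E := E) g φ (Ψ q)
          (mfderiv (𝓘(ℝ, W₁).prod 𝓘(ℝ, W₂)) 𝓘(ℝ, E) Ψ q v)
          (mfderiv (𝓘(ℝ, W₁).prod 𝓘(ℝ, W₂)) 𝓘(ℝ, E) Ψ q w) =
        warpedMetric gB gF f q v w)
    (hB : ∀ c : F, IsInvariant (E := W₁) J (fun x : B ↦ φ (Ψ (x, c))))
    (hF : ∀ x : B, IsAntiInvariant (E := W₂) g J (fun c : F ↦ φ (Ψ (x, c))))
    {y : W₁ × W₂} (hy : y ∈ σ.source) : IsAdapted D D' σ y := by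
  have hφ := hM.toIsPseudoRiemannianSubmanifold
  have hσ' := hσ.isParam
  have hχ : ∀ u : W₁ × W₂, dmap (E' := E') (fun y => φ (σ y)) y u =
      mmap (E' := E') φ (Ψ (β y.1, κ y.2)) (prodmap Ψ (β y.1, κ y.2)
        (dmap (E' := W₁) β y.1 u.1, dmap (E' := W₂) κ y.2 u.2)) := fun u => by
    rw [hσ'.dmap_comp hy hφ.contMDiff, dmap_prodParam hβ hκ hΨ hσ hy, hσ.apply_eq y hy]
  have hinv : ∀ u : W₁, ∃ u' : W₁,
      endAt J (φ (σ y)) (dmap (E' := E') (fun y => φ (σ y)) y (u, 0)) =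
        dmap (E' := E') (fun y => φ (σ y)) y (u', 0) := by
    intro u
    obtain ⟨w, hw'⟩ : ∃ w : W₁, endAt J (φ (Ψ (β y.1, κ y.2)))
      (mmap (E := W₁) (E' := E') (fun x : B => φ (Ψ (x, κ y.2))) (β y.1)
        (dmap (E' := W₁) β y.1 u)) =
      mmap (E := W₁) (E' := E') (fun x : B => φ (Ψ (x, κ y.2))) (β y.1) w :=
      hB (κ y.2) (β y.1) (dmap (E' := W₁) β y.1 u)
    rw [mmap_slice_left hφ.contMDiff hΨ, mmap_slice_left hφ.contMDiff hΨ] at hw'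
    refine ⟨vderiv (E' := W₁) β.symm (β y.1) w, ?_⟩
    rw [hχ, hχ, hβ.dmap_vderiv_symm (hσ.fst_mem y hy), map_zero, hσ.apply_eq y hy]
    exact hw'
  refine ⟨fun u => ?_, fun w => ?_⟩
  · obtain ⟨u', h⟩ := hinv u
    rw [hσ'.dmap_comp hy hφ.contMDiff, hσ'.dmap_comp hy hφ.contMDiff] at h
    exact mem_distAt_invariant hK hM h
  · refine mem_distAt_antiInvariant hK hM fun v => ?_
    obtain ⟨v, rfl⟩ : ∃ v', dmap (E' := E) σ y v' = v := ⟨_, hσ'.dmap_vderiv_symm hy v⟩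
    change metricAt g (φ (σ y)) (endAt J (φ (σ y)) (mmap (E' := E') φ (σ y)
      (dmap (E' := E) σ y (0, w)))) _ = 0
    rw [← hσ'.dmap_comp hy hφ.contMDiff, ← hσ'.dmap_comp hy hφ.contMDiff]
    have hv : v = (v.1, 0) + (0, v.2) := by ext <;> simp
    have h1 : metricAt g (φ (σ y)) (endAt J (φ (σ y))
        (dmap (E' := E') (fun y => φ (σ y)) y (0, w)))
        (dmap (E' := E') (fun y => φ (σ y)) y (v.1, 0)) = 0 := by
      obtain ⟨u', h⟩ := hinv v.1
      rw [metricAt_endAt hK, h]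
      have := coordMetric_prodParam hφ hβ hκ hΨ hσ hiso hy (0, w) (u', 0)
      rw [coordMetric_apply] at this
      rw [this]
      simp
    have h2 : metricAt g (φ (σ y)) (endAt J (φ (σ y))
        (dmap (E' := E') (fun y => φ (σ y)) y (0, w)))
        (dmap (E' := E') (fun y => φ (σ y)) y (0, v.2)) = 0 := by
      have h3 : metricAt g (φ (Ψ (β y.1, κ y.2))) (endAt J (φ (Ψ (β y.1, κ y.2)))
        (mmap (E := W₂) (E' := E') (fun x : F => φ (Ψ (β y.1, x))) (κ y.2)
          (dmap (E' := W₂) κ y.2 w)))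
        (mmap (E := W₂) (E' := E') (fun x : F => φ (Ψ (β y.1, x))) (κ y.2)
          (dmap (E' := W₂) κ y.2 v.2)) = 0 :=
        hF (β y.1) (κ y.2) (dmap (E' := W₂) κ y.2 w) (dmap (E' := W₂) κ y.2 v.2)
      rw [mmap_slice_right hφ.contMDiff hΨ, mmap_slice_right hφ.contMDiff hΨ] at h3
      rw [hχ, hχ, map_zero, hσ.apply_eq y hy]
      exact h3
    rw [hv, map_add, map_add, h1, h2, add_zero]

end Warped

end PRSub

end

noncomputable section

namespace PRSub

/-! ### Warped products satisfy the shape condition -/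

section Warped

universe uM

variable {E : Type*} [NormedAddCommGroup E] [NormedSpace ℝ E] [FiniteDimensional ℝ E]
  {M : Type uM} [TopologicalSpace M] [ChartedSpace E M] [IsManifold 𝓘(ℝ, E) ∞ M]
  {E' : Type*} [NormedAddCommGroup E'] [NormedSpace ℝ E'] [FiniteDimensional ℝ E']
  {N : Type*} [TopologicalSpace N] [ChartedSpace E' N] [IsManifold 𝓘(ℝ, E') ∞ N]
  {g : PseudoRiemannianMetric E' N}
  {J : ∀ x : N, TangentSpace 𝓘(ℝ, E') x →L[ℝ] TangentSpace 𝓘(ℝ, E') x}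
  {φ : M → N} {D D' : ∀ x : M, Submodule ℝ (TangentSpace 𝓘(ℝ, E) x)}

/-- Near each point, a `PR`-warped product has an adapted parametrization in which its metric is
`γ₁ + f² γ₂`. -/
theorem IsPRWarpedProductOn.exists_adapted (hK : IsParaKahler g J)
    (hM : IsPRSubmanifold g J φ D D') {U : Set M} {lam : M → ℝ}
    (hU : IsPRWarpedProductOn (E := E) g J φ U lam) {x : M} (hx : x ∈ U) :
    0 < lam x ∧ ContMDiffAt 𝓘(ℝ, E) 𝓘(ℝ, ℝ) ∞ lam x ∧
    ∃ (a b : ℕ) (σ : OpenPartialHomeomorph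
        (EuclideanSpace ℝ (Fin a) × EuclideanSpace ℝ (Fin b)) M)
      (z : EuclideanSpace ℝ (Fin a) × EuclideanSpace ℝ (Fin b))
      (γ₁ : EuclideanSpace ℝ (Fin a) → EuclideanSpace ℝ (Fin a) →L[ℝ]
        EuclideanSpace ℝ (Fin a) →L[ℝ] ℝ)
      (γ₂ : EuclideanSpace ℝ (Fin b) → EuclideanSpace ℝ (Fin b) →L[ℝ]
        EuclideanSpace ℝ (Fin b) →L[ℝ] ℝ)
      (f : EuclideanSpace ℝ (Fin a) → ℝ),
      IsParam (E := E) σ ∧ z ∈ σ.source ∧ σ z = x ∧ (∀ s, 0 < f s) ∧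
      ∀ y ∈ σ.source, IsAdapted D D' σ y ∧ lam (σ y) = f y.1 ∧
        ∀ u v, coordMetric g (fun y => φ (σ y)) y u v = γ₁ y.1 u.1 v.1 + f y.1 ^ 2 * γ₂ y.2 u.2 v.2 := by
  obtain ⟨a, b, B, iB₁, iB₂, iB₃, F, iF₁, iF₂, iF₃, gB, gF, f, Ψ, hf, hpos, hΨ, -, hrange, hiso, hB,
    hF, hlam⟩ := hU
  rw [← hrange] at hx
  obtain ⟨⟨b₀, c₀⟩, rfl⟩ := hx
  have hβ := isParam_chartAt_symm (W := EuclideanSpace ℝ (Fin a)) b₀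
  have hκ := isParam_chartAt_symm (W := EuclideanSpace ℝ (Fin b)) c₀
  set β := (chartAt (EuclideanSpace ℝ (Fin a)) b₀).symm with hβdef
  set κ := (chartAt (EuclideanSpace ℝ (Fin b)) c₀).symm with hκdef
  have hb : β (chartAt (EuclideanSpace ℝ (Fin a)) b₀ b₀) = b₀ :=
    (chartAt (EuclideanSpace ℝ (Fin a)) b₀).left_inv (mem_chart_source _ b₀)
  have hc : κ (chartAt (EuclideanSpace ℝ (Fin b)) c₀ c₀) = c₀ :=
    (chartAt (EuclideanSpace ℝ (Fin b)) c₀).left_inv (mem_chart_source _ c₀)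
  obtain ⟨σ, hz, hσ, hsm⟩ := exists_isProdParam (E := E) (Ψ := Ψ) hβ hκ
    (z := (chartAt (EuclideanSpace ℝ (Fin a)) b₀ b₀, chartAt (EuclideanSpace ℝ (Fin b)) c₀ c₀))
    (mem_chart_target _ b₀) (mem_chart_target _ c₀) (by
      simp only [hb, hc]; exact hΨ (b₀, c₀))
  set z := (chartAt (EuclideanSpace ℝ (Fin a)) b₀ b₀, chartAt (EuclideanSpace ℝ (Fin b)) c₀ c₀)
  have hσz : σ z = Ψ (b₀, c₀) := by
    rw [hσ.apply_eq z hz, hb, hc]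
  refine ⟨by rw [hlam]; exact hpos _, ?_, a, b, σ, z, coordMetric gB β, coordMetric gF κ,
    fun s => f (β s), hσ.isParam, hz, hσz, fun s => hpos _, fun y hy => ⟨?_, ?_, fun u v => ?_⟩⟩
  · rw [← hσz]
    have h1 : ContMDiffAt 𝓘(ℝ, E) 𝓘(ℝ, ℝ) ∞ (fun x => f (β ((σ.symm x).1))) (σ z) :=
      hf.contMDiffAt.comp (σ z) hsm
    refine h1.congr_of_eventuallyEq ?_
    filter_upwards [σ.open_target.mem_nhds (σ.map_source hz)] with p hp
    have h2 := hlam (β (σ.symm p).1, κ (σ.symm p).2)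
    rwa [← hσ.apply_eq _ (σ.map_target hp), σ.right_inv hp] at h2
  · exact isAdapted_prodParam hK hM hβ hκ hΨ.contMDiff hσ hiso hB hF hy
  · rw [hσ.apply_eq y hy, hlam]
  · exact coordMetric_prodParam hM.toIsPseudoRiemannianSubmanifold hβ hκ hΨ.contMDiff hσ hiso hy u v

/-- With `μ = -log λ` the ratio of the values of `f²` at two points is the exponential of `-2` times
the difference of `μ`, which is the scaling of the `D'`-block required by
`shapeOperator_eq_of_adapted`. Smoothness and the conditions on `μ` are local, so the pieces of the
covering suffice. -/
theorem IsLocallyPRWarpedProduct.shapeCondition (hK : IsParaKahler g J)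
    (hM : IsPRSubmanifold g J φ D D') {lam : M → ℝ}
    (h : IsLocallyPRWarpedProduct (E := E) g J φ lam) :
    (∀ x, 0 < lam x) ∧ ShapeCondition g J φ D D' (fun x => -Real.log (lam x)) := by
  have hpos : ∀ x, 0 < lam x := fun x => by
    obtain ⟨U, -, hx, hU⟩ := h x
    exact (hU.exists_adapted hK hM hx).1
  have hsm : ContMDiff 𝓘(ℝ, E) 𝓘(ℝ, ℝ) ∞ (fun x => -Real.log (lam x)) := fun x => by
    obtain ⟨U, -, hx, hU⟩ := h x
    have h1 : ContDiffAt ℝ ∞ (fun t => -Real.log t) (lam x) :=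
      (Real.contDiffAt_log.2 (hpos x).ne').neg
    exact h1.contMDiffAt.comp x (hU.exists_adapted hK hM hx).2.1
  refine ⟨hpos, hsm, fun x X hX Z hZ hZD => ?_, fun x w hw => ?_⟩
  · obtain ⟨U, -, hx, hU⟩ := h x
    obtain ⟨-, -, a, b, σ, z, γ₁, γ₂, f, hσ, hz, rfl, hf, H⟩ := hU.exists_adapted hK hM hx
    refine shapeOperator_eq_of_adapted hsm hK hM hσ hz ?_ ?_ ?_ hX hZ hZD
    · filter_upwards [σ.open_source.mem_nhds hz] with y hy using (H y hy).1
    · intro v p c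
      filter_upwards [eventually_line (0, v) (σ.open_source.mem_nhds hz)] with t ht
      rw [(H _ ht).2.2, (H _ hz).2.2]
      simp
    · intro v p c
      filter_upwards [eventually_line (v, 0) (σ.open_source.mem_nhds hz)] with t ht
      rw [(H _ ht).2.2, (H _ hz).2.2, (H _ ht).2.1, (H _ hz).2.1]
      have h1 := hf z.1
      have h2 := hf (z + t • (v, 0)).1
      have h3 : Real.exp (-2 * (-Real.log (f (z + t • (v, 0)).1) - -Real.log (f z.1))) =
          f (z + t • (v, 0)).1 ^ 2 / f z.1 ^ 2 := by
        have : -2 * (-Real.log (f (z + t • (v, 0)).1) - -Real.log (f z.1)) =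
          Real.log (f (z + t • (v, 0)).1 ^ 2) - Real.log (f z.1 ^ 2) := by
          rw [Real.log_pow, Real.log_pow]; push_cast; ring
        rw [this, Real.exp_sub, Real.exp_log (by positivity), Real.exp_log (by positivity)]
      rw [h3]
      simp only [Prod.snd_add, Prod.smul_snd, smul_zero, add_zero, map_zero]
      simp only [zero_add]
      field_simp
  · obtain ⟨U, -, hx, hU⟩ := h x
    obtain ⟨-, -, a, b, σ, z, γ₁, γ₂, f, hσ, hz, rfl, hf, H⟩ := hU.exists_adapted hK hM hx
    obtain ⟨w', rfl⟩ : ∃ w', dmap (E' := E) σ z w' = w := ⟨_, hσ.dmap_vderiv_symm hz w⟩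
    have hw' : w'.1 = 0 := (H z hz).1.fst_eq_zero hM hσ hz hw
    have h1 := vderiv_dmap hsm hσ hz w'
    refine h1.trans (fderiv_eq_zero_of_line
      ((contDiffAt_comp_param hsm hσ hz).differentiableAt (by simp)) ?_)
    filter_upwards [eventually_line w' (σ.open_source.mem_nhds hz)] with t ht
    rw [(H _ ht).2.1, (H _ hz).2.1]
    simp [hw']

end Warped

end PRSub

end

noncomputable section

namespace PRSub

/-! ### Integrability of the two distributions -/

section Straighten

variable {E : Type*} [NormedAddCommGroup E] [NormedSpace ℝ E] [FiniteDimensional ℝ E]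
  {M : Type*} [TopologicalSpace M] [ChartedSpace E M] [IsManifold 𝓘(ℝ, E) ∞ M]
  {E' : Type*} [NormedAddCommGroup E'] [NormedSpace ℝ E'] [FiniteDimensional ℝ E']
  {N : Type*} [TopologicalSpace N] [ChartedSpace E' N] [IsManifold 𝓘(ℝ, E') ∞ N]
  {g : PseudoRiemannianMetric E' N}
  {J : ∀ x : N, TangentSpace 𝓘(ℝ, E') x →L[ℝ] TangentSpace 𝓘(ℝ, E') x}
  {φ : M → N} {D D' : ∀ x : M, Submodule ℝ (TangentSpace 𝓘(ℝ, E) x)}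
  {W : Type*} [NormedAddCommGroup W] [NormedSpace ℝ W] [FiniteDimensional ℝ W]
  {W' : Type*} [NormedAddCommGroup W'] [NormedSpace ℝ W']
  {σ : OpenPartialHomeomorph W M} {z : W}

theorem IsParam.precomp (hσ : IsParam (E := E) σ) {θ : OpenPartialHomeomorph W' W}
    (h : ContDiffOn ℝ ∞ θ θ.source) (h' : ContDiffOn ℝ ∞ θ.symm θ.target) :
    IsParam (E := E) (θ.trans σ) where
  contMDiffOn := hσ.contMDiffOn.comp (h.contMDiffOn.mono fun _ hy => hy.1) fun _ hy => hy.2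
  contMDiffOn_symm := h'.contMDiffOn.comp (hσ.contMDiffOn_symm.mono fun _ hy => hy.1)
    fun _ hy => hy.2

/-- The projection onto `D` along `D'` in a parametrization. -/
def projCoord (g : PseudoRiemannianMetric E' N)
    (J : ∀ x : N, TangentSpace 𝓘(ℝ, E') x →L[ℝ] TangentSpace 𝓘(ℝ, E') x) (χ : W → N) (y : W) :
    W →L[ℝ] W := tangCoord g J χ y ∘L tangCoord g J χ y

theorem contDiffAt_projCoord (hK : IsParaKahler g J)
    (hφ : IsPseudoRiemannianSubmanifold (E := E) g φ)
    (hσ : IsParam (E := E) σ) (hz : z ∈ σ.source) :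
    ContDiffAt ℝ ∞ (projCoord g J (fun y => φ (σ y))) z :=
  (contDiffAt_tangCoord hK hφ hσ hz).clm_comp (contDiffAt_tangCoord hK hφ hσ hz)

theorem projCoord_eq_self (hK : IsParaKahler g J) (hM : IsPRSubmanifold g J φ D D')
    (hσ : IsParam (E := E) σ) (hz : z ∈ σ.source) {u : W} (hu : u ∈ pullDist D σ z) :
    projCoord g J (fun y => φ (σ y)) z u = u :=
  tangCoord_tangCoord hK hM hσ hz hu

theorem projCoord_eq_zero (hM : IsPRSubmanifold g J φ D D')
    (hσ : IsParam (E := E) σ) (hz : z ∈ σ.source) {u : W} (hu : u ∈ pullDist D' σ z) :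
    projCoord g J (fun y => φ (σ y)) z u = 0 := by
  rw [projCoord, ContinuousLinearMap.comp_apply, tangCoord_eq_zero hM hσ hz hu, map_zero]

theorem projCoord_mem (hK : IsParaKahler g J) (hM : IsPRSubmanifold g J φ D D')
    (hσ : IsParam (E := E) σ) (hz : z ∈ σ.source) (v : W) :
    projCoord g J (fun y => φ (σ y)) z v ∈ pullDist D σ z := by
  obtain ⟨u, hu, w, hw, rfl⟩ := exists_add_pullDist hM hσ hz v
  rwa [map_add, projCoord_eq_self hK hM hσ hz hu, projCoord_eq_zero hM hσ hz hw, add_zero]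

theorem sub_projCoord_mem (hK : IsParaKahler g J) (hM : IsPRSubmanifold g J φ D D')
    (hσ : IsParam (E := E) σ) (hz : z ∈ σ.source) (v : W) :
    v - projCoord g J (fun y => φ (σ y)) z v ∈ pullDist D' σ z := by
  obtain ⟨u, hu, w, hw, rfl⟩ := exists_add_pullDist hM hσ hz v
  rwa [map_add, projCoord_eq_self hK hM hσ hz hu, projCoord_eq_zero hM hσ hz hw, add_zero,
    add_sub_cancel_left]

/-- The `D'`-component of `v` is orthogonal to `D'` by hypothesis and to `D` always, so it is zero
by nondegeneracy. Hence membership of a bracket in `D` can be tested by pairing with `D'`. -/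
theorem mem_pullDist_of_orthogonal (hK : IsParaKahler g J) (hM : IsPRSubmanifold g J φ D D')
    (hσ : IsParam (E := E) σ) (hz : z ∈ σ.source) {v : W}
    (h : ∀ w ∈ pullDist D' σ z, coordMetric g (fun y => φ (σ y)) z v w = 0) :
    v ∈ pullDist D σ z := by
  obtain ⟨u, hu, w, hw, rfl⟩ := exists_add_pullDist hM hσ hz v
  have h0 : w = 0 := coordMetric_nondegenerate hM.toIsPseudoRiemannianSubmanifold hσ hz fun v => by
    obtain ⟨u', hu', w', hw', rfl⟩ := exists_add_pullDist hM hσ hz v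
    have h1 := h w' hw'
    rw [map_add, add_apply, coordMetric_orthogonal hK hM hσ hz hu hw', zero_add] at h1
    rw [map_add, h1, coordMetric_symm, coordMetric_orthogonal hK hM hσ hz hu' hw, add_zero]
  rwa [h0, add_zero]

theorem mem_pullDist_of_orthogonal' (hK : IsParaKahler g J) (hM : IsPRSubmanifold g J φ D D')
    (hσ : IsParam (E := E) σ) (hz : z ∈ σ.source) {v : W}
    (h : ∀ u ∈ pullDist D σ z, coordMetric g (fun y => φ (σ y)) z v u = 0) :
    v ∈ pullDist D' σ z := by
  obtain ⟨u, hu, w, hw, rfl⟩ := exists_add_pullDist hM hσ hz v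
  have h0 : u = 0 := coordMetric_nondegenerate hM.toIsPseudoRiemannianSubmanifold hσ hz fun v => by
    obtain ⟨u', hu', w', hw', rfl⟩ := exists_add_pullDist hM hσ hz v
    have h1 := h u' hu'
    rw [map_add, add_apply, coordMetric_symm _ _ _ w,
      coordMetric_orthogonal hK hM hσ hz hu' hw, add_zero] at h1
    rw [map_add, h1, coordMetric_orthogonal hK hM hσ hz hu hw', add_zero]
  rwa [h0, zero_add]

theorem coordMetric_contDiff_symm_near (z : W) : ∀ᶠ y in 𝓝 z, ∀ u v,
    coordMetric g (fun y => φ (σ y)) y u v = coordMetric g (fun y => φ (σ y)) y v u :=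
  Eventually.of_forall fun y u v => coordMetric_symm g _ y u v

/-- The invariant distribution is integrable. -/
theorem ShapeCondition.isInvolutiveNear {μ : M → ℝ} (hS : ShapeCondition g J φ D D' μ)
    (hK : IsParaKahler g J) (hM : IsPRSubmanifold g J φ D D')
    (hσ : IsParam (E := E) σ) (hz : z ∈ σ.source) :
    IsInvolutiveNear (projCoord g J (fun y => φ (σ y))) z := by
  have hφ := hM.toIsPseudoRiemannianSubmanifold
  filter_upwards [σ.open_source.mem_nhds hz] with z hz ζ ζ' hζ hζ' h h'
  refine projCoord_eq_self hK hM hσ hz (mem_pullDist_of_orthogonal hK hM hσ hz fun w hw => ?_)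
  -- The vector `w` of `D'` at `z` is extended to a local section of `D'` by the smooth
  -- complementary projection.
  have hξ : ContDiffAt ℝ ∞ (fun y => w - projCoord g J (fun y => φ (σ y)) y w) z :=
    contDiffAt_const.sub ((contDiffAt_projCoord hK hφ hσ hz).clm_apply contDiffAt_const)
  have hξz : w - projCoord g J (fun y => φ (σ y)) z w = w := by
    rw [projCoord_eq_zero hM hσ hz hw, sub_zero]
  have hξD : ∀ᶠ y in 𝓝 z, w - projCoord g J (fun y => φ (σ y)) y w ∈ pullDist D' σ y := by
    filter_upwards [σ.open_source.mem_nhds hz] with y hy using sub_projCoord_mem hK hM hσ hy w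
  have hD : ∀ {ζ : W → W}, (∀ᶠ y in 𝓝 z, projCoord g J (fun y => φ (σ y)) y (ζ y) = ζ y) →
      ∀ᶠ y in 𝓝 z, ζ y ∈ pullDist D σ y := fun h => by
    filter_upwards [h, σ.open_source.mem_nhds hz] with y h1 hy
    rw [← h1]; exact projCoord_mem hK hM hσ hy _
  have hort : ∀ {ζ : W → W}, (∀ᶠ y in 𝓝 z, projCoord g J (fun y => φ (σ y)) y (ζ y) = ζ y) →
      ∀ᶠ y in 𝓝 z, coordMetric g (fun y => φ (σ y)) y (ζ y)
        (w - projCoord g J (fun y => φ (σ y)) y w) = 0 := fun h => by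
    filter_upwards [hD h, hξD, σ.open_source.mem_nhds hz] with y h1 h2 hy
    exact coordMetric_orthogonal hK hM hσ hy h1 h2
  -- The required symmetry of the second fundamental form of `D` is trivial: both sides vanish, as
  -- `D` is totally geodesic.
  have key := apply_bracket_eq_zero (γ := coordMetric g (fun y => φ (σ y))) (z := z)
    (differentiableAt_coordMetric hφ hσ hz) (coordMetric_contDiff_symm_near z) hζ hζ'
    (hξ.differentiableAt (by simp)) (hort h) (hort h') (by
      rw [hS.coord_geodesic hK hM hσ hz hξ hξD (hD h).self_of_nhds (hD h').self_of_nhds,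
        hS.coord_geodesic hK hM hσ hz hξ hξD (hD h').self_of_nhds (hD h).self_of_nhds])
  rwa [hξz] at key

/-- The anti-invariant distribution is integrable. -/
theorem ShapeCondition.isInvolutiveNear' {μ : M → ℝ} (hS : ShapeCondition g J φ D D' μ)
    (hK : IsParaKahler g J) (hM : IsPRSubmanifold g J φ D D')
    (hσ : IsParam (E := E) σ) (hz : z ∈ σ.source) :
    IsInvolutiveNear (fun y => ContinuousLinearMap.id ℝ W - projCoord g J (fun y => φ (σ y)) y) z := by
  have hφ := hM.toIsPseudoRiemannianSubmanifold
  filter_upwards [σ.open_source.mem_nhds hz] with z hz ζ ζ' hζ hζ' h h'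
  suffices hb : bracket ζ ζ' z ∈ pullDist D' σ z by
    rw [sub_apply, projCoord_eq_zero hM hσ hz hb, sub_zero]; rfl
  refine mem_pullDist_of_orthogonal' hK hM hσ hz fun u hu => ?_
  have hp : DifferentiableAt ℝ (fun y => projCoord g J (fun y => φ (σ y)) y u) z :=
    ((contDiffAt_projCoord hK hφ hσ hz).differentiableAt (by simp)).clm_apply
      (differentiableAt_const u)
  have hpz : projCoord g J (fun y => φ (σ y)) z u = u := projCoord_eq_self hK hM hσ hz hu
  have hpD : ∀ᶠ y in 𝓝 z, projCoord g J (fun y => φ (σ y)) y u ∈ pullDist D σ y := by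
    filter_upwards [σ.open_source.mem_nhds hz] with y hy using projCoord_mem hK hM hσ hy u
  have hD : ∀ {ζ : W → W}, (∀ᶠ y in 𝓝 z,
      (ContinuousLinearMap.id ℝ W - projCoord g J (fun y => φ (σ y)) y) (ζ y) = ζ y) →
      ∀ᶠ y in 𝓝 z, ζ y ∈ pullDist D' σ y := fun h => by
    filter_upwards [h, σ.open_source.mem_nhds hz] with y h1 hy
    rw [← h1]; exact sub_projCoord_mem hK hM hσ hy _
  have hort : ∀ {ζ : W → W}, (∀ᶠ y in 𝓝 z,
      (ContinuousLinearMap.id ℝ W - projCoord g J (fun y => φ (σ y)) y) (ζ y) = ζ y) →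
      ∀ᶠ y in 𝓝 z, coordMetric g (fun y => φ (σ y)) y (ζ y)
        (projCoord g J (fun y => φ (σ y)) y u) = 0 := fun h => by
    filter_upwards [hD h, hpD, σ.open_source.mem_nhds hz] with y h1 h2 hy
    rw [coordMetric_symm]
    exact coordMetric_orthogonal hK hM hσ hy h2 h1
  -- Umbilicity makes the second fundamental form of `D'` in the direction `u` a multiple of the
  -- metric, which is symmetric in `v` and `w`.
  have humb : ∀ {v w : W}, v ∈ pullDist D' σ z → w ∈ pullDist D' σ z →
      coordMetric g (fun y => φ (σ y)) z
        (fderiv ℝ (fun y => projCoord g J (fun y => φ (σ y)) y u) z v) w +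
      christoffelFirst (coordMetric g (fun y => φ (σ y))) z v
        (projCoord g J (fun y => φ (σ y)) z u) w =
      -(vderiv (E' := E) μ (σ z) (dmap (E' := E) σ z (projCoord g J (fun y => φ (σ y)) z u)) *
        coordMetric g (fun y => φ (σ y)) z v w) := by
    intro v w hv hw
    have hvz : v - projCoord g J (fun y => φ (σ y)) z v = v := by
      rw [projCoord_eq_zero hM hσ hz hv, sub_zero]
    have := hS.coord_umbilical hK hM hσ hz
      (ζ := fun y => v - projCoord g J (fun y => φ (σ y)) y v)
      (contDiffAt_const.sub ((contDiffAt_projCoord hK hφ hσ hz).clm_apply contDiffAt_const))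
      (by filter_upwards [σ.open_source.mem_nhds hz] with y hy using sub_projCoord_mem hK hM hσ hy v)
      hp hpD hw
    simpa only [hvz] using this
  have key := apply_bracket_eq_zero (γ := coordMetric g (fun y => φ (σ y))) (z := z)
    (differentiableAt_coordMetric hφ hσ hz) (coordMetric_contDiff_symm_near z) hζ hζ'
    hp (hort h) (hort h') (by
      rw [humb (hD h).self_of_nhds (hD h').self_of_nhds,
        humb (hD h').self_of_nhds (hD h).self_of_nhds, coordMetric_symm _ _ _ (ζ z)])
  rwa [hpz] at key

end Straighten

end PRSub

end

noncomputable section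

namespace PRSub

/-! ### Simultaneous straightening of both distributions -/

section Straighten

variable {E : Type*} [NormedAddCommGroup E] [NormedSpace ℝ E] [FiniteDimensional ℝ E]
  {M : Type*} [TopologicalSpace M] [ChartedSpace E M] [IsManifold 𝓘(ℝ, E) ∞ M]
  {E' : Type*} [NormedAddCommGroup E'] [NormedSpace ℝ E'] [FiniteDimensional ℝ E']
  {N : Type*} [TopologicalSpace N] [ChartedSpace E' N] [IsManifold 𝓘(ℝ, E') ∞ N]
  {g : PseudoRiemannianMetric E' N}
  {J : ∀ x : N, TangentSpace 𝓘(ℝ, E') x →L[ℝ] TangentSpace 𝓘(ℝ, E') x}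
  {φ : M → N} {D D' : ∀ x : M, Submodule ℝ (TangentSpace 𝓘(ℝ, E) x)}

theorem IsParam.dmap_precomp {W W' : Type*} [NormedAddCommGroup W] [NormedSpace ℝ W]
    [NormedAddCommGroup W'] [NormedSpace ℝ W'] {σ : OpenPartialHomeomorph W M}
    (hσ : IsParam (E := E) σ) {θ : OpenPartialHomeomorph W' W} {z : W'}
    (hθ : DifferentiableAt ℝ θ z) (hz : θ z ∈ σ.source) (u : W') :
    dmap (E' := E) (θ.trans σ) z u = dmap (E' := E) σ (θ z) (fderiv ℝ θ z u) :=
  congrArg (fun L : W' →L[ℝ] E => L u)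
    ((hσ.mdifferentiableAt hz).hasMFDerivAt.comp z hθ.hasFDerivAt.hasMFDerivAt).mfderiv


/-- The preferred chart has identity derivative at its centre, so a linear change of coordinates
sending the two factors to `D x` and `D' x` is enough at this one point. -/
theorem exists_param_adapted_at (hM : IsPRSubmanifold g J φ D D') (x : M) :
    ∃ (a b : ℕ) (σ : OpenPartialHomeomorph (EuclideanSpace ℝ (Fin a) × EuclideanSpace ℝ (Fin b)) M)
      (z : EuclideanSpace ℝ (Fin a) × EuclideanSpace ℝ (Fin b)),
      IsParam (E := E) σ ∧ z ∈ σ.source ∧ σ z = x ∧ IsAdapted D D' σ z := by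
  have hc : IsCompl (distAt D x) (distAt D' x) := hM.isCompl x
  let e₁ : EuclideanSpace ℝ (Fin (Module.finrank ℝ (distAt D x))) ≃ₗ[ℝ] distAt D x :=
    LinearEquiv.ofFinrankEq _ _ (by simp)
  let e₂ : EuclideanSpace ℝ (Fin (Module.finrank ℝ (distAt D' x))) ≃ₗ[ℝ] distAt D' x :=
    LinearEquiv.ofFinrankEq _ _ (by simp)
  let e : (EuclideanSpace ℝ (Fin (Module.finrank ℝ (distAt D x))) ×
      EuclideanSpace ℝ (Fin (Module.finrank ℝ (distAt D' x)))) ≃L[ℝ] E :=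
    ((e₁.prodCongr e₂).trans (Submodule.prodEquivOfIsCompl _ _ hc)).toContinuousLinearEquiv
  have he : ∀ u w, e (u, w) = (e₁ u : E) + (e₂ w : E) := fun u w => rfl
  let θ := e.toHomeomorph.toOpenPartialHomeomorph
  have hσ := isParam_chartAt_symm (W := E) x
  have hz : θ (e.symm (chartAt E x x)) = chartAt E x x := e.apply_symm_apply _
  have hxs : θ (e.symm (chartAt E x x)) ∈ (chartAt E x).symm.source := by
    rw [hz]; exact mem_chart_target E x
  have hx : (θ.trans (chartAt E x).symm) (e.symm (chartAt E x x)) = x := by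
    change (chartAt E x).symm (θ (e.symm (chartAt E x x))) = x
    rw [hz]; exact (chartAt E x).left_inv (mem_chart_source E x)
  have hd : ∀ u, dmap (E' := E) (θ.trans (chartAt E x).symm) (e.symm (chartAt E x x)) u = e u := by
    intro u
    rw [hσ.dmap_precomp (θ := θ) (show DifferentiableAt ℝ e _ from e.differentiableAt) hxs, hz]
    have h1 : fderiv ℝ θ (e.symm (chartAt E x x)) = e := e.fderiv
    have h2 : dmap (E' := E) (chartAt E x).symm (chartAt E x x) = ContinuousLinearMap.id ℝ E :=
      dmap_extChartAt_symm_self x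
    rw [h1, h2]
    rfl
  refine ⟨_, _, θ.trans (chartAt E x).symm, e.symm (chartAt E x x),
    hσ.precomp e.contDiff.contDiffOn e.symm.contDiff.contDiffOn, ⟨trivial, hxs⟩, hx,
    fun u => ?_, fun w => ?_⟩
  · rw [mem_pullDist, hd, hx, he, map_zero, Submodule.coe_zero, add_zero]
    exact (e₁ u).2
  · rw [mem_pullDist, hd, hx, he, map_zero, Submodule.coe_zero, zero_add]
    exact (e₂ w).2

/-- Near each point there is a parametrization adapted to the two integrable distributions. -/
theorem ShapeCondition.exists_adapted {μ : M → ℝ} (hS : ShapeCondition g J φ D D' μ)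
    (hK : IsParaKahler g J) (hM : IsPRSubmanifold g J φ D D') (x : M) :
    ∃ (a b : ℕ) (σ : OpenPartialHomeomorph (EuclideanSpace ℝ (Fin a) × EuclideanSpace ℝ (Fin b)) M)
      (z : EuclideanSpace ℝ (Fin a) × EuclideanSpace ℝ (Fin b)),
      IsParam (E := E) σ ∧ z ∈ σ.source ∧ σ z = x ∧ ∀ᶠ y in 𝓝 z, IsAdapted D D' σ y := by
  obtain ⟨a, b, σ, z, hσ, hz, hx, had⟩ := exists_param_adapted_at hM x
  have hφ := hM.toIsPseudoRiemannianSubmanifold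
  have hsrc : ∀ᶠ y in 𝓝 z, y ∈ σ.source := σ.open_source.mem_nhds hz
  have hid : ∀ y ∈ σ.source, ∀ v, projCoord g J (fun y => φ (σ y)) y
      (projCoord g J (fun y => φ (σ y)) y v) = projCoord g J (fun y => φ (σ y)) y v :=
    fun y hy v => projCoord_eq_self hK hM hσ hy (projCoord_mem hK hM hσ hy v)
  have hpz : ∀ u w, projCoord g J (fun y => φ (σ y)) z (u, w) = (u, 0) := by
    intro u w
    have : ((u, w) : EuclideanSpace ℝ (Fin a) × EuclideanSpace ℝ (Fin b)) = (u, 0) + (0, w) := by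
      simp
    rw [this, map_add, projCoord_eq_self hK hM hσ hz (had.1 u),
      projCoord_eq_zero hM hσ hz (had.2 w), add_zero]
  -- The kernel of `dh₁` lies in `D'`, and that of `dh₂` below in `D`. The two maps serve as
  -- coordinates on the first and the second factor.
  obtain ⟨h₁, hsm₁, hker₁, hd₁⟩ := frobenius
    (ContinuousLinearEquiv.refl ℝ (EuclideanSpace ℝ (Fin a) × EuclideanSpace ℝ (Fin b)))
    (Q := fun y => ContinuousLinearMap.id ℝ _ - projCoord g J (fun y => φ (σ y)) y) (p := z)
    (hsrc.mono fun y hy => contDiffAt_const.sub (contDiffAt_projCoord hK hφ hσ hy))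
    (hsrc.mono fun y hy v => by simp [hid y hy])
    (fun u w => by
      change (u, w) - projCoord g J (fun y => φ (σ y)) z (u, w) = (0, w)
      rw [hpz]; simp)
    (hS.isInvolutiveNear' hK hM hσ hz)
  obtain ⟨h₂, hsm₂, hker₂, hd₂⟩ := frobenius
    (ContinuousLinearEquiv.prodComm ℝ (EuclideanSpace ℝ (Fin b)) (EuclideanSpace ℝ (Fin a)))
    (Q := projCoord g J (fun y => φ (σ y))) (p := z)
    (hsrc.mono fun y hy => contDiffAt_projCoord hK hφ hσ hy)
    (hsrc.mono fun y hy v => hid y hy v)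
    (fun w u => hpz u w)
    (hS.isInvolutiveNear hK hM hσ hz)
  have hder : HasFDerivAt (fun y => (h₁ y, h₂ y)) ((ContinuousLinearEquiv.refl ℝ
      (EuclideanSpace ℝ (Fin a) × EuclideanSpace ℝ (Fin b)) :
      _ ≃L[ℝ] EuclideanSpace ℝ (Fin a) × EuclideanSpace ℝ (Fin b)) : _ →L[ℝ] _) z := by
    have h3 := (hsm₁.self_of_nhds.differentiableAt (by simp)).hasFDerivAt.prodMk
      (hsm₂.self_of_nhds.differentiableAt (by simp)).hasFDerivAt
    refine h3.congr_fderiv ?_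
    refine ContinuousLinearMap.ext fun v => ?_
    exact Prod.ext (hd₁ v.1 v.2) (hd₂ v.2 v.1)
  -- The pair `(h₁, h₂)` has the identity as derivative at `z`. Its local inverse, followed by `σ`,
  -- is the adapted parametrization.
  obtain ⟨θ, hθ, hzθ, hθs, hθs'⟩ := exists_openPartialHomeomorph_contDiffOn
    (by filter_upwards [hsm₁, hsm₂] with y h3 h4 using h3.prodMk h4) _ hder
  have hθz : θ.symm (θ z) = z := θ.left_inv hzθ
  have htgt : θ z ∈ θ.target := θ.map_source hzθ
  have hcont : Tendsto θ.symm (𝓝 (θ z)) (𝓝 z) := by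
    have := θ.continuousAt_symm htgt
    rwa [ContinuousAt, hθz] at this
  refine ⟨a, b, θ.symm.trans σ, θ z, hσ.precomp hθs' (by simpa using hθs), ⟨htgt, by
    change θ.symm (θ z) ∈ σ.source
    rwa [hθz]⟩, by
    change σ (θ.symm (θ z)) = x
    rwa [hθz], ?_⟩
  filter_upwards [hcont.eventually hsrc, hcont.eventually hsm₁, hcont.eventually hsm₂,
    hcont.eventually hker₁, hcont.eventually hker₂, θ.open_target.mem_nhds htgt]
    with y hy hy₁ hy₂ hk₁ hk₂ hyt
  have hdθ : DifferentiableAt ℝ θ.symm y :=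
    (hθs'.contDiffAt (θ.open_target.mem_nhds hyt)).differentiableAt (by simp)
  have hinv : (fun p => (h₁ (θ.symm p), h₂ (θ.symm p))) =ᶠ[𝓝 y] id := by
    filter_upwards [θ.open_target.mem_nhds hyt] with p hp
    have := θ.right_inv hp
    rwa [hθ] at this
  -- In the new coordinates `h₁` and `h₂` are the two projections. So `dh₂` kills the image of `(u,
  -- 0)`, which therefore lies in `D`, and `dh₁` kills the image of `(0, w)`.
  have hcomp : ∀ v, (fderiv ℝ h₁ (θ.symm y) (fderiv ℝ θ.symm y v),
      fderiv ℝ h₂ (θ.symm y) (fderiv ℝ θ.symm y v)) = v := by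
    intro v
    have h3 := ((hy₁.differentiableAt (by simp)).hasFDerivAt.comp y hdθ.hasFDerivAt).prodMk
      ((hy₂.differentiableAt (by simp)).hasFDerivAt.comp y hdθ.hasFDerivAt)
    have h4 := h3.unique ((hasFDerivAt_id y).congr_of_eventuallyEq hinv)
    exact congrArg (fun L : (EuclideanSpace ℝ (Fin a) × EuclideanSpace ℝ (Fin b)) →L[ℝ]
      (EuclideanSpace ℝ (Fin a) × EuclideanSpace ℝ (Fin b)) => L v) h4
  refine ⟨fun u => ?_, fun w => ?_⟩
  · have h3 : fderiv ℝ h₂ (θ.symm y) (fderiv ℝ θ.symm y (u, 0)) = 0 :=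
      congrArg Prod.snd (hcomp (u, 0))
    have h4 := hk₂ _ h3
    rw [mem_pullDist, hσ.dmap_precomp hdθ hy]
    have h5 := projCoord_mem hK hM hσ hy (fderiv ℝ θ.symm y (u, 0))
    rw [h4] at h5
    exact mem_pullDist.1 h5
  · have h3 : fderiv ℝ h₁ (θ.symm y) (fderiv ℝ θ.symm y (0, w)) = 0 :=
      congrArg Prod.fst (hcomp (0, w))
    have h4 := hk₁ _ h3
    rw [mem_pullDist, hσ.dmap_precomp hdθ hy]
    have h5 := sub_projCoord_mem hK hM hσ hy (fderiv ℝ θ.symm y (0, w))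
    rw [show fderiv ℝ θ.symm y (0, w) - projCoord g J (fun y => φ (σ y)) (θ.symm y)
      (fderiv ℝ θ.symm y (0, w)) = fderiv ℝ θ.symm y (0, w) from h4] at h5
    exact mem_pullDist.1 h5

end Straighten

end PRSub

end

noncomputable section

namespace PRSub

/-! ### Open subsets of a vector space as manifolds with one chart -/

section SingleChart

variable {W : Type*} [NormedAddCommGroup W] [NormedSpace ℝ W]
  {B : Type*} [TopologicalSpace B] [ChartedSpace W B] [IsManifold 𝓘(ℝ, W) ∞ B]
  {e : OpenPartialHomeomorph B W}

theorem symmL_singleChart (he : ∀ b, chartAt W b = e) (b₀ b : B) :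
    (trivializationAt W (TangentSpace 𝓘(ℝ, W)) b₀).symmL ℝ b = ContinuousLinearMap.id ℝ W := by
  have hb : b ∈ (chartAt W b₀).source := by rw [he b₀, ← he b]; exact mem_chart_source W b
  rw [TangentBundle.symmL_trivializationAt hb]
  have h2 : extChartAt 𝓘(ℝ, W) b₀ = extChartAt 𝓘(ℝ, W) b := by
    simp only [extChartAt, he]
  rw [h2]
  have := mfderivWithin_range_extChartAt_symm (I := 𝓘(ℝ, W)) (x := b)
  exact this

/-- With a single chart the tangent bundle trivializations are the identity on fibres, so the bundle
coordinates of the section are just `γ ∘ e`. -/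
theorem contMDiff_singleChart (he : ∀ b, chartAt W b = e) {γ : W → W →L[ℝ] W →L[ℝ] ℝ}
    (hγ : ContDiffOn ℝ ∞ γ e.target) : ContMDiff 𝓘(ℝ, W) (𝓘(ℝ, W).prod 𝓘(ℝ, W →L[ℝ] W →L[ℝ] ℝ)) ∞
    (fun x : B ↦ TotalSpace.mk' (W →L[ℝ] W →L[ℝ] ℝ)
      (E := fun x : B ↦ TangentSpace 𝓘(ℝ, W) x →L[ℝ] TangentSpace 𝓘(ℝ, W) x →L[ℝ] ℝ) x (γ (e x))) := by
  intro b
  have hb : ∀ b, b ∈ e.source := fun b => by rw [← he b]; exact mem_chart_source W b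
  have h1 : ContMDiffAt 𝓘(ℝ, W) 𝓘(ℝ, W →L[ℝ] W →L[ℝ] ℝ) ∞ (fun x => γ (e x)) b := by
    have h2 : ContMDiffAt 𝓘(ℝ, W) 𝓘(ℝ, W) ∞ e b := by
      have := contMDiffAt_extChartAt (I := 𝓘(ℝ, W)) (n := ∞) (x := b)
      have h2 : ⇑(extChartAt 𝓘(ℝ, W) b) = e := by rw [← he b]; rfl
      rwa [h2] at this
    exact (hγ.contDiffAt (e.open_target.mem_nhds (e.map_source (hb b)))).contMDiffAt.comp b h2
  let s : ∀ x : B, TangentSpace 𝓘(ℝ, W) x →L[ℝ] TangentSpace 𝓘(ℝ, W) x →L[ℝ] ℝ := fun x => γ (e x)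
  refine (contMDiffAt_hom_bundle (fun x : B ↦ TotalSpace.mk' (W →L[ℝ] W →L[ℝ] ℝ)
      (E := fun x : B ↦ TangentSpace 𝓘(ℝ, W) x →L[ℝ] TangentSpace 𝓘(ℝ, W) x →L[ℝ] ℝ) x (s x))).2
      ⟨contMDiffAt_id, ?_⟩
  refine h1.congr_of_eventuallyEq (Eventually.of_forall fun x => ?_)
  ext v w
  simp [ContinuousLinearMap.inCoordinates, Trivialization.continuousLinearMapAt_apply, Trivialization.linearMapAt_apply, hom_trivializationAt_apply, hb, he, s]
  have h3 : (trivializationAt W (TangentSpace 𝓘(ℝ, W)) b).symm x w = w := by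
    refine ((trivializationAt W (TangentSpace 𝓘(ℝ, W)) b).symmL_apply (R := ℝ) ?_ w).symm.trans
      (congrArg (fun L : W →L[ℝ] W => L w) (symmL_singleChart he b x))
    rw [TangentBundle.trivializationAt_baseSet, he]
    exact hb x
  rw [h3]
  exact congrArg (fun L : W →L[ℝ] W => γ (e x) (L v) w) (symmL_singleChart he b x)

theorem isParam_singleChart (he : ∀ b, chartAt W b = e) (b : B) : IsParam (E := W) e.symm := by
  rw [← he b]; exact isParam_chartAt_symm b

theorem dmap_singleChart_symm (he : ∀ b, chartAt W b = e) (b : B) :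
    dmap (E' := W) e.symm (e b) = ContinuousLinearMap.id ℝ W := by
  have h : dmap (E' := W) (chartAt W b).symm (chartAt W b b) = ContinuousLinearMap.id ℝ W :=
    dmap_extChartAt_symm_self b
  rwa [he] at h

/-- A metric on a manifold with a single chart, from its expression in this chart. -/
def singleChartMetric (he : ∀ b, chartAt W b = e) (γ : W → W →L[ℝ] W →L[ℝ] ℝ)
    (hγ : ContDiffOn ℝ ∞ γ e.target) (hsymm : ∀ z ∈ e.target, ∀ u v, γ z u v = γ z v u)
    (hnd : ∀ z ∈ e.target, ∀ v, (∀ w, γ z v w = 0) → v = 0) : PseudoRiemannianMetric W B where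
  val b := γ (e b)
  symm b := hsymm (e b) (e.map_source (by rw [← he b]; exact mem_chart_source W b))
  nondegenerate b := hnd (e b) (e.map_source (by rw [← he b]; exact mem_chart_source W b))
  contMDiff := contMDiff_singleChart he hγ

end SingleChart

universe u v in
/-- An open subset of a vector space is a manifold with a single chart, in any universe. -/
theorem exists_singleChart {W : Type u} [NormedAddCommGroup W] [NormedSpace ℝ W] {S : Set W}
    (hS : IsOpen S) (hne : S.Nonempty) : ∃ (B : Type (max u v)) (_ : TopologicalSpace B)
      (_ : ChartedSpace W B) (_ : IsManifold 𝓘(ℝ, W) ∞ B) (e : OpenPartialHomeomorph B W),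
      Nonempty B ∧ (∀ b, chartAt W b = e) ∧ e.target = S := by
  have hne' : Nonempty (ULift.{v} S) := ⟨⟨⟨hne.some, hne.some_mem⟩⟩⟩
  let ι : ULift.{v} S → W := fun s => s.down
  have hι : IsOpenEmbedding ι :=
    hS.isOpenEmbedding_subtypeVal.comp Homeomorph.ulift.isOpenEmbedding
  refine ⟨ULift.{v} S, inferInstance, hι.singletonChartedSpace, hι.isManifold_singleton,
    hι.toOpenPartialHomeomorph ι, hne', fun b => rfl, ?_⟩
  rw [IsOpenEmbedding.toOpenPartialHomeomorph_target]
  ext w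
  exact ⟨by rintro ⟨s, rfl⟩; exact s.down.2, fun hw => ⟨⟨⟨w, hw⟩⟩, rfl⟩⟩

end PRSub

end

noncomputable section

namespace PRSub

/-! ### A split metric yields a warped product -/

section Construct

universe uM

variable {E : Type*} [NormedAddCommGroup E] [NormedSpace ℝ E] [FiniteDimensional ℝ E]
  {M : Type uM} [TopologicalSpace M] [ChartedSpace E M] [IsManifold 𝓘(ℝ, E) ∞ M]
  {E' : Type*} [NormedAddCommGroup E'] [NormedSpace ℝ E'] [FiniteDimensional ℝ E']
  {N : Type*} [TopologicalSpace N] [ChartedSpace E' N] [IsManifold 𝓘(ℝ, E') ∞ N]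
  {g : PseudoRiemannianMetric E' N}
  {J : ∀ x : N, TangentSpace 𝓘(ℝ, E') x →L[ℝ] TangentSpace 𝓘(ℝ, E') x}
  {φ : M → N} {D D' : ∀ x : M, Submodule ℝ (TangentSpace 𝓘(ℝ, E) x)}

/-- Both inverse charts are defined everywhere, so one partial homeomorphism whose source is the
whole product witnesses the property at every point. -/
theorem isLocalDiffeomorph_prodChart {W₁ W₂ B F : Type*} [NormedAddCommGroup W₁]
    [NormedSpace ℝ W₁] [FiniteDimensional ℝ W₁] [NormedAddCommGroup W₂] [NormedSpace ℝ W₂]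
    [FiniteDimensional ℝ W₂]
    [TopologicalSpace B] [ChartedSpace W₁ B] [IsManifold 𝓘(ℝ, W₁) ∞ B]
    [TopologicalSpace F] [ChartedSpace W₂ F] [IsManifold 𝓘(ℝ, W₂) ∞ F]
    {β : OpenPartialHomeomorph W₁ B} {κ : OpenPartialHomeomorph W₂ F}
    {σ : OpenPartialHomeomorph (W₁ × W₂) M}
    (hβ : IsParam (E := W₁) β) (hκ : IsParam (E := W₂) κ) (hσ : IsParam (E := E) σ)
    (hsrc : σ.source = β.source ×ˢ κ.source) (hβt : β.target = univ) (hκt : κ.target = univ) :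
    IsLocalDiffeomorph (𝓘(ℝ, W₁).prod 𝓘(ℝ, W₂)) 𝓘(ℝ, E) ∞
      (fun q : B × F => σ (β.symm q.1, κ.symm q.2)) := by
  let τ : OpenPartialHomeomorph (B × F) M := (β.symm.prod κ.symm).trans σ
  have hβs : ∀ b, b ∈ β.target := fun b => hβt ▸ mem_univ b
  have hκs : ∀ c, c ∈ κ.target := fun c => hκt ▸ mem_univ c
  have hmem : ∀ q : B × F, (β.symm q.1, κ.symm q.2) ∈ σ.source := fun q => by
    rw [hsrc]; exact ⟨β.map_target (hβs q.1), κ.map_target (hκs q.2)⟩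
  have hτ : ∀ q, q ∈ τ.source := fun q => ⟨⟨hβs q.1, hκs q.2⟩, hmem q⟩
  refine fun q => ⟨⟨τ.toPartialEquiv, τ.open_source, τ.open_target, fun q _ => ?_, fun x hx => ?_⟩,
    hτ q, fun _ _ => rfl⟩
  · have h3 : ContMDiffAt (𝓘(ℝ, W₁).prod 𝓘(ℝ, W₂)) 𝓘(ℝ, W₁) ∞ (fun q : B × F => β.symm q.1) q :=
      (hβ.contMDiffOn_symm.contMDiffAt (β.open_target.mem_nhds (hβs q.1))).comp q contMDiffAt_fst
    have h4 : ContMDiffAt (𝓘(ℝ, W₁).prod 𝓘(ℝ, W₂)) 𝓘(ℝ, W₂) ∞ (fun q : B × F => κ.symm q.2) q :=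
      (hκ.contMDiffOn_symm.contMDiffAt (κ.open_target.mem_nhds (hκs q.2))).comp q contMDiffAt_snd
    exact ((hσ.contMDiffAt (hmem q)).comp q (h3.prodMk_space h4)).contMDiffWithinAt
  · have hx' : x ∈ σ.target := hx.1
    have hy : σ.symm x ∈ β.source ×ˢ κ.source := hsrc ▸ σ.map_target hx'
    have h5 : ContMDiffAt 𝓘(ℝ, E) 𝓘(ℝ, W₁ × W₂) ∞ σ.symm x :=
      hσ.contMDiffOn_symm.contMDiffAt (σ.open_target.mem_nhds hx')
    have h3 : ContMDiffAt 𝓘(ℝ, E) 𝓘(ℝ, W₁) ∞ (fun x => β (σ.symm x).1) x :=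
      (hβ.contMDiffAt hy.1).comp x (contDiff_fst.contMDiff.contMDiffAt.comp x h5)
    have h4 : ContMDiffAt 𝓘(ℝ, E) 𝓘(ℝ, W₂) ∞ (fun x => κ (σ.symm x).2) x :=
      (hκ.contMDiffAt hy.2).comp x (contDiff_snd.contMDiff.contMDiffAt.comp x h5)
    exact (h3.prodMk h4).contMDiffWithinAt

/-- An adapted parametrization by a product of open sets in which the metric is `γ₁ + f² γ₂` makes its
image a `PR`-warped product. -/
theorem isPRWarpedProductOn_of_split (hM : IsPRSubmanifold g J φ D D') {a b : ℕ}
    {σ : OpenPartialHomeomorph (EuclideanSpace ℝ (Fin a) × EuclideanSpace ℝ (Fin b)) M}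
    (hσ : IsParam (E := E) σ) {S₁ : Set (EuclideanSpace ℝ (Fin a))}
    {S₂ : Set (EuclideanSpace ℝ (Fin b))} (hS₁ : IsOpen S₁) (hS₂ : IsOpen S₂) (hne₁ : S₁.Nonempty)
    (hne₂ : S₂.Nonempty) (hsrc : σ.source = S₁ ×ˢ S₂) (had : ∀ y ∈ σ.source, IsAdapted D D' σ y)
    {γ₁ : EuclideanSpace ℝ (Fin a) → EuclideanSpace ℝ (Fin a) →L[ℝ] EuclideanSpace ℝ (Fin a) →L[ℝ] ℝ}
    {γ₂ : EuclideanSpace ℝ (Fin b) → EuclideanSpace ℝ (Fin b) →L[ℝ] EuclideanSpace ℝ (Fin b) →L[ℝ] ℝ}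
    {f : EuclideanSpace ℝ (Fin a) → ℝ} (hγ₁ : ContDiffOn ℝ ∞ γ₁ S₁) (hγ₂ : ContDiffOn ℝ ∞ γ₂ S₂)
    (hf : ContDiffOn ℝ ∞ f S₁) (hpos : ∀ s, 0 < f s)
    (hsymm₁ : ∀ s ∈ S₁, ∀ u v, γ₁ s u v = γ₁ s v u) (hsymm₂ : ∀ s ∈ S₂, ∀ u v, γ₂ s u v = γ₂ s v u)
    (hnd₁ : ∀ s ∈ S₁, ∀ u, (∀ v, γ₁ s u v = 0) → u = 0)
    (hnd₂ : ∀ s ∈ S₂, ∀ u, (∀ v, γ₂ s u v = 0) → u = 0)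
    (hsplit : ∀ y ∈ σ.source, ∀ u v, coordMetric g (fun y => φ (σ y)) y u v =
      γ₁ y.1 u.1 v.1 + f y.1 ^ 2 * γ₂ y.2 u.2 v.2)
    {lam : M → ℝ} (hlam : ∀ y ∈ σ.source, lam (σ y) = f y.1) :
    IsPRWarpedProductOn (E := E) g J φ σ.target lam := by
  have hφ := hM.toIsPseudoRiemannianSubmanifold
  -- The factors of a warped product must live in the universe of `M`, whereas Euclidean spaces live
  -- in universe `0`; the open sets are lifted accordingly.
  obtain ⟨B, iB₁, iB₂, iB₃, e₁, ⟨b₀⟩, he₁, ht₁⟩ := exists_singleChart.{0, uM} hS₁ hne₁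
  obtain ⟨F, iF₁, iF₂, iF₃, e₂, ⟨c₀⟩, he₂, ht₂⟩ := exists_singleChart.{0, uM} hS₂ hne₂
  subst ht₁ ht₂
  have hs₁ : ∀ b, b ∈ e₁.source := fun b => by rw [← he₁ b]; exact mem_chart_source _ b
  have hs₂ : ∀ c, c ∈ e₂.source := fun c => by rw [← he₂ c]; exact mem_chart_source _ c
  have hβ := isParam_singleChart he₁ b₀
  have hκ := isParam_singleChart he₂ c₀
  have hmem : ∀ q : B × F, (e₁ q.1, e₂ q.2) ∈ σ.source := fun q => by
    rw [hsrc]; exact ⟨e₁.map_source (hs₁ q.1), e₂.map_source (hs₂ q.2)⟩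
  let Ψ : B × F → M := fun q => σ (e₁ q.1, e₂ q.2)
  have hΨ : IsLocalDiffeomorph
      (𝓘(ℝ, EuclideanSpace ℝ (Fin a)).prod 𝓘(ℝ, EuclideanSpace ℝ (Fin b))) 𝓘(ℝ, E) ∞ Ψ :=
    isLocalDiffeomorph_prodChart hβ hκ hσ hsrc (eq_univ_of_forall hs₁) (eq_univ_of_forall hs₂)
  have hprod : IsProdParam (E := E) Ψ e₁.symm e₂.symm σ := by
    refine ⟨hσ, fun y hy => ?_, fun y hy => ?_, fun y hy => ?_⟩ <;> rw [hsrc] at hy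
    · exact hy.1
    · exact hy.2
    · simp only [Ψ, e₁.right_inv hy.1, e₂.right_inv hy.2]
  have hd : ∀ (q : B × F) (v : EuclideanSpace ℝ (Fin a) × EuclideanSpace ℝ (Fin b)),
      prodmap (E := E) Ψ q v = dmap (E' := E) σ (e₁ q.1, e₂ q.2) v := by
    intro q v
    rw [dmap_prodParam hβ hκ hΨ.contMDiff hprod (hmem q)]
    simp only [dmap_singleChart_symm he₁, dmap_singleChart_symm he₂, e₁.left_inv (hs₁ q.1),
      e₂.left_inv (hs₂ q.2)]
    rfl
  have hχ : ∀ (q : B × F) (v : EuclideanSpace ℝ (Fin a) × EuclideanSpace ℝ (Fin b)),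
      mmap (E' := E') φ (Ψ q) (prodmap (E := E) Ψ q v) =
        dmap (E' := E') (fun y => φ (σ y)) (e₁ q.1, e₂ q.2) v := by
    intro q v
    rw [hd, hσ.dmap_comp (hmem q) hφ.contMDiff]
  refine ⟨a, b, B, iB₁, iB₂, iB₃, F, iF₁, iF₂, iF₃, singleChartMetric he₁ γ₁ hγ₁ hsymm₁ hnd₁,
    singleChartMetric he₂ γ₂ hγ₂ hsymm₂ hnd₂, fun s => f (e₁ s), Ψ, ?_, fun s => hpos _, hΨ, ?_, ?_,
    ?_, ?_, ?_, fun q => hlam _ (hmem q)⟩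
  · intro s
    exact (hf.contDiffAt (e₁.open_target.mem_nhds (e₁.map_source (hs₁ s)))).contMDiffAt.comp s
      (hβ.contMDiffOn_symm.contMDiffAt (e₁.open_source.mem_nhds (hs₁ s)))
  · intro q q' h
    have h1 := σ.injOn (hmem q) (hmem q') h
    exact Prod.ext (e₁.injOn (hs₁ _) (hs₁ _) (congrArg Prod.fst h1))
      (e₂.injOn (hs₂ _) (hs₂ _) (congrArg Prod.snd h1))
  · ext x
    refine ⟨?_, fun hx => ⟨(e₁.symm (σ.symm x).1, e₂.symm (σ.symm x).2), ?_⟩⟩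
    · rintro ⟨q, rfl⟩
      exact σ.map_source (hmem q)
    · rw [← hprod.apply_eq _ (σ.map_target hx), σ.right_inv hx]
  · refine fun q (v w : EuclideanSpace ℝ (Fin a) × EuclideanSpace ℝ (Fin b)) => ?_
    refine Eq.trans ?_ (warpedMetric_apply _ _ _ q v w).symm
    have h1 : metricAt g (φ (Ψ q)) (mmap (E' := E') φ (Ψ q) (prodmap (E := E) Ψ q v))
      (mmap (E' := E') φ (Ψ q) (prodmap (E := E) Ψ q w)) =
        coordMetric g (fun y => φ (σ y)) (e₁ q.1, e₂ q.2) v w := by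
      rw [hχ, hχ, coordMetric_apply]
    exact h1.trans (hsplit _ (hmem q) v w)
  · refine fun c x (v : EuclideanSpace ℝ (Fin a)) => ?_
    have hu := (had _ (hmem (x, c))).1 v
    have h1 := endAt_dmap_tangCoord hM hσ (hmem (x, c)) hu
    have h2 := (had _ (hmem (x, c))).snd_eq_zero hM hσ (hmem (x, c))
      (tangCoord_mem hM hσ (hmem (x, c)) hu)
    refine ⟨(tangCoord g J (fun y => φ (σ y)) (e₁ x, e₂ c) (v, 0)).1, ?_⟩
    have h3 : tangCoord g J (fun y => φ (σ y)) (e₁ x, e₂ c) (v, 0) =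
      ((tangCoord g J (fun y => φ (σ y)) (e₁ x, e₂ c) (v, 0)).1, 0) := Prod.ext rfl h2
    change endAt J (φ (Ψ (x, c))) (mmap (E := EuclideanSpace ℝ (Fin a)) (E' := E')
      (fun x : B => φ (Ψ (x, c))) x v) = mmap (E := EuclideanSpace ℝ (Fin a)) (E' := E')
      (fun x : B => φ (Ψ (x, c))) x _
    rw [mmap_slice_left hφ.contMDiff hΨ.contMDiff, mmap_slice_left hφ.contMDiff hΨ.contMDiff, hχ, hχ,
      ← h3]
    exact h1
  · refine fun x c (v w : EuclideanSpace ℝ (Fin b)) => ?_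
    change metricAt g (φ (Ψ (x, c))) (endAt J (φ (Ψ (x, c))) (mmap (E := EuclideanSpace ℝ (Fin b))
      (E' := E') (fun c : F => φ (Ψ (x, c))) c v)) (mmap (E := EuclideanSpace ℝ (Fin b)) (E' := E')
      (fun c : F => φ (Ψ (x, c))) c w) = 0
    rw [mmap_slice_right hφ.contMDiff hΨ.contMDiff, mmap_slice_right hφ.contMDiff hΨ.contMDiff, hd, hd]
    exact metricAt_endAt_mmap hM (mem_pullDist.1 ((had _ (hmem (x, c))).2 v)) _

end Construct

end PRSub

end

/-! ### Integration of the shape condition in adapted coordinates -/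

noncomputable section

namespace PRSub

theorem eq_of_fderiv_right_eq_zero {W₁ W₂ : Type*} [NormedAddCommGroup W₁] [NormedSpace ℝ W₁]
    [NormedAddCommGroup W₂] [NormedSpace ℝ W₂] {f : W₁ × W₂ → ℝ} {S₁ : Set W₁} {S₂ : Set W₂}
    (hS : IsOpen S₂) (hS' : IsPreconnected S₂) (hf : ∀ y ∈ S₁ ×ˢ S₂, DifferentiableAt ℝ f y)
    (h : ∀ y ∈ S₁ ×ˢ S₂, ∀ w, fderiv ℝ f y (0, w) = 0) {b : W₁} {c c' : W₂} (hb : b ∈ S₁)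
    (hc : c ∈ S₂) (hc' : c' ∈ S₂) : f (b, c) = f (b, c') := by
  have hd : ∀ c ∈ S₂, HasFDerivAt (fun c => f (b, c))
      (fderiv ℝ f (b, c) ∘L ContinuousLinearMap.inr ℝ W₁ W₂) c := fun c hc =>
    (hf (b, c) ⟨hb, hc⟩).hasFDerivAt.comp c (hasFDerivAt_prodMk_right b c)
  refine hS.is_const_of_fderiv_eq_zero (𝕜 := ℝ) hS' (f := fun c => f (b, c))
    (fun c hc => (hd c hc).differentiableAt.differentiableWithinAt) (fun c hc => ?_) hc hc'
  rw [(hd c hc).fderiv]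
  ext w
  exact h (b, c) ⟨hb, hc⟩ w

theorem eq_of_fderiv_left_eq_zero {W₁ W₂ : Type*} [NormedAddCommGroup W₁] [NormedSpace ℝ W₁]
    [NormedAddCommGroup W₂] [NormedSpace ℝ W₂] {f : W₁ × W₂ → ℝ} {S₁ : Set W₁} {S₂ : Set W₂}
    (hS : IsOpen S₁) (hS' : IsPreconnected S₁) (hf : ∀ y ∈ S₁ ×ˢ S₂, DifferentiableAt ℝ f y)
    (h : ∀ y ∈ S₁ ×ˢ S₂, ∀ v, fderiv ℝ f y (v, 0) = 0) {b b' : W₁} {c : W₂} (hb : b ∈ S₁)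
    (hb' : b' ∈ S₁) (hc : c ∈ S₂) : f (b, c) = f (b', c) := by
  have hd : ∀ b ∈ S₁, HasFDerivAt (fun b => f (b, c))
      (fderiv ℝ f (b, c) ∘L ContinuousLinearMap.inl ℝ W₁ W₂) b := fun b hb =>
    (hf (b, c) ⟨hb, hc⟩).hasFDerivAt.comp b (hasFDerivAt_prodMk_left b c)
  refine hS.is_const_of_fderiv_eq_zero (𝕜 := ℝ) hS' (f := fun b => f (b, c))
    (fun b hb => (hd b hb).differentiableAt.differentiableWithinAt) (fun b hb => ?_) hb hb'
  rw [(hd b hb).fderiv]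
  ext v
  exact h (b, c) ⟨hb, hc⟩ v

section Main

universe uM

variable {E : Type*} [NormedAddCommGroup E] [NormedSpace ℝ E] [FiniteDimensional ℝ E]
  {M : Type uM} [TopologicalSpace M] [ChartedSpace E M] [IsManifold 𝓘(ℝ, E) ∞ M]
  {E' : Type*} [NormedAddCommGroup E'] [NormedSpace ℝ E'] [FiniteDimensional ℝ E']
  {N : Type*} [TopologicalSpace N] [ChartedSpace E' N] [IsManifold 𝓘(ℝ, E') ∞ N]
  {g : PseudoRiemannianMetric E' N}
  {J : ∀ x : N, TangentSpace 𝓘(ℝ, E') x →L[ℝ] TangentSpace 𝓘(ℝ, E') x}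
  {φ : M → N} {D D' : ∀ x : M, Submodule ℝ (TangentSpace 𝓘(ℝ, E) x)}
  {W₁ : Type*} [NormedAddCommGroup W₁] [NormedSpace ℝ W₁] [FiniteDimensional ℝ W₁]
  {W₂ : Type*} [NormedAddCommGroup W₂] [NormedSpace ℝ W₂] [FiniteDimensional ℝ W₂]
  {σ : OpenPartialHomeomorph (W₁ × W₂) M} {z : W₁ × W₂} {μ : M → ℝ}

/-- Total geodesy of `D` applied to constant coordinate fields: the field derivative is zero and the
mixed block does not contribute, so the Christoffel symbol is half the derivative on the left. -/
theorem ShapeCondition.fderiv_coordMetric_left (hS : ShapeCondition g J φ D D' μ)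
    (hK : IsParaKahler g J) (hM : IsPRSubmanifold g J φ D D') (hσ : IsParam (E := E) σ)
    (hz : z ∈ σ.source) (had : ∀ᶠ y in 𝓝 z, IsAdapted D D' σ y) (u w : W₁) (v : W₂) :
    fderiv ℝ (coordMetric g (fun y => φ (σ y))) z (0, v) (u, 0) (w, 0) = 0 := by
  have had' := had.self_of_nhds
  have h := hS.coord_geodesic hK hM hσ hz (ζ := fun _ => (0, v)) contDiffAt_const
    (had.mono fun y hy => hy.2 v) (had'.1 u) (had'.1 w)
  rw [christoffelFirst, fderiv_coordMetric_cross had hK hM hσ hz,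
    fderiv_coordMetric_cross' had hK hM hσ hz] at h
  simp at h
  exact h

/-- Umbilicity of `D'` applied to constant coordinate fields. The factor `2` undoes the `1 / 2` in
the Christoffel symbol. -/
theorem ShapeCondition.fderiv_coordMetric_right (hS : ShapeCondition g J φ D D' μ)
    (hK : IsParaKahler g J) (hM : IsPRSubmanifold g J φ D D') (hσ : IsParam (E := E) σ)
    (hz : z ∈ σ.source) (had : ∀ᶠ y in 𝓝 z, IsAdapted D D' σ y) (v : W₁) (u w : W₂) :
    fderiv ℝ (coordMetric g (fun y => φ (σ y))) z (v, 0) (0, u) (0, w) =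
      -2 * fderiv ℝ (fun y => μ (σ y)) z (v, 0) *
        coordMetric g (fun y => φ (σ y)) z (0, u) (0, w) := by
  have had' := had.self_of_nhds
  have h := hS.coord_umbilical hK hM hσ hz (ζ := fun _ => (0, u)) (p := fun _ => (v, 0))
    contDiffAt_const (had.mono fun y hy => hy.2 u) (differentiableAt_const _)
    (had.mono fun y hy => hy.1 v) (had'.2 w)
  rw [christoffelFirst, fderiv_coordMetric_cross had hK hM hσ hz,
    fderiv_coordMetric_cross' had hK hM hσ hz, vderiv_dmap hS.contMDiff hσ hz] at h
  simp at h
  linarith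

theorem ShapeCondition.fderiv_comp_param (hS : ShapeCondition g J φ D D' μ)
    (hσ : IsParam (E := E) σ) (hz : z ∈ σ.source) (had : IsAdapted D D' σ z) (w : W₂) :
    fderiv ℝ (fun y => μ (σ y)) z (0, w) = 0 := by
  rw [← vderiv_dmap hS.contMDiff hσ hz]
  have h := mem_pullDist.1 (had.2 w)
  exact hS.vertical (σ z) _ h

theorem IsParam.restr {W : Type*} [NormedAddCommGroup W] [NormedSpace ℝ W]
    {σ : OpenPartialHomeomorph W M} (hσ : IsParam (E := E) σ) {S : Set W} (hS : IsOpen S) :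
    IsParam (E := E) (σ.restrOpen S hS) where
  contMDiffOn := hσ.contMDiffOn.mono fun _ hy => hy.1
  contMDiffOn_symm := hσ.contMDiffOn_symm.mono fun _ hy => hy.1

/-- In an adapted parametrization by a product of connected open sets the metric is a warped
product. -/
theorem ShapeCondition.coordMetric_split (hS : ShapeCondition g J φ D D' μ)
    (hK : IsParaKahler g J) (hM : IsPRSubmanifold g J φ D D') (hσ : IsParam (E := E) σ)
    {S₁ : Set W₁} {S₂ : Set W₂} (hS₁ : IsOpen S₁) (hS₂ : IsOpen S₂) (hc₁ : IsPreconnected S₁)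
    (hc₂ : IsPreconnected S₂) (hsrc : σ.source = S₁ ×ˢ S₂)
    (had : ∀ y ∈ σ.source, IsAdapted D D' σ y) {b₀ : W₁} {c₀ : W₂} (hb₀ : b₀ ∈ S₁)
    (hc₀ : c₀ ∈ S₂) {y : W₁ × W₂} (hy : y ∈ σ.source) :
    μ (σ y) = μ (σ (y.1, c₀)) ∧ ∀ u v, coordMetric g (fun y => φ (σ y)) y u v =
      coordMetric g (fun y => φ (σ y)) (y.1, c₀) (u.1, 0) (v.1, 0) +
      Real.exp (-μ (σ (y.1, c₀))) ^ 2 * (Real.exp (2 * μ (σ (b₀, c₀))) *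
        coordMetric g (fun y => φ (σ y)) (b₀, y.2) (0, u.2) (0, v.2)) := by
  have hφ := hM.toIsPseudoRiemannianSubmanifold
  have hev : ∀ y ∈ σ.source, ∀ᶠ y' in 𝓝 y, IsAdapted D D' σ y' := fun y hy => by
    filter_upwards [σ.open_source.mem_nhds hy] with y' hy' using had y' hy'
  have hμd : ∀ y ∈ σ.source, DifferentiableAt ℝ (fun y => μ (σ y)) y := fun y hy =>
    (contDiffAt_comp_param hS.contMDiff hσ hy).differentiableAt (by simp)
  have hγd := fun y (hy : y ∈ σ.source) => differentiableAt_coordMetric (g := g) hφ hσ hy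
  have hμ : ∀ b ∈ S₁, ∀ c ∈ S₂, μ (σ (b, c)) = μ (σ (b, c₀)) := fun b hb c hc =>
    eq_of_fderiv_right_eq_zero (f := fun y => μ (σ y)) hS₂ hc₂ (hsrc ▸ hμd)
      (fun y hy w => hS.fderiv_comp_param hσ (hsrc ▸ hy) (had y (hsrc ▸ hy)) w) hb hc hc₀
  have h1 : ∀ b ∈ S₁, ∀ c ∈ S₂, ∀ u w, coordMetric g (fun y => φ (σ y)) (b, c) (u, 0) (w, 0) =
      coordMetric g (fun y => φ (σ y)) (b, c₀) (u, 0) (w, 0) := fun b hb c hc u w => by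
    refine eq_of_fderiv_right_eq_zero
      (f := fun y => coordMetric g (fun y => φ (σ y)) y (u, 0) (w, 0)) hS₂ hc₂
      (fun y hy => (hasFDerivAt_apply_const (hγd y (hsrc ▸ hy)) _ _).differentiableAt)
      (fun y hy v => ?_) hb hc hc₀
    rw [(hasFDerivAt_apply_const (hγd y (hsrc ▸ hy)) _ _).fderiv]
    exact hS.fderiv_coordMetric_left hK hM hσ (hsrc ▸ hy) (hev y (hsrc ▸ hy)) u w v
  -- The factor `e^{2μ}` integrates the linear equation of
  -- `ShapeCondition.fderiv_coordMetric_right`: the product with the `D'`-block is constant along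
  -- the first factor.
  have h2 : ∀ b ∈ S₁, ∀ c ∈ S₂, ∀ u w, Real.exp (2 * μ (σ (b, c))) *
      coordMetric g (fun y => φ (σ y)) (b, c) (0, u) (0, w) = Real.exp (2 * μ (σ (b₀, c))) *
      coordMetric g (fun y => φ (σ y)) (b₀, c) (0, u) (0, w) := fun b hb c hc u w => by
    have hd : ∀ y ∈ S₁ ×ˢ S₂, HasFDerivAt (fun y => Real.exp (2 * μ (σ y)) *
        coordMetric g (fun y => φ (σ y)) y (0, u) (0, w)) _ y := fun y hy =>
      (((hμd y (hsrc ▸ hy)).hasFDerivAt.const_mul 2).exp).mul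
        (hasFDerivAt_apply_const (hγd y (hsrc ▸ hy)) (0, u) (0, w))
    refine eq_of_fderiv_left_eq_zero (f := fun y => Real.exp (2 * μ (σ y)) *
      coordMetric g (fun y => φ (σ y)) y (0, u) (0, w)) hS₁ hc₁
      (fun y hy => (hd y hy).differentiableAt) (fun y hy v => ?_) hb hb₀ hc
    rw [(hd y hy).fderiv]
    have h3 := hS.fderiv_coordMetric_right hK hM hσ (hsrc ▸ hy) (hev y (hsrc ▸ hy)) v u w
    simp only [add_apply, smul_apply, ContinuousLinearMap.flip_apply, smul_eq_mul, h3]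
    ring
  obtain ⟨b, c⟩ := y
  have hy' : (b, c) ∈ S₁ ×ˢ S₂ := hsrc ▸ hy
  obtain ⟨hb, hc⟩ := hy'
  refine ⟨hμ b hb c hc, fun u v => ?_⟩
  have hu : u = (u.1, 0) + (0, u.2) := by ext <;> simp
  have hv : v = (v.1, 0) + (0, v.2) := by ext <;> simp
  have h3 : coordMetric g (fun y => φ (σ y)) (b, c) u v =
      coordMetric g (fun y => φ (σ y)) (b, c) (u.1, 0) (v.1, 0) +
      coordMetric g (fun y => φ (σ y)) (b, c) (0, u.2) (0, v.2) := by
    conv_lhs => rw [hu, hv]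
    rw [map_add, map_add, add_apply, add_apply, (had _ hy).coordMetric_cross hK hM hσ hy,
      coordMetric_symm _ _ _ (0, u.2) (v.1, 0), (had _ hy).coordMetric_cross hK hM hσ hy]
    ring
  have h4 := h2 b hb c hc u.2 v.2
  rw [hμ b hb c hc, hμ b₀ hb₀ c hc] at h4
  rw [h3, h1 b hb c hc, ← h4, ← mul_assoc, ← Real.exp_nat_mul, ← Real.exp_add]
  simp

theorem IsAdapted.eq_zero_left (had : IsAdapted D D' σ z) (hK : IsParaKahler g J)
    (hM : IsPRSubmanifold g J φ D D') (hσ : IsParam (E := E) σ) (hz : z ∈ σ.source) {u : W₁}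
    (hu : ∀ v, coordMetric g (fun y => φ (σ y)) z (u, 0) (v, 0) = 0) : u = 0 := by
  have h : ((u, 0) : W₁ × W₂) = 0 :=
    coordMetric_nondegenerate (g := g) hM.toIsPseudoRiemannianSubmanifold hσ hz fun w => by
      have hw : w = (w.1, 0) + (0, w.2) := by ext <;> simp
      rw [hw, map_add, had.coordMetric_cross hK hM hσ hz, add_zero, hu]
  exact congrArg Prod.fst h

theorem IsAdapted.eq_zero_right (had : IsAdapted D D' σ z) (hK : IsParaKahler g J)
    (hM : IsPRSubmanifold g J φ D D') (hσ : IsParam (E := E) σ) (hz : z ∈ σ.source) {u : W₂}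
    (hu : ∀ v, coordMetric g (fun y => φ (σ y)) z (0, u) (0, v) = 0) : u = 0 := by
  have h : ((0, u) : W₁ × W₂) = 0 :=
    coordMetric_nondegenerate (g := g) hM.toIsPseudoRiemannianSubmanifold hσ hz fun w => by
      have hw : w = (w.1, 0) + (0, w.2) := by ext <;> simp
      rw [hw, map_add, coordMetric_symm, had.coordMetric_cross hK hM hσ hz, zero_add, hu]
  exact congrArg Prod.snd h

theorem ShapeCondition.isLocallyPRWarpedProduct (hS : ShapeCondition g J φ D D' μ)
    (hK : IsParaKahler g J) (hM : IsPRSubmanifold g J φ D D') :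
    IsLocallyPRWarpedProduct (E := E) g J φ (fun x => Real.exp (-μ x)) := by
  intro x
  have hφ := hM.toIsPseudoRiemannianSubmanifold
  obtain ⟨a, b, σ₀, ⟨b₀, c₀⟩, hσ₀, hz, rfl, had₀⟩ := hS.exists_adapted hK hM x
  have hsrc₀ : ∀ᶠ y in 𝓝 (b₀, c₀), y ∈ σ₀.source := σ₀.open_source.mem_nhds hz
  have hnhds := hsrc₀.and had₀
  -- A ball of the product is a product of balls, and balls are convex. This supplies the connected
  -- factors on which vanishing derivatives can be integrated.
  obtain ⟨r, hr, hball⟩ := Metric.eventually_nhds_iff_ball.1 hnhds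
  rw [← ball_prod_same] at hball
  let S₁ := Metric.ball b₀ r
  let S₂ := Metric.ball c₀ r
  have hb₀ : b₀ ∈ S₁ := Metric.mem_ball_self hr
  have hc₀ : c₀ ∈ S₂ := Metric.mem_ball_self hr
  have hS₁ : IsOpen S₁ := Metric.isOpen_ball
  have hS₂ : IsOpen S₂ := Metric.isOpen_ball
  let σ := σ₀.restrOpen (S₁ ×ˢ S₂) (hS₁.prod hS₂)
  have hσ : IsParam (E := E) σ := hσ₀.restr (hS₁.prod hS₂)
  have hsrc : σ.source = S₁ ×ˢ S₂ := inter_eq_right.2 fun y hy => (hball y hy).1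
  have had : ∀ y ∈ σ.source, IsAdapted D D' σ y := fun y hy => (hball y (hsrc ▸ hy)).2
  have hsplit := fun y (hy : y ∈ σ.source) => hS.coordMetric_split hK hM hσ hS₁ hS₂
    (convex_ball b₀ r).isPreconnected (convex_ball c₀ r).isPreconnected hsrc had hb₀ hc₀ hy
  have hm : ∀ b ∈ S₁, ∀ c ∈ S₂, (b, c) ∈ σ.source := fun b hb c hc => hsrc ▸ ⟨hb, hc⟩
  have hγs : ∀ y ∈ σ.source, ContDiffAt ℝ ∞ (coordMetric g (fun y => φ (σ y))) y := fun y hy =>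
    contDiffAt_coordMetric g (hσ.contMDiffAt_comp hy hφ.contMDiff)
  have hmem : (b₀, c₀) ∈ σ.source := hm b₀ hb₀ c₀ hc₀
  refine ⟨σ.target, σ.open_target, σ.map_source hmem,
    isPRWarpedProductOn_of_split hM hσ hS₁ hS₂ ⟨b₀, hb₀⟩ ⟨c₀, hc₀⟩ hsrc had
    (γ₁ := fun b => (coordMetric g (fun y => φ (σ y)) (b, c₀)).bilinearComp
      (ContinuousLinearMap.inl ℝ _ _) (ContinuousLinearMap.inl ℝ _ _))
    -- The constant `e^{2μ}` at the centre compensates the value of `f²` there, so that `f² γ₂`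
    -- restricts to the `D'`-block on the slice through `b₀`.
    (γ₂ := fun c => Real.exp (2 * μ (σ (b₀, c₀))) •
      (coordMetric g (fun y => φ (σ y)) (b₀, c)).bilinearComp
      (ContinuousLinearMap.inr ℝ _ _) (ContinuousLinearMap.inr ℝ _ _))
    (f := fun b => Real.exp (-μ (σ (b, c₀))))
    ?_ ?_ ?_ (fun _ => Real.exp_pos _) ?_ ?_ ?_ ?_ (fun y hy u v => (hsplit y hy).2 u v)
    (fun y hy => by rw [(hsplit y hy).1])⟩
  · intro b hb
    refine ContDiffAt.contDiffWithinAt ?_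
    refine contDiffAt_clm_apply_iff.2 fun u => contDiffAt_clm_apply_iff.2 fun v => ?_
    exact (((hγs (b, c₀) (hm b hb c₀ hc₀)).comp b
      (contDiffAt_id.prodMk contDiffAt_const)).clm_apply contDiffAt_const).clm_apply contDiffAt_const
  · intro c hc
    refine ContDiffAt.contDiffWithinAt (ContDiffAt.const_smul _ ?_)
    refine contDiffAt_clm_apply_iff.2 fun u => contDiffAt_clm_apply_iff.2 fun v => ?_
    exact (((hγs (b₀, c) (hm b₀ hb₀ c hc)).comp c
      (contDiffAt_const.prodMk contDiffAt_id)).clm_apply contDiffAt_const).clm_apply contDiffAt_const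
  · intro b hb
    exact (((contDiffAt_comp_param hS.contMDiff hσ (hm b hb c₀ hc₀)).comp b
      (contDiffAt_id.prodMk contDiffAt_const)).neg.exp).contDiffWithinAt
  · exact fun b _ u v => coordMetric_symm g (fun y => φ (σ y)) (b, c₀) (u, 0) (v, 0)
  · intro c _ u v
    have h := coordMetric_symm g (fun y => φ (σ y)) (b₀, c) (0, u) (0, v)
    exact congrArg (fun t => Real.exp (2 * μ (σ (b₀, c₀))) * t) h
  · exact fun b hb u hu => (had _ (hm b hb c₀ hc₀)).eq_zero_left hK hM hσ (hm b hb c₀ hc₀) hu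
  · exact fun c hc u hu => (had _ (hm b₀ hb₀ c hc)).eq_zero_right hK hM hσ (hm b₀ hb₀ c hc)
      fun w => (mul_eq_zero.1 (hu w)).resolve_left (Real.exp_ne_zero _)

end Main

end PRSub

end

theorem proposition3p9
    {E' : Type*} [NormedAddCommGroup E'] [NormedSpace ℝ E'] [FiniteDimensional ℝ E']
    {N : Type*} [TopologicalSpace N] [ChartedSpace E' N] [IsManifold 𝓘(ℝ, E') ∞ N]
    {E : Type*} [NormedAddCommGroup E] [NormedSpace ℝ E] [FiniteDimensional ℝ E]
    {M : Type*} [TopologicalSpace M] [ChartedSpace E M] [IsManifold 𝓘(ℝ, E) ∞ M]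
    (g : PRSub.PseudoRiemannianMetric E' N)
    (J : ∀ x : N, TangentSpace 𝓘(ℝ, E') x →L[ℝ] TangentSpace 𝓘(ℝ, E') x)
    (hK : PRSub.IsParaKahler g J)
    (φ : M → N) (D D' : ∀ x : M, Submodule ℝ (TangentSpace 𝓘(ℝ, E) x))
    (hM : PRSub.IsPRSubmanifold g J φ D D') (hproper : PRSub.IsProper D D') :
    -- a (global) warped product admits a function `μ` as required
    ((∃ lam : M → ℝ, PRSub.IsNonconstant lam ∧ PRSub.IsPRWarpedProduct (E := E) g J φ lam) →
      ∃ μ : M → ℝ, PRSub.IsNonconstant μ ∧ PRSub.ShapeCondition g J φ D D' μ) ∧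
    -- the characterization, with nonconstant warping functions
    ((∃ lam : M → ℝ, PRSub.IsNonconstant lam ∧ PRSub.IsLocallyPRWarpedProduct (E := E) g J φ lam) ↔
      ∃ μ : M → ℝ, PRSub.IsNonconstant μ ∧ PRSub.ShapeCondition g J φ D D' μ) ∧
    -- the characterization, with constant warping functions allowed
    ((∃ lam : M → ℝ, PRSub.IsLocallyPRWarpedProduct (E := E) g J φ lam) ↔
      ∃ μ : M → ℝ, PRSub.ShapeCondition g J φ D D' μ) := by
  -- Since `-log` is injective on positive numbers, two points separated by `λ` are separated by
  -- `μ`. Injectivity of the exponential does the same in the converse direction.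
  have hlocal : ∀ lam : M → ℝ, PRSub.IsNonconstant lam →
      PRSub.IsLocallyPRWarpedProduct (E := E) g J φ lam →
      ∃ μ : M → ℝ, PRSub.IsNonconstant μ ∧ PRSub.ShapeCondition g J φ D D' μ := by
    rintro lam ⟨x, y, hxy⟩ h
    obtain ⟨hpos, hS⟩ := h.shapeCondition hK hM
    exact ⟨_, ⟨x, y, fun h => hxy (Real.log_injOn_pos (hpos x) (hpos y) (neg_injective h))⟩, hS⟩
  refine ⟨?_, ⟨?_, ?_⟩, ?_, ?_⟩
  · rintro ⟨lam, hlam, h⟩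
    exact hlocal lam hlam fun x => ⟨univ, isOpen_univ, mem_univ x, h⟩
  · rintro ⟨lam, hlam, h⟩
    exact hlocal lam hlam h
  · rintro ⟨μ, ⟨x, y, hxy⟩, hS⟩
    exact ⟨_, ⟨x, y, fun h => hxy (neg_injective (Real.exp_injective h))⟩,
      hS.isLocallyPRWarpedProduct hK hM⟩
  · rintro ⟨lam, h⟩
    exact ⟨_, (h.shapeCondition hK hM).2⟩
  · rintro ⟨μ, hS⟩
    exact ⟨_, hS.isLocallyPRWarpedProduct hK hM⟩
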